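/- Let $R$ be a (unital, associative) ring with a $\mathbb{Z}$-basis $I$ such that the product of any two elements of $I$ is either zero or an element of $I$ (for example a group ring $\mathbb{Z}G$ with $I=G$, or $\mathrm{Mat}_n(\mathbb{Z})$ with the elementary matrices). Let $\mathcal{G}_\infty^{\mathbb{Q}}(R)=\bigotimes_{i\ge 1}U(\mathbb{Q}\otimes_{\mathbb Z} R)$ be the infinite tensor product (spanned by the pure tensors with almost all entries equal to $1$) of copies of the universal enveloping algebra of $\mathbb{Q}\otimes R$, viewed as a Lie algebra under the commutator, and let $T_i:\mathbb{Q}\otimes R\to\mathcal{G}_\infty^{\mathbb{Q}}(R)$ be the canonical map into the $i$-th factor. For a power series $x$ with coefficients in $\mathbb{Q}\otimes R$ and constant term $1$ put $\Theta_l(x)=\exp(T_l(\log x))$, where $T_l$ acts on the coefficients. For $U\in R$ define $e_r(U)\in\mathcal{G}_\infty^{\mathbb{Q}}(R)$ by \[ E_U(t)=\sum_{r\ge 0}e_r(U)t^r=\prod_{l\ge 1}\Theta_l\bigl(1-(-t)^lU\bigr), \] so that $E_0(t)=1$. Let $s_\lambda^{(U)}$ and $p_l^{(U)}$ denote the Schur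 functions and the power sums in a set of variables $\mathbf{x}_U$, one set for each $U\in I$. There is a unique family $(Z_{\vec\lambda})$ of elements of $\mathcal{G}_\infty^{\mathbb{Q}}(R)$, indexed by the families $\vec\lambda$ of partitions $(\vec\lambda(U))_{U\in I}$ that are empty for almost all $U$, such that \[ \sum_{\vec\lambda}\Bigl(\prod_{U\in I}s_{\vec\lambda(U)}^{(U)}\Bigr)\otimes Z_{\vec\lambda}=\prod_{l\ge 1}\Theta_l\Bigl(1+\sum_{U\in I}p_l^{(U)}U\Bigr). \] Let $\mathcal{G}_\infty^{\mathbb{Z}}(R)$ be the $\mathbb{Z}$-span of the $Z_{\vec\lambda}$. Then $\mathcal{G}_\infty^{\mathbb{Z}}(R)$ is a subring of $\mathcal{G}_\infty^{\mathbb{Q}}(R)$, it is generated as a ring by the $e_i(U)$ with $U\in I$ and $i\ge 1$, and the defining relations between these generators are the relations obtained, for all $U,V\in I$, by comparing the coefficients of the monomials in the commuting variables $u,v$ in \[ E_U(u)\,E_{VU}(-vu)^{-1}E_V(v)=E_V(v)\,E_{UV}(-uv)^{-1}E_U(u), \] where $E_0(t)=1$. That is, the quotient of the free ring on symbols $e_i(U)$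 ($i\ge 1$, $U\in I$) by the two-sided ideal generated by these relations is isomorphic to $\mathcal{G}_\infty^{\mathbb{Z}}(R)$, the symbol $e_i(U)$ being sent to the element $e_i(U)$. -/

import Mathlib

noncomputable section

namespace GInf

open scoped TensorProduct

/-! ### Power series with not necessarily commutative coefficients -/

section Series

variable {σ : Type*} {A : Type*} [Ring A] [Algebra ℚ A]

/-- `log (1 + x) = ∑_{n ≥ 1} (-1)^(n-1) x^n / n`, for a power series `x` with zero constant term.
Since then `x ^ n` has no terms of degree less than `n`, the coefficient at `m` only involves the
powers with `n ≤ deg m`. -/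
def logOneAdd (x : MvPowerSeries σ A) : MvPowerSeries σ A := fun m =>
  ∑ n ∈ Finset.Icc 1 m.degree, ((-1 : ℚ) ^ (n - 1) / (n : ℚ)) • MvPowerSeries.coeff m (x ^ n)

/-- `exp x = ∑_{n ≥ 0} x^n / n!`, for a power series `x` with zero constant term (the coefficient
at `m` only involves the powers with `n ≤ deg m`). -/
def expSeries (x : MvPowerSeries σ A) : MvPowerSeries σ A := fun m =>
  ∑ n ∈ Finset.range (m.degree + 1), ((n.factorial : ℚ)⁻¹) • MvPowerSeries.coeff m (x ^ n)

/-- The infinite product `F 1 * F 2 * F 3 * ⋯`, for factors such that `F l - 1` has no terms of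
degree less than `l` (the coefficient at `m` only involves the factors with `l ≤ deg m`). -/
def infProd (F : ℕ+ → MvPowerSeries σ A) : MvPowerSeries σ A := fun m =>
  MvPowerSeries.coeff m (((List.range m.degree).map fun k => F k.succPNat).prod)

end Series

/-! ### The rational algebra -/

section Rational

attribute [local instance 100] LieRing.ofAssociativeRing

variable (R : Type*) [Ring R]

/-- `ℚ ⊗ R`, a `ℚ`-algebra, regarded as a Lie algebra through the commutator bracket. -/
def RatExt : Type _ := ℚ ⊗[ℤ] R

instance : Ring (RatExt R) := inferInstanceAs (Ring (ℚ ⊗[ℤ] R))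

instance : Algebra ℚ (RatExt R) := inferInstanceAs (Algebra ℚ (ℚ ⊗[ℤ] R))

instance : LieRing (RatExt R) := LieRing.ofAssociativeRing

instance : LieAlgebra ℚ (RatExt R) := LieAlgebra.ofAssociativeAlgebra

variable {R} in
/-- The canonical map `R → ℚ ⊗ R`, `r ↦ 1 ⊗ r`. -/
def toRat (r : R) : RatExt R := (1 : ℚ) ⊗ₜ[ℤ] r

/-- `⨂_{i ≥ 1} U(ℚ ⊗ R)`, as a subalgebra of the tensor product of all the modules `U(ℚ ⊗ R)`:
the one generated by the factors, that is, spanned by the pure tensors `a₁ ⊗ a₂ ⊗ ⋯` in which all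
but finitely many `a_i` are `1`. -/
def GQSubalgebra :
    Subalgebra ℚ (⨂[ℚ] _ : ℕ+, UniversalEnvelopingAlgebra ℚ (RatExt R)) :=
  ⨆ i : ℕ+, (PiTensorProduct.singleAlgHom (R := ℚ)
    (A := fun _ : ℕ+ => UniversalEnvelopingAlgebra ℚ (RatExt R)) i).range

/-- The rational algebra `⨂_{i ≥ 1} U(ℚ ⊗ R)`. -/
def GQ : Type _ := GQSubalgebra R

instance : Ring (GQ R) := inferInstanceAs (Ring (GQSubalgebra R))

instance : Algebra ℚ (GQ R) := inferInstanceAs (Algebra ℚ (GQSubalgebra R))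

variable {R}

/-- `T_i : ℚ ⊗ R → ⨂ U(ℚ ⊗ R)`, the canonical map into the `i`-th tensor factor. -/
def T (i : ℕ+) : RatExt R →ₗ[ℚ] GQ R :=
  (((Subalgebra.inclusion (le_iSup (fun i : ℕ+ => (PiTensorProduct.singleAlgHom (R := ℚ)
      (A := fun _ : ℕ+ => UniversalEnvelopingAlgebra ℚ (RatExt R)) i).range) i)).comp
    (PiTensorProduct.singleAlgHom (R := ℚ)
      (A := fun _ : ℕ+ => UniversalEnvelopingAlgebra ℚ (RatExt R)) i).rangeRestrict).toLinearMap :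
    UniversalEnvelopingAlgebra ℚ (RatExt R) →ₗ[ℚ] GQSubalgebra R).comp
  (UniversalEnvelopingAlgebra.ι ℚ : RatExt R →ₗ⁅ℚ⁆ _).toLinearMap

/-- `T_l` applied to the coefficients of a power series. -/
def mapT {σ : Type*} (l : ℕ+) (x : MvPowerSeries σ (RatExt R)) : MvPowerSeries σ (GQ R) :=
  fun m => T l (MvPowerSeries.coeff m x)

/-- `Θ_l(1 + x) = exp (T_l (log (1 + x)))`, where `x` is a power series with coefficients in
`ℚ ⊗ R` and zero constant term. -/
def Theta {σ : Type*} (l : ℕ+) (x : MvPowerSeries σ (RatExt R)) : MvPowerSeries σ (GQ R) :=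
  expSeries (mapT l (logOneAdd x))

/-- `E_U(t) = ∏_{l ≥ 1} Θ_l(1 - (-t)^l U)`, for an arbitrary `U` in `R`. -/
def ESeries (U : R) : PowerSeries (GQ R) :=
  infProd fun l : ℕ+ =>
    Theta l (PowerSeries.monomial (l : ℕ) (-((-1 : ℚ) ^ (l : ℕ)) • toRat U))

/-- `e_r(U)`, the coefficient of `t^r` in `E_U(t)`. -/
def e (r : ℕ) (U : R) : GQ R := PowerSeries.coeff r (ESeries U)

end Rational

/-! ### Symmetric functions in variables `x_{U,0}, x_{U,1}, …`, one alphabet for each index `U` -/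

section Symmetric

variable {ι : Type*}

open Classical in
/-- The power sum `p_l = ∑_j x_{U,j}^l` in the alphabet of `U`. -/
def pSym (U : ι) (l : ℕ+) : MvPowerSeries (ι × ℕ) ℤ := fun m =>
  if ∃ j : ℕ, m = Finsupp.single (U, j) (l : ℕ) then 1 else 0

open Classical in
/-- The complete symmetric function `h_n` in the alphabet of `U`, the sum of all monomials of
degree `n` in the `x_{U,j}`; it is `0` for `n < 0`. -/
def hSym (U : ι) (n : ℤ) : MvPowerSeries (ι × ℕ) ℤ := fun m =>
  if (m.degree : ℤ) = n ∧ ∀ v ∈ m.support, v.1 = U then 1 else 0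

/-- The Schur function `s_μ = det (h_{μ_i - i + j})` (Jacobi-Trudi) in the alphabet of `U`, where
the size of the determinant is the number of rows of `μ`. -/
def schur (U : ι) (μ : YoungDiagram) : MvPowerSeries (ι × ℕ) ℤ :=
  Matrix.det (Matrix.of fun i j : Fin (μ.colLen 0) =>
    hSym U ((μ.rowLen i : ℤ) - (i : ℤ) + (j : ℤ)))

variable (ι) in
/-- Multipartitions: families of partitions indexed by `ι`, almost all of them empty. -/
def Multipartition : Type _ := {f : ι → YoungDiagram // {U | f U ≠ ⊥}.Finite}

/-- `∏_U s_{λ(U)}` with the factor of `U` in the alphabet of `U`. -/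
def multiSchur (lam : Multipartition ι) : MvPowerSeries (ι × ℕ) ℤ :=
  ∏ᶠ U, schur U (lam.1 U)

end Symmetric

/-! ### The integral form -/

section Integral

variable {R : Type*} [Ring R] {ι : Type*} (b : Module.Basis ι ℤ R)

/-- `∑_{U ∈ I} p_l^{(U)} U`, a power series with coefficients in `ℚ ⊗ R`. Each monomial occurs in
at most one of the `p_l^{(U)}`. -/
def pSum (l : ℕ+) : MvPowerSeries (ι × ℕ) (RatExt R) := fun m =>
  ∑ᶠ U, MvPowerSeries.coeff m (pSym U l) • toRat (b U)

/-- The generating function `∏_{l ≥ 1} exp (T_l (log (1 + ∑_{U ∈ I} p_l^{(U)} U)))`. -/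
def genFun : MvPowerSeries (ι × ℕ) (GQ R) := infProd fun l : ℕ+ => Theta l (pSum b l)

/-- The equality `∑_λ (∏_U s_{λ(U)}^{(U)}) ⊗ Z_λ = ∏_{l ≥ 1} exp (T_l (log (1 + ∑_U p_l^{(U)} U)))`,
coefficient by coefficient (each monomial occurs in finitely many of the products of Schur
functions, these being homogeneous of degree `|λ(U)|` in the alphabet of `U`). -/
def IsZFamily (Z : Multipartition ι → GQ R) : Prop :=
  ∀ m : ι × ℕ →₀ ℕ,
    ∑ᶠ lam : Multipartition ι, MvPowerSeries.coeff m (multiSchur lam) • Z lam =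
      MvPowerSeries.coeff m (genFun b)

/-- The elements `Z_λ`: the family that satisfies the equality `IsZFamily`. -/
def Z : Multipartition ι → GQ R := Classical.epsilon (IsZFamily b)

/-- The integral form: the `ℤ`-span of the `Z_λ`. -/
def GZ : Submodule ℤ (GQ R) := Submodule.span ℤ (Set.range (Z b))

end Integral

/-! ### The presentation -/

section Presentation

variable {A : Type*} [Ring A]

/-- For `E(t) = ∑ a_n t^n`, the series `E(x_k)` in the commuting variables `u = x_0`, `v = x_1`. -/
def inVar (k : Fin 2) (a : ℕ → A) : MvPowerSeries (Fin 2) A := fun m =>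
  if m = Finsupp.single k (m k) then a (m k) else 0

/-- For `E(t) = ∑ a_n t^n`, the series `E(-uv)`. -/
def negUV (a : ℕ → A) : MvPowerSeries (Fin 2) A := fun m =>
  if m 0 = m 1 then (-1) ^ (m 0) * a (m 0) else 0

/-- `E(-uv)⁻¹` for a series `E(t) = ∑ a_n t^n` with `a_0 = 1`. -/
def invNegUV (a : ℕ → A) : MvPowerSeries (Fin 2) A := MvPowerSeries.invOfUnit (negUV a) 1

variable {R : Type*} [Ring R] {ι : Type*} (b : Module.Basis ι ℤ R)

/-- The free generator that stands for `e_r(U)`, `U` the basis element with index `i`. -/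
def gen (r : ℕ+) (i : ι) : FreeAlgebra ℤ (ℕ+ × ι) := FreeAlgebra.ι ℤ (r, i)

open Classical in
/-- The coefficients of the formal series `E_W(t) = 1 + ∑_{r ≥ 1} e_r(W) t^r` over the free
algebra, where `W` is an element of the basis or zero; `E_0(t) = 1`. -/
def formalE (W : R) (n : ℕ) : FreeAlgebra ℤ (ℕ+ × ι) :=
  if hn : 0 < n then
    if hW : ∃ k, b k = W then gen ⟨n, hn⟩ hW.choose else 0
  else 1

/-- The relations obtained by comparing the coefficients of the monomials `m` in `u, v` on both
sides of `E_U(u) E_{VU}(-vu)⁻¹ E_V(v) = E_V(v) E_{UV}(-uv)⁻¹ E_U(u)`, for `U, V` in the basis. -/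
inductive Rel : FreeAlgebra ℤ (ℕ+ × ι) → FreeAlgebra ℤ (ℕ+ × ι) → Prop
  | comm (i j : ι) (m : Fin 2 →₀ ℕ) : Rel
      (MvPowerSeries.coeff m
        (inVar 0 (formalE b (b i)) * invNegUV (formalE b (b j * b i)) * inVar 1 (formalE b (b j))))
      (MvPowerSeries.coeff m
        (inVar 1 (formalE b (b j)) * invNegUV (formalE b (b i * b j)) * inVar 0 (formalE b (b i))))

/-- The ring with generators `e_r(U)` (`r ≥ 1`, `U` in the basis) and relations `Rel`. -/
abbrev Presented : Type _ := RingQuot (Rel b)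

end Presentation

end GInf

end

namespace GInf

set_option linter.unusedSectionVars false

noncomputable section

open MvPowerSeries Finset

/-! ### Series graded by an auxiliary variable, evaluated at 1 -/

section Tot

variable {σ : Type*} {B : Type*} [Ring B]

/-! The rational algebra acts on the polynomial ring over `ℚ` in variables `X_(l,i)`: `T_l(a)` acts
as multiplication by the linear form `X_l(a)` plus the derivation `X_l(c) ↦ X_l(a c)`. The value of
an operator at `1` is its symbol, `sym`. A word in the `T_l` of basis elements has as symbol the
corresponding monomial plus terms of lower degree, so `sym` is injective (`sym_injective`, a
substitute for the Poincaré-Birkhoff-Witt theorem), and every identity may be tested on symbols.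

On exponentials the action is transparent. If the symbol of `u` is `exp (∑ X_l(y_l))`, then
multiplying `u` on the left by `∏ Θ_l(1 + x_l)` replaces each `1 + y_l` by `(1 + x_l)(1 + y_l)`
(`hatSym_bigTheta_mul`). Identities between products of the series `E_U` thus become identities in
power series over `ℚ ⊗ R`, one for each `l`. The defining relations become `(1 + p)(1 - qp)⁻¹(1 + q)
= (1 + q)(1 - pq)⁻¹(1 + p)`, with `p` and `q` the increments that belong to `E_U(u)` and `E_V(v)`
(`inverse_conj`, `relation_e`).

For fixed `U` in the basis, the symbols of the `e_r(U)` are to the `l X_l(U)` as elementary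
symmetric functions are to power sums, so the symbols of all generators are algebraically
independent (`chi_injective`). Since the basis together with zero is closed under products,
expanding `(1 + x_1)⋯(1 + x_k)` only produces increments of the same shape. Hence the symbol of a
word in the generators is an integral polynomial in their symbols; its leading term, when `e_r(U)`
has weight `r`, is the expected monomial (`exists_sym_word`). In the presented ring the relations
make the generators commute up to lower weight (`commutator_mem`), so `bijective_of_triangular`
identifies that ring with the integral polynomials in the symbols. It therefore embeds in the
rational algebra, with image the elements whose symbol lies in the range of `chi`
(`injective_and_range_sym`).

The span of the `Z_λ` has the same description. The coefficient of the generating function at a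
monomial has as symbol a product of the complete analogues `eta` of the `e_r(U)`, and these generate
the same ring (`mem_span_coeff_genFun_iff`). These coefficients are symmetric in each alphabet, and
in each multidegree the Schur functions and the monomial symmetric functions are related by a matrix
invertible over `ℤ`. So the `Z_λ` exist, are unique, and span the same group as the coefficients
(`exists_schur_expansion`). -/

theorem coeff_rat_smul [Algebra ℚ B] (c : ℚ) (m : σ →₀ ℕ) (f : MvPowerSeries σ B) :
    coeff m (c • f) = c • coeff m f := rfl

/-- Setting `s = 1` in a power series in `s` over the power series in `σ`. -/
def tot (f : PowerSeries (MvPowerSeries σ B)) : MvPowerSeries σ B := fun m =>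
  ∑ n ∈ range (m.degree + 1), coeff m (PowerSeries.coeff n f)

/-- The coefficient of `s ^ n` has no terms of degree less than `n`. -/
def Admissible (f : PowerSeries (MvPowerSeries σ B)) : Prop :=
  ∀ n m, m.degree < n → coeff m (PowerSeries.coeff n f) = 0

theorem degree_le_of_mem_antidiagonal {m : σ →₀ ℕ} {p : (σ →₀ ℕ) × (σ →₀ ℕ)} [DecidableEq σ]
    (hp : p ∈ antidiagonal m) : p.1.degree ≤ m.degree ∧ p.2.degree ≤ m.degree := by
  rw [HasAntidiagonal.mem_antidiagonal] at hp
  subst hp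
  simp

theorem degree_add_of_mem_antidiagonal {m : σ →₀ ℕ} {p : (σ →₀ ℕ) × (σ →₀ ℕ)} [DecidableEq σ]
    (hp : p ∈ antidiagonal m) : p.1.degree + p.2.degree = m.degree := by
  rw [HasAntidiagonal.mem_antidiagonal] at hp
  subst hp
  simp

theorem coeff_tot {f : PowerSeries (MvPowerSeries σ B)} (hf : Admissible f) {m : σ →₀ ℕ} {N : ℕ}
    (hN : m.degree ≤ N) :
    coeff m (tot f) = ∑ n ∈ range (N + 1), coeff m (PowerSeries.coeff n f) := by
  change ∑ n ∈ range (m.degree + 1), coeff m (PowerSeries.coeff n f) = _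
  refine sum_subset (range_mono (by omega)) fun n _ hn => hf n m ?_
  simp at hn
  omega

theorem Admissible.mul {f g : PowerSeries (MvPowerSeries σ B)} (hf : Admissible f)
    (hg : Admissible g) : Admissible (f * g) := by
  classical
  intro n m h
  rw [PowerSeries.coeff_mul, map_sum]
  refine sum_eq_zero fun p hp => ?_
  rw [MvPowerSeries.coeff_mul]
  refine sum_eq_zero fun q hq => ?_
  have h1 := degree_add_of_mem_antidiagonal hq
  have h2 := HasAntidiagonal.mem_antidiagonal.1 hp
  by_cases h3 : q.1.degree < p.1
  · rw [hf _ _ h3, zero_mul]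
  · rw [hg _ _ (by omega), mul_zero]

/-- Evaluation at `s = 1` involves only finitely many terms at each monomial, and admissibility is
what makes this compatible with the Cauchy product. -/
theorem tot_mul {f g : PowerSeries (MvPowerSeries σ B)} (hf : Admissible f)
    (hg : Admissible g) : tot (f * g) = tot f * tot g := by
  classical
  ext m
  rw [coeff_tot (hf.mul hg) le_rfl, MvPowerSeries.coeff_mul]
  have key : ∀ q ∈ antidiagonal m, coeff q.1 (tot f) * coeff q.2 (tot g) =
      ∑ i ∈ range (m.degree + 1), ∑ j ∈ range (m.degree + 1),
        coeff q.1 (PowerSeries.coeff i f) * coeff q.2 (PowerSeries.coeff j g) := by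
    intro q hq
    rw [coeff_tot hf (degree_le_of_mem_antidiagonal hq).1,
      coeff_tot hg (degree_le_of_mem_antidiagonal hq).2, sum_mul_sum]
  rw [sum_congr rfl key, sum_comm]
  simp_rw [sum_comm (s := antidiagonal m), ← MvPowerSeries.coeff_mul]
  simp_rw [PowerSeries.coeff_mul, map_sum]
  rw [sum_sigma', ← sum_product']
  -- Terms with `i + j` beyond the degree of `m` vanish, so the square of index pairs can be cut
  -- down to the triangle over which the Cauchy product sums.
  have hz : ∀ i j, m.degree < i + j →
      coeff m (PowerSeries.coeff i f * PowerSeries.coeff j g) = 0 := by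
    intro i j h
    rw [MvPowerSeries.coeff_mul]
    refine sum_eq_zero fun q hq => ?_
    have h1 := degree_add_of_mem_antidiagonal hq
    by_cases h3 : q.1.degree < i
    · rw [hf _ _ h3, zero_mul]
    · rw [hg _ _ (by omega), mul_zero]
  symm
  rw [← sum_filter_add_sum_filter_not _ (fun p : ℕ × ℕ => p.1 + p.2 ≤ m.degree),
    sum_eq_zero (s := filter (fun p : ℕ × ℕ => ¬ (p.1 + p.2 ≤ m.degree)) _), add_zero]
  · refine sum_bij' (fun p _ => ⟨p.1 + p.2, p⟩) (fun p _ => p.2) ?_ ?_ ?_ ?_ ?_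
    · intro p hp
      simp at hp ⊢
      omega
    · rintro ⟨n, p⟩ hp
      simp at hp ⊢
      omega
    · simp
    · rintro ⟨n, p⟩ hp
      simp at hp
      simp [hp.2]
    · simp
  · intro p hp
    simp at hp
    exact hz _ _ (by omega)

theorem admissible_one : Admissible (1 : PowerSeries (MvPowerSeries σ B)) := by
  intro n m h
  rw [PowerSeries.coeff_one, if_neg (by omega), map_zero]

theorem tot_one : tot (1 : PowerSeries (MvPowerSeries σ B)) = 1 := by
  classical
  ext m
  change ∑ n ∈ range (m.degree + 1), coeff m (PowerSeries.coeff n _) = _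
  rw [sum_eq_single 0]
  · simp
  · intro n _ hn
    rw [PowerSeries.coeff_one, if_neg hn, map_zero]
  · simp

theorem Admissible.pow {f : PowerSeries (MvPowerSeries σ B)} (hf : Admissible f) (n : ℕ) :
    Admissible (f ^ n) := by
  induction n with
  | zero => rw [pow_zero]; exact admissible_one
  | succ n ih => rw [pow_succ]; exact ih.mul hf

theorem tot_pow {f : PowerSeries (MvPowerSeries σ B)} (hf : Admissible f) (n : ℕ) :
    tot (f ^ n) = tot f ^ n := by
  induction n with
  | zero => rw [pow_zero, pow_zero, tot_one]
  | succ n ih => rw [pow_succ, pow_succ, tot_mul (hf.pow n) hf, ih]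

theorem coeff_pow_eq_zero {σ : Type*} {f : MvPowerSeries σ B} (hf : constantCoeff f = 0) {n : ℕ}
    {m : σ →₀ ℕ} (h : m.degree < n) : coeff m (f ^ n) = 0 :=
  coeff_of_lt_order ((Nat.cast_lt.2 h).trans_le (le_order_pow_of_constantCoeff_eq_zero n hf))

variable [Algebra ℚ B]

/-- The exponential of a power series in one variable. -/
def expS (f : PowerSeries B) : PowerSeries B := PowerSeries.mk fun n =>
  ∑ j ∈ range (n + 1), ((j.factorial : ℚ)⁻¹) • PowerSeries.coeff n (f ^ j)

theorem coeff_pow_eq_zero' {f : PowerSeries B} (hf : PowerSeries.constantCoeff f = 0) {n m : ℕ}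
    (h : m < n) : PowerSeries.coeff m (f ^ n) = 0 := by
  refine coeff_pow_eq_zero (σ := Unit) hf ?_
  simpa [Finsupp.degree_single] using h

theorem coeff_expS {f : PowerSeries B} (hf : PowerSeries.constantCoeff f = 0) {n N : ℕ}
    (hn : n ≤ N) : PowerSeries.coeff n (expS f) =
      ∑ j ∈ range (N + 1), ((j.factorial : ℚ)⁻¹) • PowerSeries.coeff n (f ^ j) := by
  rw [expS, PowerSeries.coeff_mk]
  refine sum_subset (range_mono (by omega)) fun j _ hj => ?_
  rw [coeff_pow_eq_zero' hf (by simp at hj; omega), smul_zero]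

theorem coeff_expSeries {f : MvPowerSeries σ B} (hf : constantCoeff f = 0) {m : σ →₀ ℕ} {N : ℕ}
    (hN : m.degree ≤ N) : coeff m (expSeries f) =
      ∑ j ∈ range (N + 1), ((j.factorial : ℚ)⁻¹) • coeff m (f ^ j) := by
  change ∑ n ∈ range (m.degree + 1), ((n.factorial : ℚ)⁻¹) • coeff m (f ^ n) = _
  refine sum_subset (range_mono (by omega)) fun j _ hj => ?_
  rw [coeff_pow_eq_zero hf (by simp at hj; omega), smul_zero]

theorem constantCoeff_tot {f : PowerSeries (MvPowerSeries σ B)} :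
    constantCoeff (tot f) = constantCoeff (PowerSeries.constantCoeff f) := by
  change ∑ n ∈ range ((0 : σ →₀ ℕ).degree + 1), coeff 0 (PowerSeries.coeff n f) = _
  simp

theorem admissible_expS {f : PowerSeries (MvPowerSeries σ B)} (hf : Admissible f) :
    Admissible (expS f) := by
  intro n m h
  rw [expS, PowerSeries.coeff_mk, map_sum]
  refine sum_eq_zero fun j _ => ?_
  rw [coeff_rat_smul, hf.pow j n m h, smul_zero]

/-- This lets exponentials of multivariate series be computed by a recursion in the single variable
`s`, whatever the set of the other variables. -/
theorem tot_expS {f : PowerSeries (MvPowerSeries σ B)} (hf : Admissible f)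
    (h0 : PowerSeries.constantCoeff f = 0) : tot (expS f) = expSeries (tot f) := by
  ext m
  rw [coeff_tot (admissible_expS hf) le_rfl,
    coeff_expSeries (by rw [constantCoeff_tot, h0, map_zero]) le_rfl]
  have : ∀ n ∈ range (m.degree + 1), coeff m (PowerSeries.coeff n (expS f)) =
      ∑ j ∈ range (m.degree + 1),
        ((j.factorial : ℚ)⁻¹) • coeff m (PowerSeries.coeff n (f ^ j)) := by
    intro n hn
    rw [coeff_expS h0 (N := m.degree) (by simp at hn; omega), map_sum]
    simp_rw [coeff_rat_smul]
  rw [sum_congr rfl this, sum_comm]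
  refine sum_congr rfl fun j _ => ?_
  rw [← tot_pow hf, coeff_tot (hf.pow j) le_rfl, smul_sum]

end Tot

/-! ### The Euler operator and Newton's identities -/

section Euler

variable {B : Type*} [Ring B] [Algebra ℚ B]

/-- The Euler operator `s d/ds`. -/
def euler (f : PowerSeries B) : PowerSeries B := PowerSeries.mk fun n => n • PowerSeries.coeff n f

theorem coeff_euler (f : PowerSeries B) (n : ℕ) :
    PowerSeries.coeff n (euler f) = n • PowerSeries.coeff n f := PowerSeries.coeff_mk _ _

theorem euler_mul (f g : PowerSeries B) : euler (f * g) = euler f * g + f * euler g := by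
  ext n
  rw [coeff_euler, map_add, PowerSeries.coeff_mul, PowerSeries.coeff_mul, PowerSeries.coeff_mul,
    smul_sum, ← sum_add_distrib]
  refine sum_congr rfl fun p hp => ?_
  rw [coeff_euler, coeff_euler, ← HasAntidiagonal.mem_antidiagonal.1 hp, add_smul, smul_mul_assoc, mul_smul_comm]

theorem euler_pow_succ {f : PowerSeries B} (hf : Commute (euler f) f) (n : ℕ) :
    euler (f ^ (n + 1)) = (n + 1) • (euler f * f ^ n) := by
  induction n with
  | zero => simp
  | succ n ih =>
    rw [pow_succ, euler_mul, ih, add_smul (n + 1) 1, one_smul, pow_succ, smul_mul_assoc, mul_assoc,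
      ← pow_succ, (hf.pow_right (n + 1)).eq]

/-- The usual rule for differentiating an exponential; over a noncommutative ring it needs the
series to commute with its derivative. -/
theorem euler_expS {f : PowerSeries B} (h0 : PowerSeries.constantCoeff f = 0)
    (hf : Commute (euler f) f) : euler (expS f) = euler f * expS f := by
  ext n
  have e0 : PowerSeries.coeff 0 (euler f) = 0 := by simp [coeff_euler]
  -- One term more than necessary: once the term `j = 0` is split off, the shifted sum has the same
  -- range as the one on the right.
  rw [coeff_euler, coeff_expS h0 (N := n + 1) (by omega), PowerSeries.coeff_mul]
  have : ∀ p ∈ antidiagonal n, PowerSeries.coeff p.1 (euler f) * PowerSeries.coeff p.2 (expS f) =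
      ∑ j ∈ range (n + 1), ((j.factorial : ℚ)⁻¹) •
        (PowerSeries.coeff p.1 (euler f) * PowerSeries.coeff p.2 (f ^ j)) := by
    intro p hp
    rw [coeff_expS h0 (N := n) (by have := HasAntidiagonal.mem_antidiagonal.1 hp; omega), mul_sum]
    simp_rw [mul_smul_comm]
  rw [sum_congr rfl this, sum_comm]
  simp_rw [← smul_sum, ← PowerSeries.coeff_mul]
  rw [sum_range_succ', smul_add]
  have : n • (((0 : ℕ).factorial : ℚ)⁻¹ • PowerSeries.coeff n (f ^ 0)) = 0 := by
    rcases n with _ | n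
    · simp
    · simp [PowerSeries.coeff_one]
  rw [this, add_zero, smul_sum]
  refine sum_congr rfl fun j _ => ?_
  rw [smul_comm, ← coeff_euler, euler_pow_succ hf, map_nsmul, ← Nat.cast_smul_eq_nsmul ℚ, smul_smul]
  congr 1
  rw [Nat.factorial_succ]
  have : (j.factorial : ℚ) ≠ 0 := by positivity
  push_cast
  field_simp

theorem commute_of_coeff {f g : PowerSeries B}
    (h : ∀ i j, Commute (PowerSeries.coeff i f) (PowerSeries.coeff j g)) : Commute f g := by
  ext n
  rw [PowerSeries.coeff_mul, PowerSeries.coeff_mul, ← Finset.Nat.sum_antidiagonal_swap]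
  exact sum_congr rfl fun p _ => h _ _

/-- Newton's identities for the coefficients of the exponential. -/
theorem coeff_expS_newton {f : PowerSeries B} (h0 : PowerSeries.constantCoeff f = 0)
    (hf : ∀ i j, Commute (PowerSeries.coeff i f) (PowerSeries.coeff j f)) (n : ℕ) :
    n • PowerSeries.coeff n (expS f) =
      ∑ p ∈ antidiagonal n, p.1 • (PowerSeries.coeff p.1 f * PowerSeries.coeff p.2 (expS f)) := by
  rw [← coeff_euler, euler_expS h0, PowerSeries.coeff_mul]
  · simp_rw [coeff_euler, smul_mul_assoc]
  · exact commute_of_coeff fun i j => by rw [coeff_euler]; exact (hf i j).smul_left i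

theorem coeff_zero_expS (f : PowerSeries B) : PowerSeries.coeff 0 (expS f) = 1 := by
  simp [expS]

end Euler

/-! ### Exponentials over commutative rings -/

section Exp

variable {σ : Type*} {P : Type*} [CommRing P] [Algebra ℚ P]

theorem constantCoeff_expSeries {B : Type*} [Ring B] [Algebra ℚ B] (f : MvPowerSeries σ B) :
    constantCoeff (expSeries f) = 1 := by
  change ∑ n ∈ range ((0 : σ →₀ ℕ).degree + 1), ((n.factorial : ℚ)⁻¹) • coeff 0 (f ^ n) = _
  simp

theorem expSeries_zero {B : Type*} [Ring B] [Algebra ℚ B] :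
    expSeries (0 : MvPowerSeries σ B) = 1 := by
  ext m
  rw [coeff_expSeries (by simp) le_rfl, sum_eq_single 0]
  · simp
  · intro n _ hn
    simp [hn]
  · simp

/-- Grading each exponential by the number of factors turns the claim into the binomial theorem, one
power of `s` at a time. -/
theorem expSeries_add {f g : MvPowerSeries σ P} (hf : constantCoeff f = 0)
    (hg : constantCoeff g = 0) : expSeries (f + g) = expSeries f * expSeries g := by
  have hE : ∀ h : MvPowerSeries σ P,
      tot (PowerSeries.mk fun n => ((n.factorial : ℚ)⁻¹) • h ^ n) = expSeries h := by
    intro h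
    ext m
    change ∑ n ∈ range (m.degree + 1), coeff m (PowerSeries.coeff n _) = _
    simp_rw [PowerSeries.coeff_mk, coeff_rat_smul]
    rfl
  have hA : ∀ h : MvPowerSeries σ P, constantCoeff h = 0 →
      Admissible (PowerSeries.mk fun n => ((n.factorial : ℚ)⁻¹) • h ^ n) := by
    intro h hh n m hm
    rw [PowerSeries.coeff_mk, coeff_rat_smul, coeff_pow_eq_zero hh hm, smul_zero]
  rw [← hE, ← hE, ← hE, ← tot_mul (hA f hf) (hA g hg)]
  congr 1
  ext1 n
  rw [PowerSeries.coeff_mul, PowerSeries.coeff_mk, (Commute.all f g).add_pow', smul_sum]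
  refine sum_congr rfl fun p hp => ?_
  rw [PowerSeries.coeff_mk, PowerSeries.coeff_mk, smul_mul_smul_comm, ← HasAntidiagonal.mem_antidiagonal.1 hp,
    ← Nat.cast_smul_eq_nsmul ℚ, smul_smul]
  congr 1
  rw [Nat.cast_add_choose]
  have h1 : (p.1.factorial : ℚ) ≠ 0 := by positivity
  have h2 : (p.2.factorial : ℚ) ≠ 0 := by positivity
  have h3 : ((p.1 + p.2).factorial : ℚ) ≠ 0 := by positivity
  field_simp

end Exp

/-! ### Truncation by total degree -/

section Congr

variable {σ : Type*} {B : Type*} [Ring B]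

/-- Congruence modulo terms of degree greater than `N`. -/
def CongrUpTo (N : ℕ) (f g : MvPowerSeries σ B) : Prop := ∀ m, m.degree ≤ N → coeff m f = coeff m g

theorem CongrUpTo.rfl {N : ℕ} {f : MvPowerSeries σ B} : CongrUpTo N f f := fun _ _ => Eq.refl _

theorem CongrUpTo.symm {N : ℕ} {f g : MvPowerSeries σ B} (h : CongrUpTo N f g) :
    CongrUpTo N g f := fun m hm => (h m hm).symm

theorem CongrUpTo.trans {N : ℕ} {f g k : MvPowerSeries σ B} (h : CongrUpTo N f g)
    (h' : CongrUpTo N g k) : CongrUpTo N f k := fun m hm => (h m hm).trans (h' m hm)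

theorem CongrUpTo.mul {N : ℕ} {f g f' g' : MvPowerSeries σ B} (h : CongrUpTo N f f')
    (h' : CongrUpTo N g g') : CongrUpTo N (f * g) (f' * g') := by
  classical
  intro m hm
  rw [MvPowerSeries.coeff_mul, MvPowerSeries.coeff_mul]
  refine sum_congr (Eq.refl _) fun p hp => ?_
  have := degree_le_of_mem_antidiagonal hp
  rw [h _ (this.1.trans hm), h' _ (this.2.trans hm)]

theorem CongrUpTo.pow {N : ℕ} {f g : MvPowerSeries σ B} (h : CongrUpTo N f g) (n : ℕ) :
    CongrUpTo N (f ^ n) (g ^ n) := by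
  induction n with
  | zero => rw [pow_zero, pow_zero]; exact .rfl
  | succ n ih => rw [pow_succ, pow_succ]; exact ih.mul h

theorem eq_of_congrUpTo {f g : MvPowerSeries σ B} (h : ∀ N, CongrUpTo N f g) : f = g := by
  ext m
  exact h _ m le_rfl

variable [Algebra ℚ B]

theorem CongrUpTo.expSeries {N : ℕ} {f g : MvPowerSeries σ B} (h : CongrUpTo N f g) :
    CongrUpTo N (expSeries f) (expSeries g) := by
  intro m hm
  change ∑ n ∈ range (m.degree + 1), ((n.factorial : ℚ)⁻¹) • coeff m (f ^ n) =
    ∑ n ∈ range (m.degree + 1), ((n.factorial : ℚ)⁻¹) • coeff m (g ^ n)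
  refine sum_congr (Eq.refl _) fun n _ => ?_
  rw [h.pow n m hm]

theorem expSeries_congrUpTo {f : MvPowerSeries σ B} (hf : constantCoeff f = 0) {N M : ℕ}
    (h : N ≤ M) :
    CongrUpTo N (GInf.expSeries f) (∑ j ∈ range (M + 1), ((j.factorial : ℚ)⁻¹) • f ^ j) := by
  intro m hm
  rw [coeff_expSeries hf (hm.trans h), map_sum]
  simp_rw [coeff_rat_smul]

end Congr

end

end GInf

/-! ### The polynomial representation and the symbol map -/

namespace GInf

set_option linter.unusedSectionVars false

noncomputable section

open scoped TensorProduct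

attribute [local instance 100] LieRing.ofAssociativeRing

/-- By the universal property, the identity factors through the subalgebra generated by the image of
the Lie algebra. -/
theorem adjoin_range_ueaι {L : Type*} [LieRing L] [LieAlgebra ℚ L] :
    Algebra.adjoin ℚ (Set.range (UniversalEnvelopingAlgebra.ι ℚ : L →ₗ⁅ℚ⁆ _)) = ⊤ := by
  let g : L →ₗ⁅ℚ⁆ UniversalEnvelopingAlgebra ℚ L := UniversalEnvelopingAlgebra.ι ℚ
  let S := Algebra.adjoin ℚ (Set.range g)
  let f : L →ₗ⁅ℚ⁆ S :=
    { toFun := fun x => ⟨g x, Algebra.subset_adjoin ⟨x, rfl⟩⟩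
      map_add' := fun x y => Subtype.ext (map_add g x y)
      map_smul' := fun c x => Subtype.ext (map_smul g c x)
      map_lie' := fun {x y} => Subtype.ext (LieHom.map_lie g x y) }
  have h : S.val.comp (UniversalEnvelopingAlgebra.lift ℚ f) =
      AlgHom.id ℚ (UniversalEnvelopingAlgebra ℚ L) := by
    refine UniversalEnvelopingAlgebra.hom_ext (R := ℚ) (L := L) (A := UniversalEnvelopingAlgebra ℚ L) ?_
    ext x
    change (UniversalEnvelopingAlgebra.lift ℚ f (UniversalEnvelopingAlgebra.ι ℚ x) :
      UniversalEnvelopingAlgebra ℚ L) = _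
    rw [UniversalEnvelopingAlgebra.lift_ι_apply]
    rfl
  refine eq_top_iff.2 fun u _ => ?_
  have := DFunLike.congr_fun h u
  change (UniversalEnvelopingAlgebra.lift ℚ f u : UniversalEnvelopingAlgebra ℚ L) = u at this
  rw [← this]
  exact Subtype.property _

section Fock

variable {R : Type*} [Ring R] {ι : Type*} (β : Module.Basis ι ℚ (RatExt R))

/-- The linear form `X_l` on `ℚ ⊗ R`, with values in the polynomial ring. -/
def fockX (l : ℕ+) : RatExt R →ₗ[ℚ] MvPolynomial (ℕ+ × ι) ℚ :=
  β.constr ℚ fun i => MvPolynomial.X (l, i)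

theorem fockX_basis (l : ℕ+) (i : ι) : fockX β l (β i) = MvPolynomial.X (l, i) := by
  simp [fockX]

/-- The derivation `X_l(c) ↦ X_l(a c)`, which kills `X_k(c)` for `k ≠ l`. -/
def fockD (l : ℕ+) (a : RatExt R) :
    Derivation ℚ (MvPolynomial (ℕ+ × ι) ℚ) (MvPolynomial (ℕ+ × ι) ℚ) :=
  MvPolynomial.mkDerivation ℚ fun j => if j.1 = l then fockX β l (a * β j.2) else 0

theorem fockD_fockX (l : ℕ+) (a c : RatExt R) : fockD β l a (fockX β l c) = fockX β l (a * c) := by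
  have : (fockD β l a).toLinearMap ∘ₗ fockX β l =
      fockX β l ∘ₗ LinearMap.mulLeft ℚ a := by
    refine β.ext fun i => ?_
    simp [fockX_basis, fockD, MvPolynomial.mkDerivation_X]
  exact DFunLike.congr_fun this c

theorem fockD_fockX_of_ne {l k : ℕ+} (h : k ≠ l) (a c : RatExt R) :
    fockD β l a (fockX β k c) = 0 := by
  have : (fockD β l a).toLinearMap ∘ₗ fockX β k = 0 := by
    refine β.ext fun i => ?_
    simp [fockX_basis, fockD, MvPolynomial.mkDerivation_X, h]
  exact DFunLike.congr_fun this c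

theorem fockD_add (l : ℕ+) (a c : RatExt R) : fockD β l (a + c) = fockD β l a + fockD β l c := by
  refine MvPolynomial.derivation_ext fun j => ?_
  rw [Derivation.add_apply]
  simp only [fockD, MvPolynomial.mkDerivation_X]
  split_ifs
  · rw [add_mul, map_add]
  · simp

theorem fockD_smul (l : ℕ+) (r : ℚ) (a : RatExt R) : fockD β l (r • a) = r • fockD β l a := by
  refine MvPolynomial.derivation_ext fun j => ?_
  rw [Derivation.smul_apply]
  simp only [fockD, MvPolynomial.mkDerivation_X]
  split_ifs
  · rw [smul_mul_assoc, map_smul]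
  · simp

/-- Both sides are derivations, and on the variables the claim is associativity, since left
multiplications compose. -/
theorem fockD_lie (l : ℕ+) (a c : RatExt R) (f : MvPolynomial (ℕ+ × ι) ℚ) :
    fockD β l (a * c - c * a) f =
      fockD β l a (fockD β l c f) - fockD β l c (fockD β l a f) := by
  have : fockD β l (a * c - c * a) = ⁅fockD β l a, fockD β l c⁆ := by
    refine MvPolynomial.derivation_ext fun j => ?_
    rw [Derivation.commutator_apply]
    obtain ⟨k, i⟩ := j
    by_cases h : k = l
    · subst h
      rw [← fockX_basis β, fockD_fockX, fockD_fockX, fockD_fockX, fockD_fockX, fockD_fockX,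
        ← map_sub, sub_mul, mul_assoc, mul_assoc]
    · rw [← fockX_basis β]
      simp [fockD_fockX_of_ne β h]
  rw [this, Derivation.commutator_apply]

/-- The action `X_l(a) + D_{l,a}` of `ℚ ⊗ R` on the polynomial ring. -/
def fockL (l : ℕ+) : RatExt R →ₗ⁅ℚ⁆ Module.End ℚ (MvPolynomial (ℕ+ × ι) ℚ) where
  toFun a := LinearMap.mulLeft ℚ (fockX β l a) + (fockD β l a).toLinearMap
  map_add' a c := by
    refine LinearMap.ext fun f => ?_
    simp only [LinearMap.add_apply, LinearMap.mulLeft_apply, Derivation.coeFn_coe, map_add,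
      fockD_add, Derivation.add_apply]
    ring
  map_smul' r a := by
    refine LinearMap.ext fun f => ?_
    simp only [LinearMap.add_apply, LinearMap.mulLeft_apply, Derivation.coeFn_coe, map_smul,
      fockD_smul, Derivation.smul_apply, LinearMap.smul_apply, smul_add, smul_mul_assoc,
      RingHom.id_apply]
  map_lie' {a c} := by
    refine LinearMap.ext fun f => ?_
    rw [LieRing.of_associative_ring_bracket, LieRing.of_associative_ring_bracket]
    simp only [LinearMap.add_apply, LinearMap.sub_apply, Module.End.mul_apply,
      LinearMap.mulLeft_apply, Derivation.coeFn_coe, map_add, Derivation.leibniz, fockD_fockX,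
      smul_eq_mul, map_sub, fockD_lie]
    ring

theorem fockL_apply (l : ℕ+) (a : RatExt R) (f : MvPolynomial (ℕ+ × ι) ℚ) :
    fockL β l a f = fockX β l a * f + fockD β l a f := rfl

/-- The action of the enveloping algebra on the polynomial ring. -/
def fockU (l : ℕ+) : UniversalEnvelopingAlgebra ℚ (RatExt R) →ₐ[ℚ]
    Module.End ℚ (MvPolynomial (ℕ+ × ι) ℚ) :=
  UniversalEnvelopingAlgebra.lift ℚ (fockL β l)

theorem fockU_ι (l : ℕ+) (a : RatExt R) :
    fockU β l (UniversalEnvelopingAlgebra.ι ℚ a) = fockL β l a :=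
  UniversalEnvelopingAlgebra.lift_ι_apply ℚ _ a

/-- The operators of the `k`-th factor commute with the derivation `D_(l,a)`, which it suffices to
see on generators, and `D_(l,a)` kills `1`. -/
theorem fockD_fockU_one {l k : ℕ+} (h : k ≠ l) (a : RatExt R)
    (u : UniversalEnvelopingAlgebra ℚ (RatExt R)) : fockD β l a (fockU β k u 1) = 0 := by
  have hu : u ∈ (Subalgebra.centralizer ℚ
      {(fockD β l a : MvPolynomial (ℕ+ × ι) ℚ →ₗ[ℚ] MvPolynomial (ℕ+ × ι) ℚ)}).comap
        (fockU β k) := by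
    have : u ∈ Algebra.adjoin ℚ (Set.range
        (UniversalEnvelopingAlgebra.ι ℚ : RatExt R →ₗ⁅ℚ⁆ _)) := by
      rw [adjoin_range_ueaι]; trivial
    refine Algebra.adjoin_le ?_ this
    rintro _ ⟨c, rfl⟩
    change fockU β k _ ∈ Subalgebra.centralizer ℚ _
    rw [Subalgebra.mem_centralizer_iff]
    rintro _ rfl
    rw [fockU_ι]
    refine LinearMap.ext fun f => ?_
    simp only [Module.End.mul_apply, fockL_apply, Derivation.coeFn_coe, map_add,
      Derivation.leibniz, fockD_fockX_of_ne β h, smul_eq_mul, mul_zero, add_zero]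
    congr 1
    have : ⁅fockD β l a, fockD β k c⁆ = 0 := by
      refine MvPolynomial.derivation_ext fun j => ?_
      obtain ⟨m, i⟩ := j
      rw [Derivation.commutator_apply, ← fockX_basis β]
      by_cases h1 : m = l
      · subst h1
        rw [fockD_fockX, fockD_fockX_of_ne β h.symm, fockD_fockX_of_ne β h.symm]
        simp
      · rw [fockD_fockX_of_ne β h1]
        by_cases h2 : m = k
        · subst h2
          rw [fockD_fockX, fockD_fockX_of_ne β h]
          simp
        · rw [fockD_fockX_of_ne β h2]
          simp
    have := DFunLike.congr_fun this f
    rw [Derivation.commutator_apply, Derivation.zero_apply, sub_eq_zero] at this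
    exact this
  have := DFunLike.congr_fun ((Subalgebra.mem_centralizer_iff ℚ).1 hu _ rfl) 1
  simpa using this

open Classical in
/-- The product of the vacuum values of the factors of a pure tensor other than the `i`-th. -/
def vacRest (f : ℕ+ → UniversalEnvelopingAlgebra ℚ (RatExt R)) (i : ℕ+) :
    MvPolynomial (ℕ+ × ι) ℚ :=
  if {l | l ≠ i ∧ f l ≠ 1}.Finite then ∏ᶠ l, if l = i then 1 else fockU β l (f l) 1 else 0

open Classical in
/-- The product of the vacuum values of the factors of a pure tensor, almost all of them `1`. -/
def vacFun (f : ℕ+ → UniversalEnvelopingAlgebra ℚ (RatExt R)) : MvPolynomial (ℕ+ × ι) ℚ :=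
  if {l | f l ≠ 1}.Finite then ∏ᶠ l, fockU β l (f l) 1 else 0

/-- Changing one entry does not affect whether almost all entries are `1`. The default value `0` on
the other pure tensors is therefore compatible with multilinearity, and the value is linear in the
entry that varies. -/
theorem vacFun_update [DecidableEq ℕ+] (f : ℕ+ → UniversalEnvelopingAlgebra ℚ (RatExt R)) (i : ℕ+)
    (x : UniversalEnvelopingAlgebra ℚ (RatExt R)) :
    vacFun β (Function.update f i x) = fockU β i x 1 * vacRest β f i := by
  have hfin : {l | Function.update f i x l ≠ 1}.Finite ↔ {l | l ≠ i ∧ f l ≠ 1}.Finite := by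
    constructor
    · refine fun h => h.subset ?_
      rintro l ⟨h1, h2⟩
      simpa [Function.update_of_ne h1] using h2
    · refine fun h => (h.insert i).subset ?_
      intro l hl
      by_cases h1 : l = i
      · exact Or.inl h1
      · exact Or.inr ⟨h1, by simpa [Function.update_of_ne h1] using hl⟩
  unfold vacFun vacRest
  by_cases h : {l | l ≠ i ∧ f l ≠ 1}.Finite
  · rw [if_pos h, if_pos (hfin.2 h), ← finprod_eq_single (fun l => if l = i then fockU β i x 1 else 1)
      i (fun l hl => if_neg hl) |>.trans (if_pos rfl), ← finprod_mul_distrib]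
    · refine finprod_congr fun l => ?_
      by_cases h1 : l = i
      · subst h1; simp
      · simp [h1]
    · refine (Set.finite_singleton i).subset fun l hl => ?_
      by_contra h1
      exact hl (if_neg h1)
    · refine h.subset fun l hl => ⟨fun h1 => hl (if_pos h1), fun h1 => hl ?_⟩
      simp [h1]
  · rw [if_neg h, if_neg (fun h1 => h (hfin.1 h1)), mul_zero]

/-- The vacuum values of pure tensors, as a multilinear map. -/
def vacMultilinear : MultilinearMap ℚ
    (fun _ : ℕ+ => UniversalEnvelopingAlgebra ℚ (RatExt R)) (MvPolynomial (ℕ+ × ι) ℚ) where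
  toFun := vacFun β
  map_update_add' f i x y := by
    rw [vacFun_update, vacFun_update, vacFun_update, map_add, LinearMap.add_apply, add_mul]
  map_update_smul' f i c x := by
    rw [vacFun_update, vacFun_update, map_smul, LinearMap.smul_apply, smul_mul_assoc]

theorem fockD_vacRest (f : ℕ+ → UniversalEnvelopingAlgebra ℚ (RatExt R)) (i : ℕ+) (a : RatExt R) :
    fockD β i a (vacRest β f i) = 0 := by
  unfold vacRest
  split_ifs with h
  · refine finprod_induction (fun p => fockD β i a p = 0) (by simp) ?_ ?_
    · intro p q hp hq
      rw [Derivation.leibniz, hp, hq, smul_zero, smul_zero, add_zero]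
    · intro l
      split_ifs with h1
      · simp
      · exact fockD_fockU_one β h1 a _
  · simp

/-- The value on the vacuum. -/
def sym : GQ R →ₗ[ℚ] MvPolynomial (ℕ+ × ι) ℚ :=
  (PiTensorProduct.lift (vacMultilinear β)).comp (GQSubalgebra R).val.toLinearMap

theorem sym_one : sym β (1 : GQ R) = 1 := by
  change PiTensorProduct.lift (vacMultilinear β) (1 : ⨂[ℚ] _ : ℕ+, _) = 1
  rw [PiTensorProduct.one_def, PiTensorProduct.lift.tprod]
  change vacFun β _ = 1
  unfold vacFun
  simp

theorem coe_T (l : ℕ+) (a : RatExt R) : (GQSubalgebra R).val (T l a) =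
    PiTensorProduct.singleAlgHom (R := ℚ)
      (A := fun _ : ℕ+ => UniversalEnvelopingAlgebra ℚ (RatExt R)) l
      (UniversalEnvelopingAlgebra.ι ℚ a) := rfl

/-- On a pure tensor the vacuum value is the product of the value of the `l`-th factor and the rest.
The derivation kills the rest (`fockD_vacRest`), so acting on the `l`-th factor alone is the same as
acting on the whole product. -/
theorem sym_T_mul (l : ℕ+) (a : RatExt R) (u : GQ R) :
    sym β (T l a * u) = fockX β l a * sym β u + fockD β l a (sym β u) := by
  change PiTensorProduct.lift (vacMultilinear β) ((GQSubalgebra R).val (T l a) *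
    (GQSubalgebra R).val u) = fockL β l a (PiTensorProduct.lift (vacMultilinear β)
      ((GQSubalgebra R).val u))
  rw [coe_T]
  generalize (GQSubalgebra R).val u = v
  induction v using PiTensorProduct.induction_on with
  | smul_tprod r f =>
    rw [mul_smul_comm, map_smul, map_smul, map_smul]
    congr 1
    have h1 : PiTensorProduct.singleAlgHom (R := ℚ)
        (A := fun _ : ℕ+ => UniversalEnvelopingAlgebra ℚ (RatExt R)) l
        (UniversalEnvelopingAlgebra.ι ℚ a) * PiTensorProduct.tprod ℚ f =
        PiTensorProduct.tprod ℚ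
          (Function.update f l (UniversalEnvelopingAlgebra.ι ℚ a * f l)) := by
      change PiTensorProduct.tprod ℚ _ * PiTensorProduct.tprod ℚ f = _
      rw [PiTensorProduct.tprod_mul_tprod]
      congr 1
      ext k
      by_cases h : k = l
      · subst h; simp
      · simp [h]
    have h2 : PiTensorProduct.tprod ℚ f =
        PiTensorProduct.tprod ℚ (Function.update f l (f l)) := by
      rw [Function.update_eq_self]
    rw [h1, h2, PiTensorProduct.lift.tprod, PiTensorProduct.lift.tprod]
    change vacFun β _ = fockL β l a (vacFun β _)
    rw [vacFun_update, vacFun_update, map_mul, Module.End.mul_apply, fockU_ι, fockL_apply,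
      fockL_apply, Derivation.leibniz, fockD_vacRest]
    simp only [smul_eq_mul]
    ring
  | add x y hx hy => rw [mul_add, map_add, map_add, map_add, hx, hy]

theorem T_mul_sub (l : ℕ+) (a c : RatExt R) :
    T l a * T l c - T l c * T l a = T l (a * c - c * a) := by
  have h : ∀ x y : GQ R, (GQSubalgebra R).val x = (GQSubalgebra R).val y → x = y :=
    fun x y h => Subtype.ext h
  refine h _ _ ?_
  have h2 : (GQSubalgebra R).val (T l a * T l c - T l c * T l a) =
    (GQSubalgebra R).val (T l a) * (GQSubalgebra R).val (T l c) -
      (GQSubalgebra R).val (T l c) * (GQSubalgebra R).val (T l a) := rfl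
  rw [h2, coe_T, coe_T, coe_T, ← map_mul (PiTensorProduct.singleAlgHom _), ← map_mul (PiTensorProduct.singleAlgHom _),
    ← map_sub (PiTensorProduct.singleAlgHom _)]
  congr 1
  exact (LieHom.map_lie (UniversalEnvelopingAlgebra.ι ℚ :
    RatExt R →ₗ⁅ℚ⁆ UniversalEnvelopingAlgebra ℚ (RatExt R)) a c).symm

theorem T_commute {l k : ℕ+} (h : l ≠ k) (a c : RatExt R) : Commute (T l a) (T k c) := by
  have h' : ∀ x y : GQ R, (GQSubalgebra R).val x = (GQSubalgebra R).val y → x = y :=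
    fun x y h => Subtype.ext h
  refine h' _ _ ?_
  change (GQSubalgebra R).val (T l a) * (GQSubalgebra R).val (T k c) =
      (GQSubalgebra R).val (T k c) * (GQSubalgebra R).val (T l a)
  rw [coe_T, coe_T]
  exact (Pi.mulSingle_commute (f := fun _ : ℕ+ => UniversalEnvelopingAlgebra ℚ (RatExt R))
    h _ _).tprod

theorem adjoin_T : Algebra.adjoin ℚ {u : GQ R | ∃ l a, T l a = u} = ⊤ := by
  refine eq_top_iff.2 fun u _ => ?_
  suffices H : ∀ v (hv : v ∈ GQSubalgebra R), (⟨v, hv⟩ : GQSubalgebra R) ∈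
      (Algebra.adjoin ℚ {u : GQ R | ∃ l a, T l a = u} : Subalgebra ℚ (GQSubalgebra R)) from
    H u.1 u.2
  set S : Subalgebra ℚ (GQSubalgebra R) := Algebra.adjoin ℚ {u : GQ R | ∃ l a, T l a = u} with hS
  suffices H : GQSubalgebra R ≤ S.map (GQSubalgebra R).val by
    intro v hv
    obtain ⟨w, hw, rfl⟩ := H hv
    exact hw
  refine iSup_le fun l => ?_
  rw [← Algebra.map_top, ← adjoin_range_ueaι, AlgHom.map_adjoin]
  refine Algebra.adjoin_le ?_
  rintro _ ⟨_, ⟨a, rfl⟩, rfl⟩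
  exact ⟨T l a, Algebra.subset_adjoin ⟨l, a, rfl⟩, rfl⟩

end Fock

end

end GInf

namespace GInf

set_option linter.unusedSectionVars false

noncomputable section

/-! ### Straightening of words and triangular maps -/

section Straightening

variable {K B J : Type*} [CommRing K] [Ring B] [Algebra K B] (g : J → B) (w : J → ℕ)

/-- The weight of a word. -/
def wordWeight (l : List J) : ℕ := (l.map w).sum

/-- The span of the words of weight less than `n` in the elements `g j`. -/
def wordsBelow (K : Type*) {B J : Type*} [CommRing K] [Ring B] [Algebra K B] (g : J → B) (w : J → ℕ)
    (n : ℕ) : Submodule K B :=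
  Submodule.span K {x | ∃ l : List J, wordWeight w l < n ∧ (l.map g).prod = x}

theorem wordWeight_append (l l' : List J) :
    wordWeight w (l ++ l') = wordWeight w l + wordWeight w l' := by
  simp [wordWeight]

theorem wordWeight_cons (j : J) (l : List J) :
    wordWeight w (j :: l) = w j + wordWeight w l := by
  simp [wordWeight]

variable {g w}

theorem wordsBelow_mono {m n : ℕ} (h : m ≤ n) : wordsBelow K g w m ≤ wordsBelow K g w n := by
  refine Submodule.span_mono ?_
  rintro _ ⟨l, hl, rfl⟩
  exact ⟨l, hl.trans_le h, rfl⟩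

theorem mul_word_mem_wordsBelow {n : ℕ} {x : B} (hx : x ∈ wordsBelow K g w n) (l : List J) :
    x * (l.map g).prod ∈ wordsBelow K g w (n + wordWeight w l) := by
  induction hx using Submodule.span_induction with
  | mem x h =>
    obtain ⟨l', hl', rfl⟩ := h
    refine Submodule.subset_span ⟨l' ++ l, ?_, ?_⟩
    · rw [wordWeight_append]; omega
    · rw [List.map_append, List.prod_append]
  | zero => rw [zero_mul]; exact zero_mem _
  | add x y _ _ hx hy => rw [add_mul]; exact add_mem hx hy
  | smul c x _ hx => rw [smul_mul_assoc]; exact Submodule.smul_mem _ _ hx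

theorem gen_mul_mem_wordsBelow {n : ℕ} {x : B} (hx : x ∈ wordsBelow K g w n) (j : J) :
    g j * x ∈ wordsBelow K g w (w j + n) := by
  induction hx using Submodule.span_induction with
  | mem x h =>
    obtain ⟨l', hl', rfl⟩ := h
    refine Submodule.subset_span ⟨j :: l', ?_, ?_⟩
    · rw [wordWeight_cons]; omega
    · rw [List.map_cons, List.prod_cons]
  | zero => rw [mul_zero]; exact zero_mem _
  | add x y _ _ hx hy => rw [mul_add]; exact add_mem hx hy
  | smul c x _ hx => rw [mul_smul_comm]; exact Submodule.smul_mem _ _ hx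

theorem wordWeight_perm {l l' : List J} (h : l.Perm l') : wordWeight w l = wordWeight w l' :=
  (h.map w).sum_eq

/-- A permutation is a chain of adjacent swaps, and each swap costs a commutator, which is of lower
weight by `hg`. -/
theorem word_sub_mem_of_perm
    (hg : ∀ i j, g i * g j - g j * g i ∈ wordsBelow K g w (w i + w j)) {l l' : List J}
    (h : l.Perm l') : (l.map g).prod - (l'.map g).prod ∈ wordsBelow K g w (wordWeight w l) := by
  induction h with
  | nil => simp
  | cons j h ih =>
    rw [List.map_cons, List.map_cons, List.prod_cons, List.prod_cons, ← mul_sub, wordWeight_cons]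
    exact gen_mul_mem_wordsBelow ih j
  | swap i j l =>
    have := mul_word_mem_wordsBelow (hg j i) l
    simp only [List.map_cons, List.prod_cons, wordWeight_cons, ← mul_assoc, ← sub_mul]
    rwa [← add_assoc]
  | trans h h' ih ih' =>
    rw [← wordWeight_perm h] at ih'
    simpa using add_mem ih ih'

theorem weight_toFinsupp [DecidableEq J] (l : List J) :
    Finsupp.weight w (Multiset.toFinsupp (l : Multiset J)) = wordWeight w l := by
  induction l with
  | nil => simp [wordWeight]
  | cons j l ih =>
    rw [← Multiset.cons_coe, ← Multiset.singleton_add, map_add, map_add, ih,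
      Multiset.toFinsupp_singleton, Finsupp.weight_single, wordWeight_cons, smul_eq_mul, one_mul]

theorem prod_map_X [DecidableEq J] (l : List J) : (l.map (MvPolynomial.X : J → MvPolynomial J K)).prod =
    MvPolynomial.monomial (Multiset.toFinsupp (l : Multiset J)) 1 := by
  induction l with
  | nil => simp
  | cons j l ih =>
    rw [List.map_cons, List.prod_cons, ih, ← Multiset.cons_coe, ← Multiset.singleton_add, map_add,
      Multiset.toFinsupp_singleton, MvPolynomial.X, MvPolynomial.monomial_mul, one_mul]

variable (K w) in
/-- The polynomials all of whose monomials have weight less than `n`. -/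
def polyBelow (n : ℕ) : Submodule K (MvPolynomial J K) where
  carrier := {p | ∀ ν, n ≤ Finsupp.weight w ν → MvPolynomial.coeff ν p = 0}
  add_mem' hp hq ν h := by rw [MvPolynomial.coeff_add, hp ν h, hq ν h, add_zero]
  zero_mem' ν _ := MvPolynomial.coeff_zero ν
  smul_mem' c p hp ν h := by rw [MvPolynomial.coeff_smul, hp ν h, smul_zero]

variable (g) in
/-- A word in the `g j` with prescribed multiplicities. -/
def normalWord (ν : J →₀ ℕ) : B := ((Finsupp.toMultiset ν).toList.map g).prod

theorem wordWeight_normal (ν : J →₀ ℕ) :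
    wordWeight w (Finsupp.toMultiset ν).toList = Finsupp.weight w ν := by
  classical
  rw [← weight_toFinsupp, Multiset.coe_toList, Finsupp.toMultiset_toFinsupp]

/-- Rearranging the letters into the chosen order leaves an error made of words of lower weight, to
which induction applies. -/
theorem word_mem_span_normalWord
    (hg : ∀ i j, g i * g j - g j * g i ∈ wordsBelow K g w (w i + w j)) (l : List J) :
    (l.map g).prod ∈ Submodule.span K (Set.range (normalWord g)) := by
  classical
  induction hn : wordWeight w l using Nat.strong_induction_on generalizing l with
  | _ n ih =>
    have hp : l.Perm (Finsupp.toMultiset (Multiset.toFinsupp (l : Multiset J))).toList := by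
      rw [← Multiset.coe_eq_coe, Multiset.coe_toList, Multiset.toFinsupp_toMultiset]
    have h1 := word_sub_mem_of_perm hg hp
    have h2 : wordsBelow K g w (wordWeight w l) ≤
        Submodule.span K (Set.range (normalWord g)) := by
      refine Submodule.span_le.2 ?_
      rintro _ ⟨l', hl', rfl⟩
      exact ih _ (hn ▸ hl') l' rfl
    have h3 := add_mem (h2 h1) (Submodule.subset_span
      (Set.mem_range_self (Multiset.toFinsupp (l : Multiset J))))
    rwa [normalWord, sub_add_cancel] at h3

theorem span_normalWord (hadj : Algebra.adjoin K (Set.range g) = ⊤)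
    (hg : ∀ i j, g i * g j - g j * g i ∈ wordsBelow K g w (w i + w j)) :
    Submodule.span K (Set.range (normalWord g)) = ⊤ := by
  rw [eq_top_iff, ← Algebra.top_toSubmodule, ← hadj, Algebra.adjoin_eq_span, Submodule.span_le]
  intro x hx
  induction hx using Submonoid.closure_induction_left with
  | one => exact word_mem_span_normalWord (w := w) hg []
  | mul_left x hx y hy ih =>
    obtain ⟨j, rfl⟩ := hx
    suffices H : Submodule.span K (Set.range (normalWord g)) ≤
        (Submodule.span K (Set.range (normalWord g))).comap (LinearMap.mulLeft K (g j)) from H ih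
    refine Submodule.span_le.2 ?_
    rintro _ ⟨ν, rfl⟩
    exact word_mem_span_normalWord (w := w) hg (j :: (Finsupp.toMultiset ν).toList)

/-- A linear map to the polynomial ring that sends each word to the corresponding monomial plus
terms of lower weight is bijective. -/
theorem bijective_of_triangular (hadj : Algebra.adjoin K (Set.range g) = ⊤)
    (hg : ∀ i j, g i * g j - g j * g i ∈ wordsBelow K g w (w i + w j))
    (s : B →ₗ[K] MvPolynomial J K)
    (hs : ∀ l : List J, s (l.map g).prod - (l.map MvPolynomial.X).prod ∈
      polyBelow K w (wordWeight w l)) : Function.Bijective s := by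
  classical
  have hs' : ∀ ν, s (normalWord g ν) - MvPolynomial.monomial ν 1 ∈
      polyBelow K w (Finsupp.weight w ν) := by
    intro ν
    have := hs (Finsupp.toMultiset ν).toList
    rwa [wordWeight_normal, prod_map_X, Multiset.coe_toList, Finsupp.toMultiset_toFinsupp] at this
  constructor
  · let r : MvPolynomial J K →ₗ[K] B := (MvPolynomial.basisMonomials J K).constr K (normalWord g)
    have hr : ∀ ν, r (MvPolynomial.monomial ν 1) = normalWord g ν := by
      intro ν
      have := (MvPolynomial.basisMonomials J K).constr_basis K (normalWord g) ν
      rwa [MvPolynomial.coe_basisMonomials] at this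
    have hsurj : Function.Surjective r := by
      rw [← LinearMap.range_eq_top, eq_top_iff, ← span_normalWord hadj hg, Submodule.span_le]
      rintro _ ⟨ν, rfl⟩
      exact ⟨_, hr ν⟩
    rw [← LinearMap.ker_eq_bot, LinearMap.ker_eq_bot']
    intro u hu
    obtain ⟨p, rfl⟩ := hsurj u
    by_cases hp : p = 0
    · rw [hp, map_zero]
    exfalso
    -- A monomial of maximal weight cannot be reached by the error terms of any other monomial of
    -- `p`, so its coefficient survives in `s (r p)`, contradicting `hu`.
    obtain ⟨ν, hν, hmax⟩ := p.support.exists_max_image (Finsupp.weight w)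
      (Finset.nonempty_iff_ne_empty.2 (mt MvPolynomial.support_eq_empty.1 hp))
    have h1 : MvPolynomial.coeff ν (s (r p)) = MvPolynomial.coeff ν p := by
      conv_lhs => rw [p.as_sum]
      rw [map_sum, map_sum, MvPolynomial.coeff_sum, Finset.sum_eq_single ν]
      · have h2 := hs' ν ν le_rfl
        rw [← mul_one (MvPolynomial.coeff ν p), ← smul_eq_mul, ← MvPolynomial.smul_monomial,
          map_smul, map_smul, hr, MvPolynomial.coeff_smul]
        rw [MvPolynomial.coeff_sub, MvPolynomial.coeff_monomial, if_pos rfl, sub_eq_zero] at h2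
        rw [h2]
      · intro μ hμ hne
        have h2 := hs' μ ν (hmax μ hμ)
        rw [MvPolynomial.coeff_sub, MvPolynomial.coeff_monomial, if_neg hne, sub_zero] at h2
        rw [← mul_one (MvPolynomial.coeff μ p), ← smul_eq_mul, ← MvPolynomial.smul_monomial,
          map_smul, map_smul, hr, MvPolynomial.coeff_smul, h2, smul_zero]
      · intro h
        exact absurd hν h
    rw [hu, MvPolynomial.coeff_zero] at h1
    exact MvPolynomial.mem_support_iff.1 hν h1.symm
  · have key : ∀ ν, MvPolynomial.monomial ν (1 : K) ∈ LinearMap.range s := by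
      intro ν
      induction hn : Finsupp.weight w ν using Nat.strong_induction_on generalizing ν with
      | _ n ih =>
        -- For surjectivity, the error term of a normal word is hit by induction, hence so is its
        -- leading monomial.
        have h1 : ∀ p ∈ polyBelow K w n, p ∈ LinearMap.range s := by
          intro p hp
          rw [p.as_sum]
          refine Submodule.sum_mem _ fun μ hμ => ?_
          rw [← mul_one (MvPolynomial.coeff μ p), ← smul_eq_mul, ← MvPolynomial.smul_monomial]
          refine Submodule.smul_mem _ _ (ih _ ?_ μ rfl)
          by_contra h
          exact MvPolynomial.mem_support_iff.1 hμ (hp μ (not_lt.1 h))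
        have h2 := sub_mem (LinearMap.mem_range_self s (normalWord g ν)) (h1 _ (hn ▸ hs' ν))
        rwa [sub_sub_cancel] at h2
    intro p
    rw [← LinearMap.mem_range, p.as_sum]
    refine Submodule.sum_mem _ fun μ hμ => ?_
    rw [← mul_one (MvPolynomial.coeff μ p), ← smul_eq_mul, ← MvPolynomial.smul_monomial]
    exact Submodule.smul_mem _ _ (key μ)

theorem polyBelow_mono {m n : ℕ} (h : m ≤ n) : polyBelow K w m ≤ polyBelow K w n :=
  fun _ hp ν hν => hp ν (h.trans hν)

/-- Index `m + 1` means weight at most `m`; a factor of weight at most `m` times one of weight less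
than `n` has weight less than `m + n`. -/
theorem mul_mem_polyBelow {m n : ℕ} {p q : MvPolynomial J K} (hp : p ∈ polyBelow K w (m + 1))
    (hq : q ∈ polyBelow K w n) : p * q ∈ polyBelow K w (m + n) := by
  classical
  intro ν hν
  rw [MvPolynomial.coeff_mul]
  refine Finset.sum_eq_zero fun x hx => ?_
  rw [Finset.HasAntidiagonal.mem_antidiagonal] at hx
  subst hx
  rw [map_add] at hν
  by_cases h : m + 1 ≤ Finsupp.weight w x.1
  · rw [hp _ h, zero_mul]
  · rw [hq _ (by omega), mul_zero]

theorem X_mem_polyBelow (j : J) : (MvPolynomial.X j : MvPolynomial J K) ∈ polyBelow K w (w j + 1) := by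
  classical
  intro ν hν
  rw [MvPolynomial.coeff_X, if_neg]
  rintro rfl
  rw [Finsupp.weight_single, one_smul] at hν
  omega

theorem one_mem_polyBelow : (1 : MvPolynomial J K) ∈ polyBelow K w 1 := by
  classical
  intro ν hν
  rw [MvPolynomial.coeff_one, if_neg]
  rintro rfl
  simp at hν

end Straightening

/-! ### Injectivity of the symbol map -/

section SymInjective

variable {R : Type*} [Ring R] {ι : Type*} (β : Module.Basis ι ℚ (RatExt R))

/-- The derivation sends variables to linear forms, so it does not raise the degree. -/
theorem fockD_mem_polyBelow (l : ℕ+) (a : RatExt R) (n : ℕ) {p : MvPolynomial (ℕ+ × ι) ℚ}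
    (hp : p ∈ polyBelow ℚ (fun _ => 1) n) : fockD β l a p ∈ polyBelow ℚ (fun _ => 1) n := by
  have hX : ∀ c, fockX β l c ∈ polyBelow ℚ (fun _ : ℕ+ × ι => 1) 2 := by
    intro c
    rw [← β.linearCombination_repr c, Finsupp.linearCombination_apply, Finsupp.sum, map_sum]
    refine Submodule.sum_mem _ fun i _ => ?_
    rw [map_smul, fockX_basis]
    exact Submodule.smul_mem _ _ (X_mem_polyBelow (w := fun _ => 1) _)
  have hm : ∀ L : List (ℕ+ × ι), fockD β l a ((L.map MvPolynomial.X).prod) ∈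
      polyBelow ℚ (fun _ => 1) (wordWeight (fun _ => 1) L + 1) ∧
      (L.map MvPolynomial.X).prod ∈ polyBelow ℚ (fun _ => 1) (wordWeight (fun _ => 1) L + 1) := by
    intro L
    induction L with
    | nil => simpa [wordWeight] using one_mem_polyBelow
    | cons j L ih =>
      have hX1 := X_mem_polyBelow (K := ℚ) (w := fun _ => 1) j
      rw [List.map_cons, List.prod_cons, wordWeight_cons, add_assoc]
      refine ⟨?_, mul_mem_polyBelow hX1 ih.2⟩
      rw [Derivation.leibniz, smul_eq_mul, smul_eq_mul]
      refine add_mem (mul_mem_polyBelow hX1 ih.1) ?_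
      rw [mul_comm]
      refine mul_mem_polyBelow ?_ ih.2
      rw [fockD, MvPolynomial.mkDerivation_X]
      split_ifs
      · exact hX _
      · exact zero_mem _
  rw [p.as_sum, map_sum]
  refine Submodule.sum_mem _ fun ν hν => ?_
  rw [← mul_one (MvPolynomial.coeff ν p), ← smul_eq_mul, ← MvPolynomial.smul_monomial,
    Derivation.map_smul]
  refine Submodule.smul_mem _ _ ?_
  classical
  have h1 := (hm (Finsupp.toMultiset ν).toList).1
  rw [prod_map_X, wordWeight_normal, Multiset.coe_toList, Finsupp.toMultiset_toFinsupp] at h1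
  refine polyBelow_mono ?_ h1
  by_contra h
  exact MvPolynomial.mem_support_iff.1 hν (hp ν (by omega))

theorem T_mem_span (l : ℕ+) (a : RatExt R) :
    T l a ∈ Submodule.span ℚ (Set.range fun j : ℕ+ × ι => T j.1 (β j.2)) := by
  rw [← β.linearCombination_repr a, Finsupp.linearCombination_apply, Finsupp.sum, map_sum]
  refine Submodule.sum_mem _ fun i _ => ?_
  rw [map_smul]
  exact Submodule.smul_mem _ _ (Submodule.subset_span ⟨(l, i), rfl⟩)

/-- Every generator gets weight `1`. A commutator of two generators is again linear in the
generators, and in `sym_T_mul` the multiplication by a variable dominates the derivation, so the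
triangularity criterion applies. -/
theorem sym_injective : Function.Injective (sym β) := by
  refine (bijective_of_triangular (g := fun j : ℕ+ × ι => T (R := R) j.1 (β j.2))
    (w := fun _ => 1) ?_ ?_ (sym β) ?_).1
  · rw [eq_top_iff, ← adjoin_T, Algebra.adjoin_le_iff]
    rintro _ ⟨l, a, rfl⟩
    exact Algebra.span_le_adjoin ℚ _ (T_mem_span β l a)
  · rintro ⟨l, i⟩ ⟨k, j⟩
    by_cases h : l = k
    · subst h
      dsimp only
      rw [T_mul_sub]
      refine Submodule.span_mono ?_ (T_mem_span β _ _)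
      rintro _ ⟨j, rfl⟩
      exact ⟨[j], by simp [wordWeight], by simp⟩
    · dsimp only
      rw [(T_commute h _ _).eq, sub_self]
      exact zero_mem _
  · intro L
    induction L with
    | nil => simp [sym_one]
    | cons j L ih =>
      rw [List.map_cons, List.prod_cons, List.map_cons, List.prod_cons, sym_T_mul, fockX_basis,
        add_sub_right_comm, ← mul_sub, wordWeight_cons]
      refine add_mem (mul_mem_polyBelow (X_mem_polyBelow j) ih) ?_
      refine fockD_mem_polyBelow β _ _ _ ?_
      rw [← sub_add_cancel (sym β _) (L.map MvPolynomial.X).prod]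
      refine add_mem (polyBelow_mono (by omega) ih) ?_
      intro ν hν
      classical
      rw [prod_map_X, MvPolynomial.coeff_monomial, if_neg]
      rintro rfl
      rw [weight_toFinsupp] at hν
      omega

end SymInjective

end

end GInf

namespace GInf

set_option linter.unusedSectionVars false

noncomputable section

open MvPowerSeries Finset

/-! ### The action of `Θ_l` on exponentials -/

section Hat

variable {σ : Type*} {R : Type*} [Ring R] {ι : Type*} (β : Module.Basis ι ℚ (RatExt R))

/-- The linear form `X_l` applied to the coefficients. -/
def hatX (l : ℕ+) (x : MvPowerSeries σ (RatExt R)) :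
    MvPowerSeries σ (MvPolynomial (ℕ+ × ι) ℚ) := fun m => fockX β l (coeff m x)

/-- The derivation `D_l` with power series as arguments. -/
def hatD (l : ℕ+) (x : MvPowerSeries σ (RatExt R))
    (f : MvPowerSeries σ (MvPolynomial (ℕ+ × ι) ℚ)) :
    MvPowerSeries σ (MvPolynomial (ℕ+ × ι) ℚ) := fun m =>
  open Classical in ∑ p ∈ antidiagonal m, fockD β l (coeff p.1 x) (coeff p.2 f)

/-- The vacuum values of the coefficients. -/
def hatSym (u : MvPowerSeries σ (GQ R)) : MvPowerSeries σ (MvPolynomial (ℕ+ × ι) ℚ) :=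
  fun m => sym β (coeff m u)

theorem coeff_mapT (l : ℕ+) (x : MvPowerSeries σ (RatExt R)) (m : σ →₀ ℕ) :
    coeff m (mapT l x) = T l (coeff m x) := rfl

theorem coeff_hatX (l : ℕ+) (x : MvPowerSeries σ (RatExt R)) (m : σ →₀ ℕ) :
    coeff m (hatX β l x) = fockX β l (coeff m x) := rfl

theorem coeff_hatSym (u : MvPowerSeries σ (GQ R)) (m : σ →₀ ℕ) :
    coeff m (hatSym β u) = sym β (coeff m u) := rfl

theorem coeff_hatD [DecidableEq σ] (l : ℕ+) (x : MvPowerSeries σ (RatExt R))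
    (f : MvPowerSeries σ (MvPolynomial (ℕ+ × ι) ℚ)) (m : σ →₀ ℕ) : coeff m (hatD β l x f) =
      ∑ p ∈ antidiagonal m, fockD β l (coeff p.1 x) (coeff p.2 f) := by
  change hatD β l x f m = _
  unfold hatD
  congr!

theorem hatSym_injective : Function.Injective (hatSym β : MvPowerSeries σ (GQ R) → _) := by
  intro u v h
  ext m
  exact sym_injective β (congrArg (coeff m) h)

theorem hatX_add (l : ℕ+) (x y : MvPowerSeries σ (RatExt R)) :
    hatX β l (x + y) = hatX β l x + hatX β l y := by
  ext1 m
  rw [map_add, coeff_hatX, coeff_hatX, coeff_hatX, map_add, map_add]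

theorem hatX_zero (l : ℕ+) : hatX β l (0 : MvPowerSeries σ (RatExt R)) = 0 := by
  ext1 m
  rw [coeff_hatX, map_zero, map_zero, map_zero]

theorem constantCoeff_hatX {l : ℕ+} {x : MvPowerSeries σ (RatExt R)} (h : constantCoeff x = 0) :
    constantCoeff (hatX β l x) = 0 := by
  rw [← coeff_zero_eq_constantCoeff_apply, coeff_hatX, coeff_zero_eq_constantCoeff_apply, h,
    map_zero]

theorem hatD_add (l : ℕ+) (x : MvPowerSeries σ (RatExt R))
    (f g : MvPowerSeries σ (MvPolynomial (ℕ+ × ι) ℚ)) :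
    hatD β l x (f + g) = hatD β l x f + hatD β l x g := by
  classical
  ext1 m
  rw [map_add, coeff_hatD, coeff_hatD, coeff_hatD, ← sum_add_distrib]
  simp_rw [map_add]

theorem hatD_zero (l : ℕ+) (x : MvPowerSeries σ (RatExt R)) : hatD β l x 0 = 0 := by
  classical
  ext1 m
  rw [coeff_hatD]
  simp

theorem hatD_sum (l : ℕ+) (x : MvPowerSeries σ (RatExt R)) {κ : Type*} (s : Finset κ)
    (f : κ → MvPowerSeries σ (MvPolynomial (ℕ+ × ι) ℚ)) :
    hatD β l x (∑ k ∈ s, f k) = ∑ k ∈ s, hatD β l x (f k) := by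
  classical
  induction s using Finset.induction_on with
  | empty => simp [hatD_zero]
  | insert k s hk ih => rw [sum_insert hk, sum_insert hk, hatD_add, ih]

theorem hatD_smul (l : ℕ+) (x : MvPowerSeries σ (RatExt R)) (c : ℚ)
    (f : MvPowerSeries σ (MvPolynomial (ℕ+ × ι) ℚ)) :
    hatD β l x (c • f) = c • hatD β l x f := by
  classical
  ext1 m
  rw [coeff_rat_smul, coeff_hatD, coeff_hatD, smul_sum]
  simp_rw [coeff_rat_smul, Derivation.map_smul]

theorem hatD_hatX (l : ℕ+) (x y : MvPowerSeries σ (RatExt R)) :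
    hatD β l x (hatX β l y) = hatX β l (x * y) := by
  classical
  ext1 m
  rw [coeff_hatD, coeff_hatX, MvPowerSeries.coeff_mul, map_sum]
  simp_rw [coeff_hatX, fockD_fockX]

theorem hatD_hatX_of_ne {l k : ℕ+} (h : k ≠ l) (x y : MvPowerSeries σ (RatExt R)) :
    hatD β l x (hatX β k y) = 0 := by
  classical
  ext1 m
  rw [coeff_hatD]
  simp_rw [coeff_hatX, fockD_fockX_of_ne β h, sum_const_zero, map_zero]

/-- The operators of multiplication by the coefficients. -/
def mulOp : MvPowerSeries σ (MvPolynomial (ℕ+ × ι) ℚ) →+*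
    MvPowerSeries σ (Module.End ℚ (MvPolynomial (ℕ+ × ι) ℚ)) :=
  MvPowerSeries.map (Algebra.lmul ℚ (MvPolynomial (ℕ+ × ι) ℚ)).toRingHom

theorem mulOp_injective : Function.Injective (mulOp (σ := σ) (ι := ι)) := by
  intro f g h
  ext1 m
  have := congrArg (coeff m) h
  simp only [mulOp, coeff_map] at this
  have := DFunLike.congr_fun this 1
  simpa using this

/-- The coefficients of `hatD`, as operators. -/
def derOp (l : ℕ+) (x : MvPowerSeries σ (RatExt R)) :
    MvPowerSeries σ (Module.End ℚ (MvPolynomial (ℕ+ × ι) ℚ)) :=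
  fun m => (fockD β l (coeff m x)).toLinearMap

theorem coeff_mul_swap {S : Type*} [Ring S] [DecidableEq σ] (f g : MvPowerSeries σ S)
    (m : σ →₀ ℕ) : coeff m (f * g) = ∑ p ∈ antidiagonal m, coeff p.2 f * coeff p.1 g := by
  conv_rhs => rw [← HasAntidiagonal.map_swap_antidiagonal, sum_map]
  rw [MvPowerSeries.coeff_mul]
  rfl

theorem mulOp_hatD (l : ℕ+) (x : MvPowerSeries σ (RatExt R))
    (f : MvPowerSeries σ (MvPolynomial (ℕ+ × ι) ℚ)) :
    mulOp (hatD β l x f) = derOp β l x * mulOp f - mulOp f * derOp β l x := by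
  classical
  ext1 m
  rw [map_sub, MvPowerSeries.coeff_mul, coeff_mul_swap, ← sum_sub_distrib, mulOp, coeff_map, coeff_hatD,
    map_sum]
  refine sum_congr rfl fun p _ => ?_
  refine LinearMap.ext fun q => ?_
  change fockD β l (coeff p.1 x) (coeff p.2 f) * q =
    fockD β l (coeff p.1 x) (coeff p.2 f * q) - coeff p.2 f * fockD β l (coeff p.1 x) q
  rw [Derivation.leibniz, smul_eq_mul, smul_eq_mul]
  ring

/-- By `mulOp_hatD` the operator `hatD` becomes the commutator with a fixed element, and a
commutator is a derivation; this avoids manipulating threefold convolutions. -/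
theorem hatD_mul (l : ℕ+) (x : MvPowerSeries σ (RatExt R))
    (f g : MvPowerSeries σ (MvPolynomial (ℕ+ × ι) ℚ)) :
    hatD β l x (f * g) = hatD β l x f * g + f * hatD β l x g := by
  apply mulOp_injective
  rw [map_add, map_mul, map_mul, mulOp_hatD, mulOp_hatD, mulOp_hatD, map_mul]
  simp only [sub_mul, mul_sub, mul_assoc]
  abel

theorem hatD_one (l : ℕ+) (x : MvPowerSeries σ (RatExt R)) : hatD β l x 1 = 0 := by
  have := hatD_mul β l x 1 1
  simpa using this

theorem hatD_pow (l : ℕ+) (x : MvPowerSeries σ (RatExt R))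
    (f : MvPowerSeries σ (MvPolynomial (ℕ+ × ι) ℚ)) (n : ℕ) :
    hatD β l x (f ^ (n + 1)) = ((n + 1 : ℕ) : ℚ) • (f ^ n * hatD β l x f) := by
  induction n with
  | zero => simp
  | succ n ih =>
    rw [pow_succ, hatD_mul, ih, pow_succ f n]
    have h : ((n + 1 + 1 : ℕ) : ℚ) = ((n + 1 : ℕ) : ℚ) + 1 := by push_cast; ring
    rw [h, add_smul, one_smul, smul_mul_assoc]
    congr 2
    ring

/-- The divided power `f ^ n / n!`. -/
def divPow {S : Type*} [CommRing S] [Algebra ℚ S] (f : S) (n : ℕ) : S :=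
  ((n.factorial : ℚ)⁻¹) • f ^ n

theorem hatD_divPow (l : ℕ+) (x : MvPowerSeries σ (RatExt R))
    (f : MvPowerSeries σ (MvPolynomial (ℕ+ × ι) ℚ)) (n : ℕ) :
    hatD β l x (divPow f (n + 1)) = divPow f n * hatD β l x f := by
  rw [divPow, hatD_smul, hatD_pow, divPow, smul_smul, smul_mul_assoc, Nat.factorial_succ]
  congr 1
  have : (n.factorial : ℚ) ≠ 0 := by positivity
  push_cast
  field_simp

theorem CongrUpTo.hatD {N : ℕ} {f g : MvPowerSeries σ (MvPolynomial (ℕ+ × ι) ℚ)}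
    (h : CongrUpTo N f g) (l : ℕ+) (x : MvPowerSeries σ (RatExt R)) :
    CongrUpTo N (hatD β l x f) (hatD β l x g) := by
  classical
  intro m hm
  rw [coeff_hatD, coeff_hatD]
  refine sum_congr (Eq.refl _) fun p hp => ?_
  rw [h _ ((degree_le_of_mem_antidiagonal hp).2.trans hm)]

theorem hatD_expSeries (l : ℕ+) (x : MvPowerSeries σ (RatExt R))
    {f : MvPowerSeries σ (MvPolynomial (ℕ+ × ι) ℚ)} (hf : constantCoeff f = 0) :
    hatD β l x (expSeries f) = expSeries f * hatD β l x f := by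
  refine eq_of_congrUpTo fun N => ?_
  refine ((expSeries_congrUpTo hf (Nat.le_succ N)).hatD β l x).trans ?_
  refine CongrUpTo.trans ?_ ((expSeries_congrUpTo hf le_rfl).symm.mul CongrUpTo.rfl)
  rw [hatD_sum, sum_range_succ']
  have h0 : hatD β l x (((Nat.factorial 0 : ℚ)⁻¹) • f ^ 0) = 0 := by
    rw [hatD_smul, pow_zero, hatD_one, smul_zero]
  rw [h0, add_zero, sum_mul]
  have : ∀ k ∈ range (N + 1), hatD β l x (((k + 1).factorial : ℚ)⁻¹ • f ^ (k + 1)) =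
      ((k.factorial : ℚ)⁻¹ • f ^ k) * hatD β l x f := fun k _ => hatD_divPow β l x f k
  rw [sum_congr rfl this]
  exact .rfl

theorem hatSym_smul (c : ℚ) (u : MvPowerSeries σ (GQ R)) :
    hatSym β (c • u) = c • hatSym β u := by
  ext1 m
  rw [coeff_rat_smul, coeff_hatSym, coeff_hatSym, coeff_rat_smul, map_smul]

theorem hatSym_sum {κ : Type*} (s : Finset κ) (u : κ → MvPowerSeries σ (GQ R)) :
    hatSym β (∑ k ∈ s, u k) = ∑ k ∈ s, hatSym β (u k) := by
  ext1 m
  rw [map_sum, coeff_hatSym, map_sum, map_sum]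
  rfl

theorem hatSym_one : hatSym β (1 : MvPowerSeries σ (GQ R)) = 1 := by
  classical
  ext1 m
  rw [coeff_hatSym, MvPowerSeries.coeff_one, MvPowerSeries.coeff_one]
  split_ifs
  · exact sym_one β
  · exact map_zero _

theorem hatSym_mapT_mul (l : ℕ+) (x : MvPowerSeries σ (RatExt R)) (u : MvPowerSeries σ (GQ R)) :
    hatSym β (mapT l x * u) = hatX β l x * hatSym β u + hatD β l x (hatSym β u) := by
  classical
  ext1 m
  rw [coeff_hatSym, map_add, MvPowerSeries.coeff_mul, MvPowerSeries.coeff_mul, coeff_hatD, map_sum,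
    ← sum_add_distrib]
  refine sum_congr rfl fun p _ => ?_
  rw [coeff_mapT, sym_T_mul]
  rfl

theorem mapT_mul_sub (l : ℕ+) (x y : MvPowerSeries σ (RatExt R)) :
    mapT l x * mapT l y - mapT l y * mapT l x = mapT l (x * y - y * x) := by
  classical
  ext1 m
  rw [map_sub, MvPowerSeries.coeff_mul, coeff_mul_swap, coeff_mapT, map_sub, MvPowerSeries.coeff_mul,
    coeff_mul_swap y x, ← sum_sub_distrib, ← sum_sub_distrib, map_sum]
  refine sum_congr rfl fun p _ => ?_
  rw [coeff_mapT, coeff_mapT, T_mul_sub]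

/-- Since `T_l` respects commutators and the variables are central, so does its extension to power
series; powers of one series therefore have commuting images. -/
theorem mapT_commute (l : ℕ+) {x y : MvPowerSeries σ (RatExt R)} (h : Commute x y) :
    Commute (mapT l x) (mapT l y) := by
  refine sub_eq_zero.1 ?_
  rw [mapT_mul_sub, h.eq, sub_self]
  ext1 m
  rw [coeff_mapT, map_zero, map_zero, map_zero]

/-- The homogeneous parts of `T_l (log (1 + x))` in `x`. -/
def logParts (l : ℕ+) (x : MvPowerSeries σ (RatExt R)) : PowerSeries (MvPowerSeries σ (GQ R)) :=
  PowerSeries.mk fun k => ((-1 : ℚ) ^ (k - 1) / (k : ℚ)) • mapT l (x ^ k)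

theorem coeff_logParts (l : ℕ+) (x : MvPowerSeries σ (RatExt R)) (k : ℕ) :
    PowerSeries.coeff k (logParts l x) = ((-1 : ℚ) ^ (k - 1) / (k : ℚ)) • mapT l (x ^ k) :=
  PowerSeries.coeff_mk _ _

theorem constantCoeff_logParts (l : ℕ+) (x : MvPowerSeries σ (RatExt R)) :
    PowerSeries.constantCoeff (logParts l x) = 0 := by
  rw [← PowerSeries.coeff_zero_eq_constantCoeff_apply, logParts, PowerSeries.coeff_mk]
  simp

theorem admissible_logParts (l : ℕ+) {x : MvPowerSeries σ (RatExt R)} (hx : constantCoeff x = 0) :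
    Admissible (logParts l x) := by
  intro n m h
  rw [logParts, PowerSeries.coeff_mk, coeff_rat_smul, coeff_mapT, coeff_pow_eq_zero hx h, map_zero,
    smul_zero]

/-- Marking `x ^ k` by `s ^ k` makes `Θ_l(1 + x)` the value at `s = 1` of an exponential in one
variable, to which Newton's identities apply. -/
theorem Theta_eq_tot (l : ℕ+) {x : MvPowerSeries σ (RatExt R)} (hx : constantCoeff x = 0) :
    Theta l x = tot (expS (logParts l x)) := by
  rw [tot_expS (admissible_logParts l hx) (constantCoeff_logParts l x), Theta]
  congr 1
  ext1 m
  rw [coeff_mapT]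
  change T l (∑ n ∈ Icc 1 m.degree, ((-1 : ℚ) ^ (n - 1) / (n : ℚ)) • coeff m (x ^ n)) =
    ∑ n ∈ range (m.degree + 1), coeff m (PowerSeries.coeff n (logParts l x))
  rw [map_sum, range_eq_Ico, ← sum_Ioo_add_eq_sum_Ico (by omega), PowerSeries.coeff_zero_eq_constantCoeff_apply,
    constantCoeff_logParts, map_zero, add_zero]
  refine sum_congr (by ext; simp; omega) fun n _ => ?_
  rw [logParts, PowerSeries.coeff_mk, coeff_rat_smul, coeff_mapT, map_smul]

/-- The part of `Θ_l(1 + x)` of order `n` in `x` multiplies the symbol by the `n`-th divided power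
of `X_l(x + x y)`. The proof is by Newton's recursion, whose right-hand side telescopes. -/
theorem hatSym_expS_mul (l : ℕ+) {x y : MvPowerSeries σ (RatExt R)}
    {f : MvPowerSeries σ (MvPolynomial (ℕ+ × ι) ℚ)} (hf : constantCoeff f = 0)
    (hy : ∀ z, hatD β l z f = hatX β l (z * y)) {u : MvPowerSeries σ (GQ R)}
    (hu : hatSym β u = expSeries f) (n : ℕ) :
    hatSym β (PowerSeries.coeff n (expS (logParts l x)) * u) =
      expSeries f * divPow (hatX β l (x + x * y)) n := by
  induction n using Nat.strong_induction_on with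
  | _ n ih =>
    rcases n with _ | n
    · rw [coeff_zero_expS, one_mul, hu]
      simp [divPow]
    set a := hatX β l (x + x * y) with ha
    let h : ℕ → MvPowerSeries σ (MvPolynomial (ℕ+ × ι) ℚ) := fun k => hatX β l (x ^ k + x ^ k * y)
    have hL0 : ∀ k, hatSym β (mapT l (x ^ k) * (PowerSeries.coeff 0 (expS (logParts l x)) * u)) =
        expSeries f * (h k * divPow a 0) := by
      intro k
      rw [hatSym_mapT_mul, ih 0 (by omega), hatD_mul, hatD_expSeries β l _ hf, hy]
      simp only [h, hatX_add]
      have : hatD β l (x ^ k) (divPow a 0) = 0 := by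
        rw [divPow, hatD_smul, pow_zero, hatD_one, smul_zero]
      rw [this]
      ring
    -- The derivation attached to `x ^ k` sends `a` to `h (k + 1)`, which lowers the divided power
    -- by one and raises the index of `h` by one. This is the shape that makes the alternating sum
    -- telescope.
    have hL : ∀ k q, q < n → hatSym β (mapT l (x ^ k) *
        (PowerSeries.coeff (q + 1) (expS (logParts l x)) * u)) =
          expSeries f * (h k * divPow a (q + 1) + h (k + 1) * divPow a q) := by
      intro k q hq
      have e : x ^ k * (x + x * y) = x ^ (k + 1) + x ^ (k + 1) * y := by
        rw [mul_add, ← mul_assoc, ← pow_succ]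
      rw [hatSym_mapT_mul, ih (q + 1) (by omega), hatD_mul, hatD_expSeries β l _ hf, hy,
        hatD_divPow, ha, hatD_hatX, e]
      simp only [h, hatX_add]
      ring
    have hnewton := coeff_expS_newton (constantCoeff_logParts l x) (by
      intro i j
      rw [logParts, PowerSeries.coeff_mk, PowerSeries.coeff_mk]
      exact ((mapT_commute l ((Commute.refl x).pow_pow i j)).smul_left _).smul_right _) (n + 1)
    have h1 : ((n + 1 : ℕ) : ℚ) •
        hatSym β (PowerSeries.coeff (n + 1) (expS (logParts l x)) * u) =
        ∑ k ∈ range (n + 1), (-1 : ℚ) ^ k • hatSym β (mapT l (x ^ (k + 1)) *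
          (PowerSeries.coeff (n - k) (expS (logParts l x)) * u)) := by
      rw [← hatSym_smul, ← smul_mul_assoc, Nat.cast_smul_eq_nsmul, hnewton,
        Nat.sum_antidiagonal_eq_sum_range_succ_mk, sum_range_succ']
      simp only [zero_smul, add_zero]
      rw [sum_mul, hatSym_sum]
      refine sum_congr rfl fun k hk => ?_
      have e1 : n + 1 - (k + 1) = n - k := by omega
      have e2 : ((k + 1 : ℕ) : ℚ) * ((-1 : ℚ) ^ (k + 1 - 1) / ((k + 1 : ℕ) : ℚ)) = (-1) ^ k := by
        have : ((k + 1 : ℕ) : ℚ) ≠ 0 := by positivity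
        rw [Nat.add_sub_cancel]
        field_simp
      rw [← hatSym_smul, coeff_logParts, ← Nat.cast_smul_eq_nsmul ℚ, e1, smul_mul_assoc,
        smul_mul_assoc, smul_mul_assoc, smul_smul, e2, mul_assoc]
    have h2 : ∑ k ∈ range (n + 1), (-1 : ℚ) ^ k • hatSym β (mapT l (x ^ (k + 1)) *
          (PowerSeries.coeff (n - k) (expS (logParts l x)) * u)) =
        expSeries f * (a * divPow a n) := by
      -- Telescoping quantity: consecutive differences of `t` are the terms of the sum with `k < n`;
      -- the last term `k = n` cancels `t n`, and only `t 0` remains.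
      let t : ℕ → MvPowerSeries σ (MvPolynomial (ℕ+ × ι) ℚ) := fun k =>
        expSeries f * ((-1 : ℚ) ^ k • (h (k + 1) * divPow a (n - k)))
      rw [sum_range_succ, Nat.sub_self, hL0]
      have : ∀ k ∈ range n, (-1 : ℚ) ^ k • hatSym β (mapT l (x ^ (k + 1)) *
          (PowerSeries.coeff (n - k) (expS (logParts l x)) * u)) = t k - t (k + 1) := by
        intro k hk
        rw [mem_range] at hk
        obtain ⟨q, hq⟩ : ∃ q, n - k = q + 1 := ⟨n - k - 1, by omega⟩
        have hq' : n - (k + 1) = q := by omega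
        simp only [t, hq, hq']
        rw [hL _ _ (by omega), pow_succ, mul_neg_one, neg_smul, mul_neg, sub_neg_eq_add, ← mul_add,
          ← smul_add, mul_smul_comm]
      rw [sum_congr rfl this, sum_range_sub']
      simp only [t, pow_zero, one_smul, Nat.sub_zero, Nat.sub_self, zero_add, h, pow_one]
      rw [mul_smul_comm, sub_add_cancel]
    have h3 : ((n + 1 : ℕ) : ℚ) • (expSeries f * divPow a (n + 1)) =
        expSeries f * (a * divPow a n) := by
      rw [divPow, divPow, ← mul_smul_comm, smul_smul, mul_smul_comm _ a, pow_succ', Nat.factorial_succ]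
      congr 2
      have : (n.factorial : ℚ) ≠ 0 := by positivity
      push_cast
      field_simp
    have h4 := (h1.trans h2).trans h3.symm
    have h5 : ((n + 1 : ℕ) : ℚ) ≠ 0 := by positivity
    have := congrArg (fun v => ((n + 1 : ℕ) : ℚ)⁻¹ • v) h4
    simpa only [smul_smul, inv_mul_cancel₀ h5, one_smul] using this

theorem CongrUpTo.hatSym {N : ℕ} {u v : MvPowerSeries σ (GQ R)} (h : CongrUpTo N u v) :
    CongrUpTo N (hatSym β u) (hatSym β v) := by
  intro m hm
  rw [coeff_hatSym, coeff_hatSym, h m hm]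

theorem tot_congrUpTo {B : Type*} [Ring B] {f : PowerSeries (MvPowerSeries σ B)}
    (hf : Admissible f) (N : ℕ) :
    CongrUpTo N (tot f) (∑ n ∈ range (N + 1), PowerSeries.coeff n f) := by
  intro m hm
  rw [coeff_tot hf hm, map_sum]

/-- The action of `Θ_l(1 + x)` on exponentials. -/
theorem hatSym_Theta_mul (l : ℕ+) {x y : MvPowerSeries σ (RatExt R)} (hx : constantCoeff x = 0)
    {f : MvPowerSeries σ (MvPolynomial (ℕ+ × ι) ℚ)} (hf : constantCoeff f = 0)
    (hy : ∀ z, hatD β l z f = hatX β l (z * y)) {u : MvPowerSeries σ (GQ R)}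
    (hu : hatSym β u = expSeries f) :
    hatSym β (Theta l x * u) = expSeries (f + hatX β l (x + x * y)) := by
  have ha : constantCoeff (hatX β l (x + x * y)) = 0 := by
    refine constantCoeff_hatX β ?_
    rw [map_add, map_mul, hx, zero_mul, add_zero]
  rw [expSeries_add hf ha]
  refine eq_of_congrUpTo fun N => ?_
  rw [Theta_eq_tot l hx]
  have h1 := tot_congrUpTo (admissible_expS (admissible_logParts l hx)) N
  refine ((h1.mul (CongrUpTo.rfl (f := u))).hatSym β).trans ?_
  rw [sum_mul, hatSym_sum, sum_congr rfl fun n _ => hatSym_expS_mul β l hf hy hu n, ← mul_sum]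
  exact CongrUpTo.rfl.mul (expSeries_congrUpTo ha le_rfl).symm

end Hat

end

end GInf

namespace GInf

set_option linter.unusedSectionVars false

noncomputable section

open MvPowerSeries Finset

/-! ### Products over all tensor factors -/

section Families

variable {σ : Type*} {R : Type*} [Ring R] {ι : Type*} (β : Module.Basis ι ℚ (RatExt R))

/-- The `l`-th member of the family has no terms of degree less than `l`. -/
def IncreasingOrder {B : Type*} [Ring B] (x : ℕ+ → MvPowerSeries σ B) : Prop :=
  ∀ (l : ℕ+) (m : σ →₀ ℕ), m.degree < (l : ℕ) → coeff m (x l) = 0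

section Ring

variable {B : Type*} [Ring B] {x y : ℕ+ → MvPowerSeries σ B}

theorem IncreasingOrder.constantCoeff (hx : IncreasingOrder x) (l : ℕ+) :
    constantCoeff (x l) = 0 :=
  hx l 0 (by simp)

theorem IncreasingOrder.congrUpTo (hx : IncreasingOrder x) {l : ℕ+} {N : ℕ} (h : N < l) :
    CongrUpTo N (x l) 0 := by
  intro m hm
  rw [hx l m (by omega), map_zero]

theorem increasingOrder_zero : IncreasingOrder (0 : ℕ+ → MvPowerSeries σ B) := fun _ _ _ => rfl

theorem IncreasingOrder.add (hx : IncreasingOrder x) (hy : IncreasingOrder y) :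
    IncreasingOrder (x + y) := by
  intro l m h
  rw [Pi.add_apply, map_add, hx l m h, hy l m h, add_zero]

theorem IncreasingOrder.mul_right (hx : IncreasingOrder x) (y : ℕ+ → MvPowerSeries σ B) :
    IncreasingOrder (x * y) := by
  classical
  intro l m h
  rw [Pi.mul_apply, MvPowerSeries.coeff_mul]
  refine sum_eq_zero fun p hp => ?_
  rw [hx l p.1 ((degree_le_of_mem_antidiagonal hp).1.trans_lt h), zero_mul]

theorem IncreasingOrder.neg (hx : IncreasingOrder x) : IncreasingOrder (-x) := by
  intro l m h
  rw [Pi.neg_apply, map_neg, hx l m h, neg_zero]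

end Ring

variable {x y : ℕ+ → MvPowerSeries σ (RatExt R)}

/-- The sum `∑_l X_l(y_l)`. -/
def expo (y : ℕ+ → MvPowerSeries σ (RatExt R)) : MvPowerSeries σ (MvPolynomial (ℕ+ × ι) ℚ) :=
  fun m => ∑ k ∈ range m.degree, coeff m (hatX β k.succPNat (y k.succPNat))

theorem coeff_expo (hy : IncreasingOrder y) {m : σ →₀ ℕ} {N : ℕ} (hN : m.degree ≤ N) :
    coeff m (expo β y) = ∑ k ∈ range N, coeff m (hatX β k.succPNat (y k.succPNat)) := by
  change ∑ k ∈ range m.degree, coeff m (hatX β k.succPNat (y k.succPNat)) = _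
  refine sum_subset (range_mono hN) fun k _ hk => ?_
  rw [coeff_hatX, hy, map_zero]
  simp at hk ⊢
  omega

theorem expo_congrUpTo (hy : IncreasingOrder y) (N : ℕ) :
    CongrUpTo N (expo β y) (∑ k ∈ range N, hatX β k.succPNat (y k.succPNat)) := by
  intro m hm
  rw [coeff_expo β hy hm, map_sum]

theorem constantCoeff_expo : constantCoeff (expo β y) = 0 := by
  change ∑ k ∈ range (0 : σ →₀ ℕ).degree, coeff 0 (hatX β k.succPNat (y k.succPNat)) = 0
  rw [map_zero, range_zero, sum_empty]

theorem expo_add : expo β (x + y) = expo β x + expo β y := by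
  ext1 m
  change ∑ k ∈ range m.degree, coeff m (hatX β k.succPNat ((x + y) k.succPNat)) =
    ∑ k ∈ range m.degree, coeff m (hatX β k.succPNat (x k.succPNat)) +
      ∑ k ∈ range m.degree, coeff m (hatX β k.succPNat (y k.succPNat))
  rw [← sum_add_distrib]
  refine sum_congr rfl fun k _ => ?_
  rw [Pi.add_apply, hatX_add, map_add]

theorem expo_zero : expo β (0 : ℕ+ → MvPowerSeries σ (RatExt R)) = 0 := by
  ext1 m
  change ∑ k ∈ range m.degree, _ = _
  refine sum_eq_zero fun k _ => ?_
  rw [Pi.zero_apply, hatX_zero, map_zero]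

theorem hatD_expo (hy : IncreasingOrder y) (l : ℕ+) (z : MvPowerSeries σ (RatExt R)) :
    hatD β l z (expo β y) = hatX β l (z * y l) := by
  refine eq_of_congrUpTo fun N => ?_
  -- Truncating at `N + l` rather than at `N` ensures that the `l`-th summand, the only one the
  -- derivation sees, is present.
  have h := (expo_congrUpTo β hy (N + l)).hatD β l z
  rw [hatD_sum, sum_eq_single (PNat.natPred l)] at h
  · rw [PNat.succPNat_natPred, hatD_hatX] at h
    exact fun m hm => h m (by omega)
  · intro k _ hk
    refine hatD_hatX_of_ne β (fun h1 => hk ?_) _ _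
    rw [← h1, Nat.natPred_succPNat]
  · intro h1
    simp [PNat.natPred] at h1
    have := l.pos
    omega

theorem expo_update (l : ℕ+) (a : MvPowerSeries σ (RatExt R))
    (ha : ∀ m : σ →₀ ℕ, m.degree < (l : ℕ) → coeff m a = 0) :
    expo β (Function.update y l (y l + a)) = expo β y + hatX β l a := by
  have h1 : Function.update y l (y l + a) = y + Pi.single l a := by
    ext1 k
    by_cases h : k = l
    · subst h; simp
    · simp [h]
  rw [h1, expo_add]
  congr 1
  ext1 m
  change ∑ k ∈ range m.degree, _ = _
  by_cases h : m.degree < (l : ℕ)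
  · rw [coeff_hatX, ha m h, map_zero]
    refine sum_eq_zero fun k hk => ?_
    rw [Pi.single_eq_of_ne, hatX_zero, map_zero]
    rintro rfl
    simp at hk h
    omega
  · rw [sum_eq_single (PNat.natPred l)]
    · rw [PNat.succPNat_natPred, Pi.single_eq_same]
    · intro k _ hk
      rw [Pi.single_eq_of_ne, hatX_zero, map_zero]
      intro h1
      rw [← h1, Nat.natPred_succPNat] at hk
      exact hk rfl
    · intro h1
      simp [PNat.natPred] at h1
      have := l.pos
      omega

/-- The product of the first `n` factors of `∏_l Θ_l(1 + x_l)`. -/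
def partialTheta (x : ℕ+ → MvPowerSeries σ (RatExt R)) (n : ℕ) : MvPowerSeries σ (GQ R) :=
  ((List.range n).map fun k => Theta k.succPNat (x k.succPNat)).prod

theorem partialTheta_succ (x : ℕ+ → MvPowerSeries σ (RatExt R)) (n : ℕ) :
    partialTheta x (n + 1) = partialTheta x n * Theta n.succPNat (x n.succPNat) := by
  simp [partialTheta, List.range_succ]

/-- The rightmost factor acts first. Each factor changes one component of the exponent only, so the
effects of different `l` are independent. -/
theorem hatSym_partialTheta_mul (hx : IncreasingOrder x) (n : ℕ)
    {y : ℕ+ → MvPowerSeries σ (RatExt R)} (hy : IncreasingOrder y) {u : MvPowerSeries σ (GQ R)}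
    (hu : hatSym β u = expSeries (expo β y)) :
    hatSym β (partialTheta x n * u) =
      expSeries (expo β fun l => if (l : ℕ) ≤ n then (y + (x + x * y)) l else y l) := by
  induction n generalizing y u with
  | zero =>
    have : (fun l : ℕ+ => if (l : ℕ) ≤ 0 then (y + (x + x * y)) l else y l) = y := by
      ext1 l
      rw [if_neg (by have := l.pos; omega)]
    rw [this]
    simpa [partialTheta] using hu
  | succ n ih =>
    rw [partialTheta_succ, mul_assoc]
    have hxy := hx.add (hx.mul_right y)
    have h1 := hatSym_Theta_mul β n.succPNat (hx.constantCoeff n.succPNat)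
      (constantCoeff_expo β) (fun z => hatD_expo β hy n.succPNat z) hu
    have h2 := expo_update β (y := y) n.succPNat
      (x n.succPNat + x n.succPNat * y n.succPNat) (hxy n.succPNat)
    rw [← h2] at h1
    have hy' : IncreasingOrder (Function.update y n.succPNat
        (y n.succPNat + (x n.succPNat + x n.succPNat * y n.succPNat))) := by
      intro l m h
      by_cases hl : l = n.succPNat
      · subst hl
        rw [Function.update_self]
        exact (hy.add hxy) n.succPNat m h
      · rw [Function.update_of_ne hl]
        exact hy l m h
    rw [ih hy' h1]
    congr 2
    ext1 l
    by_cases hl : l = n.succPNat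
    · subst hl
      simp
    · have h2 : (l : ℕ) ≠ n + 1 := fun h => hl (PNat.coe_injective (by simpa using h))
      have h3 : ((l : ℕ) ≤ n + 1) ↔ ((l : ℕ) ≤ n) := by omega
      simp [Function.update_of_ne hl, h3]

theorem Theta_congrUpTo_one {l : ℕ+} {N : ℕ} {x : MvPowerSeries σ (RatExt R)}
    (h : CongrUpTo N x 0) : CongrUpTo N (Theta l x) 1 := by
  have h1 : CongrUpTo N (mapT l (logOneAdd x)) 0 := by
    intro m hm
    rw [coeff_mapT]
    change T l (∑ n ∈ Icc 1 m.degree, ((-1 : ℚ) ^ (n - 1) / (n : ℚ)) • coeff m (x ^ n)) = _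
    rw [sum_eq_zero, map_zero, map_zero]
    intro n hn
    rw [h.pow n m hm, zero_pow (by simp at hn; omega), map_zero, smul_zero]
  have h2 := h1.expSeries
  rwa [expSeries_zero] at h2

/-- A factor with index `l > N` is `1` up to degree `N`, so further factors do not change the
truncation. -/
theorem infProd_congrUpTo (hx : IncreasingOrder x) {N M : ℕ} (hM : N ≤ M) :
    CongrUpTo N (infProd fun l => Theta l (x l)) (partialTheta x M) := by
  intro m hm
  change coeff m (partialTheta x m.degree) = _
  have : ∀ n, m.degree ≤ n → coeff m (partialTheta x m.degree) = coeff m (partialTheta x n) := by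
    intro n hn
    induction n, hn using Nat.le_induction with
    | base => rfl
    | succ n hn ih =>
      have h := (CongrUpTo.rfl (f := partialTheta x n)).mul
        (Theta_congrUpTo_one (l := n.succPNat) (hx.congrUpTo (l := n.succPNat) (N := n) (by simp)))
      rw [ih, partialTheta_succ, h m hn, mul_one]
  exact this M (hm.trans hM)

/-- The product `∏_l Θ_l(1 + x_l)`. -/
def bigTheta (x : ℕ+ → MvPowerSeries σ (RatExt R)) : MvPowerSeries σ (GQ R) :=
  infProd fun l => Theta l (x l)

/-- The central computation rule: on exponents, left multiplication by `bigTheta x` is the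
composition `1 + y ↦ (1 + x)(1 + y)` in every component. -/
theorem hatSym_bigTheta_mul (hx : IncreasingOrder x) (hy : IncreasingOrder y)
    {u : MvPowerSeries σ (GQ R)} (hu : hatSym β u = expSeries (expo β y)) :
    hatSym β (bigTheta x * u) = expSeries (expo β (y + (x + x * y))) := by
  refine eq_of_congrUpTo fun N => ?_
  refine (((infProd_congrUpTo hx le_rfl).mul CongrUpTo.rfl).hatSym β).trans ?_
  rw [hatSym_partialTheta_mul β hx N hy hu]
  refine CongrUpTo.expSeries fun m hm => ?_
  change ∑ k ∈ range m.degree, _ = ∑ k ∈ range m.degree, _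
  refine sum_congr rfl fun k hk => ?_
  beta_reduce
  rw [if_pos]
  simp at hk ⊢
  omega

theorem hatSym_bigTheta (hx : IncreasingOrder x) :
    hatSym β (bigTheta x) = expSeries (expo β x) := by
  have h := hatSym_bigTheta_mul β hx increasingOrder_zero (u := 1) (by
    rw [hatSym_one, expo_zero, expSeries_zero])
  rwa [mul_one, mul_zero, add_zero, zero_add] at h

end Families

/-! ### Substitution of a scaled monomial -/

section Subst

variable {σ : Type*} {B : Type*} [Ring B] [Algebra ℚ B] (τ : σ →₀ ℕ) (c : ℚ)

/-- The terms of `f (c s τ)`, sorted by powers of `s`. -/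
def spread (f : PowerSeries B) : PowerSeries (MvPowerSeries σ B) :=
  PowerSeries.mk fun r => monomial (r • τ) (c ^ r • PowerSeries.coeff r f)

/-- The substitution of `c τ`, where `τ` is a monomial, into a power series in one variable. -/
def substMono (f : PowerSeries B) : MvPowerSeries σ B := tot (spread τ c f)

theorem coeff_spread (f : PowerSeries B) (r : ℕ) :
    PowerSeries.coeff r (spread τ c f) = monomial (r • τ) (c ^ r • PowerSeries.coeff r f) :=
  PowerSeries.coeff_mk _ _

variable {τ} (hτ : τ ≠ 0)

theorem degree_pos_of_ne_zero (hτ : τ ≠ 0) : 0 < τ.degree := by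
  rw [Nat.pos_iff_ne_zero]
  exact fun h => hτ ((Finsupp.degree_eq_zero_iff τ).1 h)

include hτ in
theorem admissible_spread (f : PowerSeries B) : Admissible (spread τ c f) := by
  classical
  intro n m h
  rw [coeff_spread, coeff_monomial, if_neg]
  rintro rfl
  rw [map_nsmul, smul_eq_mul] at h
  have := degree_pos_of_ne_zero hτ
  nlinarith

include hτ in
theorem coeff_substMono_smul (f : PowerSeries B) (r : ℕ) :
    coeff (r • τ) (substMono τ c f) = c ^ r • PowerSeries.coeff r f := by
  classical
  have hd := degree_pos_of_ne_zero hτ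
  rw [substMono, coeff_tot (admissible_spread c hτ f) le_rfl, sum_eq_single r]
  · rw [coeff_spread, coeff_monomial_same]
  · intro n _ hn
    rw [coeff_spread, coeff_monomial, if_neg]
    intro h
    have := congrArg Finsupp.degree h
    rw [map_nsmul, map_nsmul, smul_eq_mul, smul_eq_mul] at this
    exact hn (Nat.eq_of_mul_eq_mul_right hd this).symm
  · intro h
    exfalso
    apply h
    rw [mem_range, map_nsmul, smul_eq_mul]
    nlinarith

theorem coeff_substMono_of_forall (f : PowerSeries B) {m : σ →₀ ℕ} (h : ∀ r : ℕ, m ≠ r • τ) :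
    coeff m (substMono τ c f) = 0 := by
  classical
  change ∑ n ∈ range (m.degree + 1), coeff m (PowerSeries.coeff n (spread τ c f)) = 0
  refine sum_eq_zero fun n _ => ?_
  rw [coeff_spread, coeff_monomial, if_neg (h n)]

theorem spread_mul (f g : PowerSeries B) : spread τ c (f * g) = spread τ c f * spread τ c g := by
  ext1 n
  rw [PowerSeries.coeff_mul, coeff_spread, PowerSeries.coeff_mul, smul_sum, map_sum]
  refine sum_congr rfl fun p hp => ?_
  rw [coeff_spread, coeff_spread, monomial_mul_monomial, ← add_smul,
    HasAntidiagonal.mem_antidiagonal.1 hp, smul_mul_smul_comm, ← pow_add,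
    HasAntidiagonal.mem_antidiagonal.1 hp]

theorem spread_one : spread τ c (1 : PowerSeries B) = 1 := by
  ext1 n
  rw [coeff_spread, PowerSeries.coeff_one, PowerSeries.coeff_one]
  split_ifs with h
  · subst h
    rw [pow_zero, one_smul, zero_smul]
    rfl
  · rw [smul_zero, map_zero]

theorem spread_pow (f : PowerSeries B) (n : ℕ) : spread τ c (f ^ n) = spread τ c f ^ n := by
  induction n with
  | zero => rw [pow_zero, pow_zero, spread_one]
  | succ n ih => rw [pow_succ, pow_succ, spread_mul, ih]

theorem monomial_rat_smul (m : σ →₀ ℕ) (q : ℚ) (a : B) :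
    (monomial m (q • a) : MvPowerSeries σ B) = q • monomial m a := by
  classical
  ext1 n
  rw [coeff_rat_smul, coeff_monomial, coeff_monomial]
  split_ifs
  · rfl
  · rw [smul_zero]

theorem expS_eq_expSeries (f : PowerSeries B) : expS f = (expSeries f : PowerSeries B) := by
  ext1 n
  rw [expS, PowerSeries.coeff_mk]
  change _ = ∑ j ∈ range ((Finsupp.single () n).degree + 1), _
  rw [Finsupp.degree_single]
  rfl

include hτ in
theorem substMono_expSeries {f : PowerSeries B} (hf : PowerSeries.constantCoeff f = 0) :
    substMono τ c (expSeries f : PowerSeries B) = expSeries (substMono τ c f) := by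
  have h0 : PowerSeries.constantCoeff (spread τ c f) = 0 := by
    rw [← PowerSeries.coeff_zero_eq_constantCoeff_apply, coeff_spread,
      PowerSeries.coeff_zero_eq_constantCoeff_apply, hf, smul_zero, map_zero]
  rw [← expS_eq_expSeries, substMono, substMono, ← tot_expS (admissible_spread c hτ f) h0]
  congr 1
  ext1 n
  rw [coeff_spread, expS, expS, PowerSeries.coeff_mk, PowerSeries.coeff_mk, smul_sum, map_sum]
  refine sum_congr rfl fun j _ => ?_
  rw [← spread_pow, coeff_spread, smul_comm, monomial_rat_smul]

end Subst

/-! ### The series `E_U` at a monomial -/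

section ESeries

variable {σ : Type*} {R : Type*} [Ring R] {ι : Type*} (β : Module.Basis ι ℚ (RatExt R))

/-- The family `-(-c τ)^l U`, so that `E_U(c τ) = ∏_l Θ_l(1 - (-c τ)^l U)`. -/
def eFamily (τ : σ →₀ ℕ) (c : ℚ) (U : R) (l : ℕ+) : MvPowerSeries σ (RatExt R) :=
  monomial ((l : ℕ) • τ) (-((-c) ^ (l : ℕ)) • toRat U)

theorem increasingOrder_eFamily {τ : σ →₀ ℕ} (hτ : τ ≠ 0) (c : ℚ) (U : R) :
    IncreasingOrder (eFamily τ c U) := by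
  classical
  intro l m h
  rw [eFamily, coeff_monomial, if_neg]
  rintro rfl
  rw [map_nsmul, smul_eq_mul] at h
  have := degree_pos_of_ne_zero hτ
  nlinarith

theorem ESeries_eq_bigTheta (U : R) :
    ESeries U = (bigTheta (eFamily (Finsupp.single () 1) 1 U) : PowerSeries (GQ R)) := by
  rw [ESeries, bigTheta]
  congr 1
  ext1 l
  congr 1
  rw [eFamily, Finsupp.smul_single, smul_eq_mul, mul_one]
  rfl

theorem hatSym_substMono {τ : σ →₀ ℕ} (hτ : τ ≠ 0) (c : ℚ) (f : PowerSeries (GQ R)) :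
    hatSym β (substMono τ c f) = substMono τ c (hatSym β f : PowerSeries _) := by
  ext1 m
  rw [coeff_hatSym]
  by_cases h : ∃ r : ℕ, m = r • τ
  · obtain ⟨r, rfl⟩ := h
    rw [coeff_substMono_smul c hτ, coeff_substMono_smul c hτ, map_smul]
    rfl
  · push Not at h
    rw [coeff_substMono_of_forall c _ h, coeff_substMono_of_forall c _ h, map_zero]

theorem substMono_expo {τ : σ →₀ ℕ} (hτ : τ ≠ 0) (c : ℚ) (U : R) :
    substMono τ c (expo β (eFamily (Finsupp.single () 1) 1 U) : PowerSeries _) =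
      expo β (eFamily τ c U) := by
  classical
  have hd := degree_pos_of_ne_zero hτ
  have h1 : (Finsupp.single () 1 : Unit →₀ ℕ) ≠ 0 := by simp
  ext1 m
  by_cases h : ∃ r : ℕ, m = r • τ
  · obtain ⟨r, rfl⟩ := h
    rw [coeff_substMono_smul c hτ, PowerSeries.coeff]
    have hr : r ≤ (r • τ).degree := by
      rw [map_nsmul, smul_eq_mul]
      nlinarith
    rw [coeff_expo β (increasingOrder_eFamily h1 1 U) (N := (r • τ).degree) (by simpa using hr),
      coeff_expo β (increasingOrder_eFamily hτ c U) le_rfl, smul_sum]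
    refine sum_congr rfl fun k _ => ?_
    rw [coeff_hatX, coeff_hatX, eFamily, eFamily, coeff_monomial, coeff_monomial, ← map_smul]
    congr 1
    by_cases hk : r = k + 1
    · subst hk
      rw [if_pos (by simp), if_pos (by simp), smul_smul]
      congr 1
      simp only [Nat.succPNat_coe, Nat.succ_eq_add_one]
      rw [neg_pow c]
      ring
    · rw [if_neg, if_neg, smul_zero]
      · intro h
        have := congrArg Finsupp.degree h
        rw [map_nsmul, map_nsmul, smul_eq_mul, smul_eq_mul] at this
        exact hk (Nat.eq_of_mul_eq_mul_right hd this)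
      · intro h
        have := congrArg Finsupp.degree h
        simp at this
        exact hk this
  · push Not at h
    rw [coeff_substMono_of_forall c _ h]
    change _ = ∑ k ∈ range m.degree, _
    symm
    refine sum_eq_zero fun k _ => ?_
    rw [coeff_hatX, eFamily, coeff_monomial, if_neg (h _), map_zero]

theorem hatSym_substMono_ESeries {τ : σ →₀ ℕ} (hτ : τ ≠ 0) (c : ℚ) (U : R) :
    hatSym β (substMono τ c (ESeries U)) = expSeries (expo β (eFamily τ c U)) := by
  have h1 : (Finsupp.single () 1 : Unit →₀ ℕ) ≠ 0 := by simp
  rw [hatSym_substMono β hτ, ESeries_eq_bigTheta, hatSym_bigTheta β (increasingOrder_eFamily h1 1 U),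
    substMono_expSeries c hτ (constantCoeff_expo β), substMono_expo β hτ]

/-- Substitution commutes with taking symbols and with exponentials, so the two sides have the same
symbol; this transfers the rule for `bigTheta` to `E_U(c τ)`. -/
theorem substMono_ESeries (β : Module.Basis ι ℚ (RatExt R)) {τ : σ →₀ ℕ} (hτ : τ ≠ 0) (c : ℚ)
    (U : R) : substMono τ c (ESeries U) = bigTheta (eFamily τ c U) := by
  apply hatSym_injective β
  rw [hatSym_substMono_ESeries β hτ, hatSym_bigTheta β (increasingOrder_eFamily hτ c U)]

/-- The action of `E_U(c τ)` on exponentials. -/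
theorem hatSym_substMono_ESeries_mul {τ : σ →₀ ℕ} (hτ : τ ≠ 0) (c : ℚ) (U : R)
    {y : ℕ+ → MvPowerSeries σ (RatExt R)} (hy : IncreasingOrder y) {u : MvPowerSeries σ (GQ R)}
    (hu : hatSym β u = expSeries (expo β y)) :
    hatSym β (substMono τ c (ESeries U) * u) =
      expSeries (expo β (y + (eFamily τ c U + eFamily τ c U * y))) := by
  rw [substMono_ESeries β hτ]
  exact hatSym_bigTheta_mul β (increasingOrder_eFamily hτ c U) hy hu

end ESeries

end

end GInf

namespace GInf

set_option linter.unusedSectionVars false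

noncomputable section

open MvPowerSeries Finset

/-! ### Weight filtrations on coefficients -/

section Filtration

variable {σ : Type*} {B : Type*} [Ring B]

/-- A multiplicative filtration, where `Fil n` stands for the elements of weight less than `n`. -/
structure IsFiltration (Fil : ℕ → AddSubgroup B) : Prop where
  mono : Monotone Fil
  one_mem : 1 ∈ Fil 1
  mul_mem_right : ∀ {m n : ℕ} {x y : B}, x ∈ Fil (m + 1) → y ∈ Fil n → x * y ∈ Fil (m + n)
  mul_mem_left : ∀ {m n : ℕ} {x y : B}, x ∈ Fil m → y ∈ Fil (n + 1) → x * y ∈ Fil (m + n)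

/-- The coefficients of degree `n` have weight at most `n`. -/
def Filtered (Fil : ℕ → AddSubgroup B) (f : MvPowerSeries σ B) : Prop :=
  ∀ m : σ →₀ ℕ, coeff m f ∈ Fil (m.degree + 1)

/-- The coefficients of degree `n` have weight at most `n / 2`. -/
def HalfFiltered (Fil : ℕ → AddSubgroup B) (f : MvPowerSeries σ B) : Prop :=
  ∀ m : σ →₀ ℕ, coeff m f ∈ Fil (m.degree / 2 + 1)

/-- The coefficients of degree `n` agree up to terms of weight less than `n`. -/
def LowCongr (Fil : ℕ → AddSubgroup B) (f g : MvPowerSeries σ B) : Prop :=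
  ∀ m : σ →₀ ℕ, coeff m f - coeff m g ∈ Fil m.degree

variable {Fil : ℕ → AddSubgroup B} (hF : IsFiltration Fil)

include hF

theorem filtered_one : Filtered Fil (1 : MvPowerSeries σ B) := by
  classical
  intro m
  rw [MvPowerSeries.coeff_one]
  split_ifs
  · exact hF.mono (by omega) hF.one_mem
  · exact zero_mem _

theorem halfFiltered_one : HalfFiltered Fil (1 : MvPowerSeries σ B) := by
  classical
  intro m
  rw [MvPowerSeries.coeff_one]
  split_ifs
  · exact hF.mono (by omega) hF.one_mem
  · exact zero_mem _

theorem Filtered.mul {f g : MvPowerSeries σ B} (hf : Filtered Fil f) (hg : Filtered Fil g) :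
    Filtered Fil (f * g) := by
  classical
  intro m
  rw [MvPowerSeries.coeff_mul]
  refine sum_mem fun p hp => ?_
  have h := hF.mul_mem_right (hf p.1) (hg p.2)
  rwa [← add_assoc, degree_add_of_mem_antidiagonal hp] at h

theorem HalfFiltered.mul {f g : MvPowerSeries σ B} (hf : HalfFiltered Fil f)
    (hg : HalfFiltered Fil g) : HalfFiltered Fil (f * g) := by
  classical
  intro m
  rw [MvPowerSeries.coeff_mul]
  refine sum_mem fun p hp => ?_
  rw [← degree_add_of_mem_antidiagonal hp]
  exact hF.mono (by omega) (hF.mul_mem_right (hf p.1) (hg p.2))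

/-- The recursion for the inverse expresses a coefficient by products of coefficients of
complementary degrees, and halves rounded down add up to at most the half of the sum. -/
theorem HalfFiltered.invOfUnit {f : MvPowerSeries σ B} (hf : HalfFiltered Fil f) :
    HalfFiltered Fil (invOfUnit f 1) := by
  classical
  intro m
  induction hn : m.degree using Nat.strong_induction_on generalizing m with
  | _ n ih =>
    subst hn
    rw [coeff_invOfUnit]
    split_ifs with h
    · rw [inv_one, Units.val_one]
      exact hF.mono (by omega) hF.one_mem
    · rw [inv_one, Units.val_one, neg_one_mul]
      refine neg_mem (sum_mem fun p hp => ?_)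
      split_ifs with h1
      · have h2 := degree_add_of_mem_antidiagonal hp
        have h3 : p.2.degree < m.degree := by
          have : p.1 ≠ 0 := by
            rintro h3
            have h4 := HasAntidiagonal.mem_antidiagonal.1 hp
            rw [h3, zero_add] at h4
            exact h1.ne h4
          have := degree_pos_of_ne_zero this
          omega
        rw [← h2]
        exact hF.mono (by omega) (hF.mul_mem_right (hf p.1) (ih _ h3 p.2 rfl))
      · exact zero_mem _

theorem HalfFiltered.filtered {f : MvPowerSeries σ B} (hf : HalfFiltered Fil f) :
    Filtered Fil f :=
  fun m => hF.mono (by omega) (hf m)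

/-- In positive degree `n` the weight is at most `n / 2 < n`, so such a series is invisible in the
leading terms. -/
theorem HalfFiltered.lowCongr_one {f : MvPowerSeries σ B} (hf : HalfFiltered Fil f)
    (h0 : constantCoeff f = 1) : LowCongr Fil f 1 := by
  classical
  intro m
  rw [MvPowerSeries.coeff_one]
  split_ifs with h
  · subst h
    rw [coeff_zero_eq_constantCoeff_apply, h0, sub_self]
    exact zero_mem _
  · rw [sub_zero]
    have := degree_pos_of_ne_zero h
    exact hF.mono (by omega) (hf m)

theorem LowCongr.mul {f g f' g' : MvPowerSeries σ B} (hf : LowCongr Fil f f')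
    (hg : LowCongr Fil g g') (hf' : Filtered Fil f') (hg' : Filtered Fil g) :
    LowCongr Fil (f * g) (f' * g') := by
  classical
  intro m
  rw [MvPowerSeries.coeff_mul, MvPowerSeries.coeff_mul, ← sum_sub_distrib]
  refine sum_mem fun p hp => ?_
  rw [← degree_add_of_mem_antidiagonal hp]
  have h : coeff p.1 f * coeff p.2 g - coeff p.1 f' * coeff p.2 g' =
      (coeff p.1 f - coeff p.1 f') * coeff p.2 g + coeff p.1 f' * (coeff p.2 g - coeff p.2 g') := by
    noncomm_ring
  rw [h]
  exact add_mem (hF.mul_mem_left (hf p.1) (hg' p.2)) (hF.mul_mem_right (hf' p.1) (hg p.2))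

omit hF in
theorem LowCongr.rfl {f : MvPowerSeries σ B} : LowCongr Fil f f := by
  intro m
  rw [sub_self]
  exact zero_mem _

end Filtration

/-! ### Series in powers of one monomial, and words as coefficients -/

section InMono

variable {σ : Type*} {B : Type*} [Ring B]

/-- The series `∑ a_r τ^r`, where `τ` is a monomial. -/
def inMono (τ : σ →₀ ℕ) (a : ℕ → B) : MvPowerSeries σ B :=
  tot (PowerSeries.mk fun r => monomial (r • τ) (a r))

theorem smul_injective {τ : σ →₀ ℕ} (hτ : τ ≠ 0) {r s : ℕ} (h : r • τ = s • τ) : r = s := by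
  have := congrArg Finsupp.degree h
  rw [map_nsmul, map_nsmul, smul_eq_mul, smul_eq_mul] at this
  exact Nat.eq_of_mul_eq_mul_right (degree_pos_of_ne_zero hτ) this

theorem coeff_inMono_smul {τ : σ →₀ ℕ} (hτ : τ ≠ 0) (a : ℕ → B) (r : ℕ) :
    coeff (r • τ) (inMono τ a) = a r := by
  classical
  have hd := degree_pos_of_ne_zero hτ
  change ∑ n ∈ range ((r • τ).degree + 1), coeff (r • τ) (PowerSeries.coeff n _) = _
  rw [sum_eq_single r]
  · rw [PowerSeries.coeff_mk, coeff_monomial_same]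
  · intro n _ hn
    rw [PowerSeries.coeff_mk, coeff_monomial, if_neg fun h => hn (smul_injective hτ h).symm]
  · intro h
    exfalso
    apply h
    rw [mem_range, map_nsmul, smul_eq_mul]
    nlinarith

theorem coeff_inMono_of_forall {τ : σ →₀ ℕ} (a : ℕ → B) {m : σ →₀ ℕ} (h : ∀ r : ℕ, m ≠ r • τ) :
    coeff m (inMono τ a) = 0 := by
  classical
  change ∑ n ∈ range (m.degree + 1), coeff m (PowerSeries.coeff n _) = 0
  refine sum_eq_zero fun n _ => ?_
  rw [PowerSeries.coeff_mk, coeff_monomial, if_neg (h n)]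

theorem eq_inMono {τ : σ →₀ ℕ} (hτ : τ ≠ 0) {a : ℕ → B} {f : MvPowerSeries σ B}
    (h1 : ∀ r : ℕ, coeff (r • τ) f = a r) (h2 : ∀ m : σ →₀ ℕ, (∀ r : ℕ, m ≠ r • τ) → coeff m f = 0) :
    f = inMono τ a := by
  ext1 m
  by_cases h : ∃ r : ℕ, m = r • τ
  · obtain ⟨r, rfl⟩ := h
    rw [h1, coeff_inMono_smul hτ]
  · push Not at h
    rw [h2 m h, coeff_inMono_of_forall a h]

theorem constantCoeff_inMono {τ : σ →₀ ℕ} (hτ : τ ≠ 0) (a : ℕ → B) :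
    constantCoeff (inMono τ a) = a 0 := by
  have := coeff_inMono_smul hτ a 0
  rwa [zero_smul] at this

theorem map_inMono {C : Type*} [Ring C] (φ : B →+* C) {τ : σ →₀ ℕ} (hτ : τ ≠ 0) (a : ℕ → B) :
    MvPowerSeries.map φ (inMono τ a) = inMono τ fun r => φ (a r) := by
  refine eq_inMono hτ (fun r => ?_) fun m hm => ?_
  · rw [MvPowerSeries.coeff_map, coeff_inMono_smul hτ]
  · rw [MvPowerSeries.coeff_map, coeff_inMono_of_forall a hm, map_zero]

theorem substMono_eq_inMono [Algebra ℚ B] {τ : σ →₀ ℕ} (hτ : τ ≠ 0) (c : ℚ) (f : PowerSeries B) :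
    substMono τ c f = inMono τ fun r => c ^ r • PowerSeries.coeff r f :=
  eq_inMono hτ (fun r => coeff_substMono_smul c hτ f r) fun _ hm => coeff_substMono_of_forall c f hm

theorem filtered_inMono {Fil : ℕ → AddSubgroup B} (hF : IsFiltration Fil) {τ : σ →₀ ℕ} (hτ : τ ≠ 0)
    {a : ℕ → B} (ha : ∀ r, a r ∈ Fil (r + 1)) : Filtered Fil (inMono τ a) := by
  intro m
  by_cases h : ∃ r : ℕ, m = r • τ
  · obtain ⟨r, rfl⟩ := h
    rw [coeff_inMono_smul hτ, map_nsmul, smul_eq_mul]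
    have := degree_pos_of_ne_zero hτ
    exact hF.mono (by nlinarith) (ha r)
  · push Not at h
    rw [coeff_inMono_of_forall a h]
    exact zero_mem _

theorem halfFiltered_inMono {Fil : ℕ → AddSubgroup B} (hF : IsFiltration Fil) {τ : σ →₀ ℕ}
    (hτ : 2 ≤ τ.degree) {a : ℕ → B} (ha : ∀ r, a r ∈ Fil (r + 1)) :
    HalfFiltered Fil (inMono τ a) := by
  have hτ' : τ ≠ 0 := by
    rintro rfl
    simp at hτ
  intro m
  by_cases h : ∃ r : ℕ, m = r • τ
  · obtain ⟨r, rfl⟩ := h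
    rw [coeff_inMono_smul hτ', map_nsmul, smul_eq_mul]
    refine hF.mono ?_ (ha r)
    have : r * 2 ≤ r * τ.degree := Nat.mul_le_mul_left r hτ
    omega
  · push Not at h
    rw [coeff_inMono_of_forall a h]
    exact zero_mem _

theorem inVar_eq_inMono (k : Fin 2) (a : ℕ → B) : inVar k a = inMono (Finsupp.single k 1) a := by
  refine eq_inMono (by simp) (fun r => ?_) fun m hm => ?_
  · change (if r • Finsupp.single k 1 = Finsupp.single k ((r • Finsupp.single k 1 : Fin 2 →₀ ℕ) k)
      then a ((r • Finsupp.single k 1 : Fin 2 →₀ ℕ) k) else 0) = _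
    simp
  · change (if m = Finsupp.single k (m k) then a (m k) else 0) = _
    rw [if_neg]
    intro h
    refine hm (m k) ?_
    rw [Finsupp.smul_single, smul_eq_mul, mul_one, ← h]

/-- The monomial `u v`. -/
def uv : Fin 2 →₀ ℕ := Finsupp.single 0 1 + Finsupp.single 1 1

theorem uv_ne_zero : uv ≠ 0 := by
  intro h
  have := DFunLike.congr_fun h 0
  simp [uv] at this

theorem negUV_eq_inMono (a : ℕ → B) : negUV a = inMono uv fun r => (-1) ^ r * a r := by
  refine eq_inMono uv_ne_zero (fun r => ?_) fun m hm => ?_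
  · change (if (r • uv) 0 = (r • uv) 1 then (-1) ^ ((r • uv) 0) * a ((r • uv) 0) else 0) = _
    simp [uv]
  · change (if m 0 = m 1 then (-1) ^ (m 0) * a (m 0) else 0) = _
    rw [if_neg]
    intro h
    refine hm (m 0) ?_
    ext i
    fin_cases i
    · simp [uv]
    · simp [uv, h]

theorem map_invOfUnit {C : Type*} [Ring C] (φ : B →+* C) {f : MvPowerSeries σ B}
    (hf : constantCoeff f = 1) :
    MvPowerSeries.map φ (invOfUnit f 1) = invOfUnit (MvPowerSeries.map φ f) 1 := by
  have h1 : MvPowerSeries.map φ (invOfUnit f 1) * MvPowerSeries.map φ f = 1 := by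
    rw [← map_mul, invOfUnit_mul f 1 (by simpa using hf), map_one]
  have h2 : MvPowerSeries.map φ f * invOfUnit (MvPowerSeries.map φ f) 1 = 1 :=
    mul_invOfUnit _ 1 (by simp [hf])
  exact left_inv_eq_right_inv h1 h2

/-- A series in which only the variables in `s` occur. -/
def VarsIn (s : Set σ) (f : MvPowerSeries σ B) : Prop :=
  ∀ m : σ →₀ ℕ, (∃ k, k ∉ s ∧ m k ≠ 0) → coeff m f = 0

/-- The variable `k` does not occur in `f`, so there is only one way to split the monomial. -/
theorem coeff_inMono_single_mul {k : σ} {s : Set σ} (hk : k ∉ s) (a : ℕ → B)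
    {f : MvPowerSeries σ B} (hf : VarsIn s f) (r : ℕ) {m : σ →₀ ℕ} (hm : m k = 0) :
    coeff (Finsupp.single k r + m) (inMono (Finsupp.single k 1) a * f) = a r * coeff m f := by
  classical
  rw [MvPowerSeries.coeff_mul, sum_eq_single ((Finsupp.single k r : σ →₀ ℕ), m)]
  · dsimp only
    have := coeff_inMono_smul (τ := Finsupp.single k 1) (by simp) a r
    rw [Finsupp.smul_single, smul_eq_mul, mul_one] at this
    rw [this]
  · rintro ⟨p, q⟩ hp hne
    dsimp only
    rw [HasAntidiagonal.mem_antidiagonal] at hp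
    dsimp only at hp
    by_cases h : ∃ n : ℕ, p = n • Finsupp.single k 1
    · obtain ⟨n, rfl⟩ := h
      rw [hf q, mul_zero]
      refine ⟨k, hk, fun hq => hne ?_⟩
      rw [Finsupp.smul_single, smul_eq_mul, mul_one] at hp ⊢
      have h1 := DFunLike.congr_fun hp k
      simp [hm, hq] at h1
      subst h1
      rw [add_left_cancel hp]
    · push Not at h
      rw [coeff_inMono_of_forall a h, zero_mul]
  · intro h
    exfalso
    apply h
    rw [HasAntidiagonal.mem_antidiagonal]

theorem VarsIn.inMono_single_mul {k : σ} {s t : Set σ} (hs : s ⊆ t) (hk : k ∈ t) (a : ℕ → B)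
    {f : MvPowerSeries σ B} (hf : VarsIn s f) : VarsIn t (inMono (Finsupp.single k 1) a * f) := by
  classical
  rintro m ⟨j, hj, hm⟩
  rw [MvPowerSeries.coeff_mul]
  refine sum_eq_zero ?_
  rintro ⟨p, q⟩ hp
  dsimp only
  rw [HasAntidiagonal.mem_antidiagonal] at hp
  dsimp only at hp
  by_cases h : ∃ n : ℕ, p = n • Finsupp.single k 1
  · obtain ⟨n, rfl⟩ := h
    rw [hf q ⟨j, fun h => hj (hs h), fun h0 => hm ?_⟩, mul_zero]
    have hjk : k ≠ j := fun h => hj (h ▸ hk)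
    rw [← hp, Finsupp.add_apply, h0, Finsupp.smul_apply, Finsupp.single_eq_of_ne' hjk]
    simp
  · push Not at h
    rw [coeff_inMono_of_forall a h, zero_mul]

/-- The product of the series `∑ a(i) t^r` for the letters `i` of a word, in different variables. -/
def wordSeries {ι : Type*} (a : ι → ℕ → B) : List ι → MvPowerSeries ℕ B
  | [] => 1
  | i :: L => inMono (Finsupp.single L.length 1) (a i) * wordSeries a L

/-- The monomial that marks a word of indexed letters. -/
def wordMono {ι : Type*} : List (ℕ+ × ι) → ℕ →₀ ℕ
  | [] => 0
  | p :: l => Finsupp.single l.length (p.1 : ℕ) + wordMono l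

theorem wordMono_apply {ι : Type*} (l : List (ℕ+ × ι)) {k : ℕ} (hk : l.length ≤ k) :
    wordMono l k = 0 := by
  induction l with
  | nil => rfl
  | cons p l ih =>
    rw [List.length_cons] at hk
    rw [wordMono, Finsupp.add_apply, ih (by omega), Finsupp.single_eq_of_ne (by omega)]

theorem degree_wordMono {ι : Type*} (l : List (ℕ+ × ι)) :
    (wordMono l).degree = wordWeight (fun p => (p.1 : ℕ)) l := by
  induction l with
  | nil => simp [wordMono, wordWeight]
  | cons p l ih => rw [wordMono, map_add, ih, wordWeight_cons, Finsupp.degree_single]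

theorem varsIn_wordSeries {ι : Type*} (a : ι → ℕ → B) (L : List ι) :
    VarsIn {k | k < L.length} (wordSeries a L) := by
  classical
  induction L with
  | nil =>
    rintro m ⟨k, _, hk⟩
    rw [wordSeries, MvPowerSeries.coeff_one, if_neg]
    rintro rfl
    exact hk rfl
  | cons i L ih =>
    refine ih.inMono_single_mul ?_ ?_ _
    · intro k hk
      simp at hk ⊢
      omega
    · simp

/-- Each letter has a variable of its own, numbered from the right, so a single coefficient isolates
a word. This is how statements on products of the series `E_U` descend to words in the `e_r(U)`. -/
theorem coeff_wordSeries {ι : Type*} (a : ι → ℕ → B) (l : List (ℕ+ × ι)) :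
    coeff (wordMono l) (wordSeries a (l.map Prod.snd)) =
      (l.map fun p => a p.2 (p.1 : ℕ)).prod := by
  classical
  induction l with
  | nil => simp [wordMono, wordSeries]
  | cons p l ih =>
    rw [List.map_cons, List.map_cons, List.prod_cons, wordMono, wordSeries, List.length_map,
      coeff_inMono_single_mul _ _ (varsIn_wordSeries a _), ih]
    · exact wordMono_apply l le_rfl
    · simp

end InMono

end

end GInf

namespace GInf

set_option linter.unusedSectionVars false

noncomputable section

open MvPowerSeries Finset

/-! ### Constant terms and symbols of the `e_r` -/

section Constants

variable {R : Type*} [Ring R] {ι : Type*} (β : Module.Basis ι ℚ (RatExt R))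

theorem e_zero_left (U : R) : e 0 U = 1 := by
  change coeff (Finsupp.single () 0) (infProd _) = 1
  rw [Finsupp.single_zero]
  change coeff 0 (((List.range (0 : Unit →₀ ℕ).degree).map fun k => Theta k.succPNat
    (PowerSeries.monomial (k.succPNat : ℕ) (-((-1 : ℚ) ^ (k.succPNat : ℕ)) • toRat U))).prod) = _
  rw [map_zero, List.range_zero, List.map_nil, List.prod_nil, coeff_zero_one]

theorem toRat_mul (U V : R) : toRat U * toRat V = toRat (U * V) :=
  (Algebra.TensorProduct.tmul_mul_tmul (R := ℤ) (1 : ℚ) 1 U V).trans (by rw [one_mul]; rfl)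

theorem toRat_zero : toRat (0 : R) = 0 := TensorProduct.tmul_zero _ _

include β in
theorem ESeries_zero : ESeries (0 : R) = 1 := by
  rw [ESeries_eq_bigTheta]
  have h : eFamily (Finsupp.single () 1) 1 (0 : R) = 0 := by
    ext1 l
    rw [eFamily, toRat_zero, smul_zero, map_zero]
    rfl
  apply hatSym_injective β
  rw [h, hatSym_bigTheta β increasingOrder_zero, expo_zero, expSeries_zero]
  exact (hatSym_one β).symm

include β in
theorem e_zero_right {n : ℕ} (hn : n ≠ 0) : e n (0 : R) = 0 := by
  rw [e, ESeries_zero β, PowerSeries.coeff_one, if_neg hn]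

theorem inMono_sym_e {σ : Type*} {τ : σ →₀ ℕ} (hτ : τ ≠ 0) (c : ℚ) (U : R) :
    inMono τ (fun r => c ^ r • sym β (e r U)) =
      expSeries (expo β (eFamily τ c U)) := by
  rw [← hatSym_substMono_ESeries β hτ]
  refine (eq_inMono hτ (fun r => ?_) fun m hm => ?_).symm
  · rw [coeff_hatSym, coeff_substMono_smul c hτ, map_smul]
    rfl
  · rw [coeff_hatSym, coeff_substMono_of_forall c _ hm, map_zero]

theorem substMono_ESeries_one {σ : Type*} {τ : σ →₀ ℕ} (hτ : τ ≠ 0) (U : R) :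
    substMono τ 1 (ESeries U) = inMono τ fun r => e r U := by
  rw [substMono_eq_inMono hτ]
  congr 1
  ext1 r
  rw [one_pow, one_smul]
  rfl

end Constants

/-! ### Newton's recursion for the logarithm -/

section Newton

variable {C : Type*} [CommRing C] [Algebra ℚ C]

/-- The coefficients of `log (1 + ∑ x_n t^n)`, by Newton's recursion. -/
def newtonLog (x : ℕ → C) (n : ℕ) : C :=
  x n - (n : ℚ)⁻¹ • ∑ k : Fin n, (k : ℕ) • (newtonLog x k * x (n - k))

theorem newtonLog_spec {x : ℕ → C} (hx : x 0 = 1) (n : ℕ) :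
    n • x n = ∑ p ∈ antidiagonal n, p.1 • (newtonLog x p.1 * x p.2) := by
  rw [Nat.sum_antidiagonal_eq_sum_range_succ_mk, sum_range_succ, Nat.sub_self, hx, mul_one]
  by_cases hn : n = 0
  · subst hn
    simp
  · have h := newtonLog.eq_1 x n
    rw [Fin.sum_univ_eq_sum_range (fun k => k • (newtonLog x k * x (n - k)))] at h
    rw [h, smul_sub, ← Nat.cast_smul_eq_nsmul ℚ n ((n : ℚ)⁻¹ • _), smul_smul,
      mul_inv_cancel₀ (by exact_mod_cast hn), one_smul]
    ring

end Newton

/-! ### Algebraic independence of the symbols of the generators -/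

section Independence

variable {R : Type*} [Ring R] {ι : Type*} (b : Module.Basis ι ℤ R)
  (β : Module.Basis ι ℚ (RatExt R))

/-- The homomorphism that sends the variable of `(r, i)` to the symbol of `e_r` of the `i`-th
basis element. -/
def chi : MvPolynomial (ℕ+ × ι) ℤ →ₐ[ℤ] MvPolynomial (ℕ+ × ι) ℚ :=
  MvPolynomial.aeval fun p => sym β (e (p.1 : ℕ) (b p.2))

theorem chi_X (p : ℕ+ × ι) : chi b β (MvPolynomial.X p) = sym β (e (p.1 : ℕ) (b p.2)) :=
  MvPolynomial.aeval_X _ _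

variable {b β} (hβ : ∀ i, β i = toRat (b i))

include hβ

/-- The symbol of `E_U(t)` is `exp (∑ (-1)^(k+1) X_k(U) t^k)`, so these are Newton's identities for
the elementary symmetric functions with power sums `k X_k(U)`. -/
theorem newton_sym_e (i : ι) (n : ℕ) :
    n • sym β (e n (b i)) = ∑ p ∈ antidiagonal n,
      p.1 • ((-1 : ℚ) ^ (p.1 + 1) • MvPolynomial.X ((p.1 - 1).succPNat, i) *
        sym β (e p.2 (b i))) := by
  have h1 : (Finsupp.single () 1 : Unit →₀ ℕ) ≠ 0 := by simp
  have hinc := increasingOrder_eFamily (R := R) h1 1 (b i)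
  set f : PowerSeries (MvPolynomial (ℕ+ × ι) ℚ) :=
    expo β (eFamily (Finsupp.single () 1) 1 (b i)) with hf
  have h2 : ∀ k, sym β (e k (b i)) = PowerSeries.coeff k (expS f) := by
    intro k
    rw [expS_eq_expSeries, hf, ← hatSym_bigTheta β hinc, ← ESeries_eq_bigTheta]
    rfl
  have h3 : ∀ k, k ≠ 0 → PowerSeries.coeff k f =
      (-1 : ℚ) ^ (k + 1) • MvPolynomial.X ((k - 1).succPNat, i) := by
    classical
    intro k hk
    have h4 : ((k - 1).succPNat : ℕ) = k := by
      rw [Nat.succPNat_coe]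
      omega
    rw [PowerSeries.coeff, hf, coeff_expo β hinc (N := k) (by simp), sum_eq_single (k - 1)]
    · rw [coeff_hatX, eFamily, coeff_monomial, if_pos (by simp [h4]), map_smul, ← hβ,
        fockX_basis, h4, pow_succ, mul_neg_one]
    · intro j _ hj
      rw [coeff_hatX, eFamily, coeff_monomial, if_neg, map_zero]
      intro h
      have h5 := DFunLike.congr_fun h ()
      simp at h5
      omega
    · intro h
      exfalso
      simp at h
      omega
  rw [h2, coeff_expS_newton (constantCoeff_expo β) (fun _ _ => Commute.all _ _)]
  refine sum_congr rfl fun p _ => ?_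
  -- For `p.1 = 0` the truncated index `(p.1 - 1).succPNat` is meaningless, but the factor `p.1`
  -- removes the term.
  by_cases hp : p.1 = 0
  · rw [hp, zero_smul, zero_smul]
  · rw [h2, h3 p.1 hp]

/-- Over `ℚ`, Newton's identities can be solved for the variables. This gives an endomorphism `ψ`
that sends the symbol of `e_n` of the `i`-th basis element to the variable `(n, i)`, so that `ψ ∘
chi` is the inclusion of the integral polynomials. -/
theorem chi_injective : Function.Injective (chi b β) := by
  let x : ι → ℕ → MvPolynomial (ℕ+ × ι) ℚ := fun i n =>
    if n = 0 then 1 else MvPolynomial.X ((n - 1).succPNat, i)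
  have hx0 : ∀ i, x i 0 = 1 := fun i => if_pos rfl
  -- The sign cancels the one in `newton_sym_e`.
  let ψ : MvPolynomial (ℕ+ × ι) ℚ →ₐ[ℚ] MvPolynomial (ℕ+ × ι) ℚ :=
    MvPolynomial.aeval fun p => (-1 : ℚ) ^ ((p.1 : ℕ) + 1) • newtonLog (x p.2) p.1
  have hψ : ∀ i n, ψ (sym β (e n (b i))) = x i n := by
    intro i n
    induction n using Nat.strong_induction_on with
    | _ n ih =>
      by_cases hn : n = 0
      · subst hn
        rw [e_zero_left, sym_one, map_one, hx0]
      · have h1 := congrArg ψ (newton_sym_e hβ i n)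
        rw [map_nsmul, map_sum] at h1
        have h2 := newtonLog_spec (hx0 i) n
        have h3 : n • ψ (sym β (e n (b i))) = n • x i n := by
          rw [h1, h2]
          refine sum_congr rfl fun p hp => ?_
          rw [HasAntidiagonal.mem_antidiagonal] at hp
          rw [map_nsmul, map_mul]
          by_cases hp0 : p.1 = 0
          · rw [hp0, zero_smul, zero_smul]
          · have h4 : ((p.1 - 1).succPNat : ℕ) = p.1 := by
              rw [Nat.succPNat_coe]
              omega
            rw [ih p.2 (by omega), map_smul, MvPolynomial.aeval_X, smul_smul, h4, ← mul_pow,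
              neg_one_mul, neg_neg, one_pow, one_smul]
        exact (smul_right_inj hn).1 h3
  have h : ∀ p, ψ (chi b β p) = MvPolynomial.map (Int.castRingHom ℚ) p := by
    intro p
    induction p using MvPolynomial.induction_on with
    | C a => simp
    | add p q hp hq => rw [map_add, map_add, map_add, hp, hq]
    | mul_X p j hp =>
      rw [map_mul, map_mul, map_mul, hp, chi_X, hψ, MvPolynomial.map_X]
      have h4 : ((j.1 : ℕ) - 1).succPNat = j.1 := j.1.succPNat_natPred
      rw [show x j.2 j.1 = _ from if_neg j.1.pos.ne', h4]
  intro p q hpq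
  refine MvPolynomial.map_injective (Int.castRingHom ℚ) Int.cast_injective ?_
  rw [← h, ← h, hpq]

end Independence

end

end GInf

namespace GInf

set_option linter.unusedSectionVars false

noncomputable section

open MvPowerSeries Finset

/-! ### The formal series `E_W`, for `W` zero or in the basis -/

section Formal

variable {R : Type*} [Ring R] {ι : Type*} (b : Module.Basis ι ℤ R)

/-- The element is zero or belongs to the basis. -/
def ZeroOrBasis (W : R) : Prop := W = 0 ∨ ∃ k, W = b k

theorem zeroOrBasis_basis (i : ι) : ZeroOrBasis b (b i) := Or.inr ⟨i, rfl⟩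

theorem ZeroOrBasis.mul_left {b : Module.Basis ι ℤ R}
    (hb : ∀ i j : ι, b i * b j = 0 ∨ ∃ k : ι, b i * b j = b k)
    (i : ι) {W : R} (hW : ZeroOrBasis b W) : ZeroOrBasis b (b i * W) := by
  obtain rfl | ⟨k, rfl⟩ := hW
  · exact Or.inl (mul_zero _)
  · exact hb i k

theorem formalE_zero (W : R) : formalE b W 0 = 1 := dif_neg (lt_irrefl 0)

theorem formalE_basis (r : ℕ+) (i : ι) : formalE b (b i) r = gen r i := by
  have h : ∃ k, b k = b i := ⟨i, rfl⟩
  have h1 : h.choose = i := b.injective h.choose_spec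
  rw [formalE, dif_pos r.pos, dif_pos h, h1]
  rfl

theorem formalE_zero_right {n : ℕ} (hn : n ≠ 0) : formalE b 0 n = 0 := by
  rw [formalE, dif_pos (Nat.pos_of_ne_zero hn), dif_neg]
  rintro ⟨k, hk⟩
  exact b.ne_zero k hk

/-- A general comparison, used for the symbols and for the rational algebra; the conventions `E_W(0)
= 1` and `E_0 = 1` must hold in the target as well. -/
theorem map_formalE {C : Type*} [Ring C] (f : FreeAlgebra ℤ (ℕ+ × ι) →+* C) (a : R → ℕ → C)
    (h0 : ∀ W, a W 0 = 1) (hz : ∀ n, n ≠ 0 → a 0 n = 0) (hg : ∀ r i, f (gen r i) = a (b i) r)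
    {W : R} (hW : ZeroOrBasis b W) (n : ℕ) : f (formalE b W n) = a W n := by
  by_cases hn : n = 0
  · subst hn
    rw [formalE_zero, map_one, h0]
  · obtain rfl | ⟨k, rfl⟩ := hW
    · rw [formalE_zero_right b hn, map_zero, hz n hn]
    · lift n to ℕ+ using Nat.pos_of_ne_zero hn
      rw [formalE_basis, hg]

/-- The coefficients of `E_W(t)` in commuting variables. -/
def formalX (W : R) (n : ℕ) : MvPolynomial (ℕ+ × ι) ℤ :=
  FreeAlgebra.lift ℤ MvPolynomial.X (formalE b W n)

theorem formalX_zero (W : R) : formalX b W 0 = 1 := by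
  rw [formalX, formalE_zero, map_one]

theorem formalX_basis (r : ℕ+) (i : ι) : formalX b (b i) r = MvPolynomial.X (r, i) := by
  rw [formalX, formalE_basis, gen, FreeAlgebra.lift_ι_apply]

theorem formalX_zero_right {n : ℕ} (hn : n ≠ 0) : formalX b 0 n = 0 := by
  rw [formalX, formalE_zero_right b hn, map_zero]

/-- The filtration by weight, where the variable of `(r, i)` has weight `r`. -/
def polyFil (ι : Type*) (n : ℕ) : AddSubgroup (MvPolynomial (ℕ+ × ι) ℤ) :=
  (polyBelow ℤ (fun p : ℕ+ × ι => (p.1 : ℕ)) n).toAddSubgroup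

theorem isFiltration_polyFil : IsFiltration (polyFil ι) where
  mono _ _ h := polyBelow_mono h
  one_mem := one_mem_polyBelow
  mul_mem_right hx hy := mul_mem_polyBelow hx hy
  mul_mem_left {m n x y} hx hy := by
    rw [mul_comm, add_comm]
    exact mul_mem_polyBelow hy hx

theorem formalX_mem {W : R} (hW : ZeroOrBasis b W) (n : ℕ) : formalX b W n ∈ polyFil ι (n + 1) := by
  by_cases hn : n = 0
  · subst hn
    rw [formalX_zero]
    exact one_mem_polyBelow
  · obtain rfl | ⟨k, rfl⟩ := hW
    · rw [formalX_zero_right b hn]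
      exact zero_mem _
    · lift n to ℕ+ using Nat.pos_of_ne_zero hn
      rw [formalX_basis]
      exact X_mem_polyBelow (K := ℤ) (w := fun p : ℕ+ × ι => (p.1 : ℕ)) (n, k)

variable (β : Module.Basis ι ℚ (RatExt R))

theorem chi_formalX {W : R} (hW : ZeroOrBasis b W) (n : ℕ) :
    chi b β (formalX b W n) = sym β (e n W) := by
  refine map_formalE b ((chi b β).toRingHom.comp (FreeAlgebra.lift ℤ MvPolynomial.X).toRingHom)
    (fun W n => sym β (e n W)) (fun W => ?_) (fun n hn => ?_) (fun r i => ?_) hW n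
  · rw [e_zero_left, sym_one]
  · rw [e_zero_right β hn, map_zero]
  · change chi b β (FreeAlgebra.lift ℤ MvPolynomial.X (gen r i)) = _
    rw [gen, FreeAlgebra.lift_ι_apply, chi_X]

end Formal

/-! ### Symbols of words as integral polynomials -/

section Entries

variable {σ : Type*} {R : Type*} [Ring R] {ι : Type*} (b : Module.Basis ι ℤ R)
  (β : Module.Basis ι ℚ (RatExt R))

/-- The series `E_W(τ)` or `E_W(-τ)⁻¹` in commuting variables. -/
def entrySeries : Bool × (σ →₀ ℕ) × R → MvPowerSeries σ (MvPolynomial (ℕ+ × ι) ℤ)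
  | (true, τ, W) => inMono τ (formalX b W)
  | (false, τ, W) => invOfUnit (inMono τ fun r => (-1) ^ r * formalX b W r) 1

/-- The families whose exponentials are `E_W(τ)` and `E_W(-τ)⁻¹`. -/
def entryFamily : Bool × (σ →₀ ℕ) × R → ℕ+ → MvPowerSeries σ (RatExt R)
  | (true, τ, W) => eFamily τ 1 W
  | (false, τ, W) => -eFamily τ (-1) W

theorem expo_neg (y : ℕ+ → MvPowerSeries σ (RatExt R)) : expo β (-y) = -expo β y := by
  rw [eq_neg_iff_add_eq_zero, ← expo_add, neg_add_cancel, expo_zero]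

theorem constantCoeff_aux {τ : σ →₀ ℕ} (hτ : τ ≠ 0) (W : R) :
    constantCoeff (inMono τ fun r => (-1) ^ r * formalX b W r) = 1 := by
  rw [constantCoeff_inMono hτ, pow_zero, one_mul, formalX_zero]

theorem constantCoeff_entrySeries (s : Bool) {τ : σ →₀ ℕ} (hτ : τ ≠ 0) (W : R) :
    constantCoeff (entrySeries b (s, τ, W)) = 1 := by
  cases s
  · rw [entrySeries, constantCoeff_invOfUnit, inv_one, Units.val_one]
  · rw [entrySeries, constantCoeff_inMono hτ, formalX_zero]

theorem map_inMono_formalX {W : R} (hW : ZeroOrBasis b W) {τ : σ →₀ ℕ} (hτ : τ ≠ 0) :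
    MvPowerSeries.map (chi b β).toRingHom (inMono τ (formalX b W)) =
      expSeries (expo β (eFamily τ 1 W)) := by
  rw [map_inMono _ hτ, ← inMono_sym_e β hτ]
  congr 1
  ext1 r
  rw [one_pow, one_smul]
  exact chi_formalX b β hW r

theorem map_inMono_neg_formalX {W : R} (hW : ZeroOrBasis b W) {τ : σ →₀ ℕ} (hτ : τ ≠ 0) :
    MvPowerSeries.map (chi b β).toRingHom (inMono τ fun r => (-1) ^ r * formalX b W r) =
      expSeries (expo β (eFamily τ (-1) W)) := by
  rw [map_inMono _ hτ, ← inMono_sym_e β hτ]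
  congr 1
  ext1 r
  rw [map_mul, map_pow, map_neg, map_one, Algebra.smul_def, map_pow, map_neg, map_one]
  congr 1
  exact chi_formalX b β hW r

theorem map_entrySeries (s : Bool) {W : R} (hW : ZeroOrBasis b W) {τ : σ →₀ ℕ} (hτ : τ ≠ 0) :
    MvPowerSeries.map (chi b β).toRingHom (entrySeries b (s, τ, W)) =
      expSeries (expo β (entryFamily (s, τ, W))) := by
  cases s
  · rw [entrySeries, entryFamily]
    have h1 := congrArg (MvPowerSeries.map (chi b β).toRingHom)
      (mul_invOfUnit _ 1 (constantCoeff_aux b hτ W))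
    rw [map_mul, map_one, map_inMono_neg_formalX b β hW hτ] at h1
    refine (left_inv_eq_right_inv ?_ h1).symm
    rw [← expSeries_add (constantCoeff_expo β) (constantCoeff_expo β), ← expo_add,
      neg_add_cancel, expo_zero, expSeries_zero]
  · exact map_inMono_formalX b β hW hτ

theorem halfFiltered_entrySeries (s : Bool) {W : R} (hW : ZeroOrBasis b W) {τ : σ →₀ ℕ}
    (hτ : 2 ≤ τ.degree) : HalfFiltered (polyFil ι) (entrySeries b (s, τ, W)) := by
  cases s
  · refine HalfFiltered.invOfUnit isFiltration_polyFil
      (halfFiltered_inMono isFiltration_polyFil hτ fun r => ?_)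
    obtain h | h := neg_one_pow_eq_or (MvPolynomial (ℕ+ × ι) ℤ) r
    · rw [h, one_mul]
      exact formalX_mem b hW r
    · rw [h, neg_one_mul]
      exact neg_mem (formalX_mem b hW r)
  · exact halfFiltered_inMono isFiltration_polyFil hτ (formalX_mem b hW)

theorem increasingOrder_entryFamily (s : Bool) {τ : σ →₀ ℕ} (hτ : τ ≠ 0) (W : R) :
    IncreasingOrder (entryFamily (s, τ, W)) := by
  cases s
  · exact (increasingOrder_eFamily hτ (-1) W).neg
  · exact increasingOrder_eFamily hτ 1 W

/-- Here closure of the shapes under products is seen: `-(-τ)^l U` times `-(-τ')^l W` is `(ττ')^l U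
W`, which belongs to `E_(UW)(-ττ')⁻¹`, and multiplying an inverse entry gives a direct one. -/
theorem eFamily_mul_entryFamily (s : Bool) (τ τ' : σ →₀ ℕ) (U W : R) :
    eFamily τ 1 U * entryFamily (s, τ', W) = entryFamily (!s, τ + τ', U * W) := by
  ext1 l
  cases s
  · change eFamily τ 1 U l * (-eFamily τ' (-1) W l) = eFamily (τ + τ') 1 (U * W) l
    rw [eFamily, eFamily, eFamily, ← map_neg, monomial_mul_monomial, smul_add, ← smul_neg,
      smul_mul_smul_comm, mul_neg (toRat U), toRat_mul]
    simp
  · change eFamily τ 1 U l * (eFamily τ' 1 W l) = -eFamily (τ + τ') (-1) (U * W) l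
    rw [eFamily, eFamily, eFamily, ← map_neg, monomial_mul_monomial, smul_add,
      smul_mul_smul_comm, toRat_mul, neg_mul_neg, ← mul_pow]
    simp

/-- Admissible lists of entries. -/
def GoodEntries (L : List (Bool × (σ →₀ ℕ) × R)) : Prop :=
  ∀ t ∈ L, t.2.1 ≠ 0 ∧ ZeroOrBasis b t.2.2

variable {b}

theorem increasingOrder_sum {L : List (Bool × (σ →₀ ℕ) × R)} (hL : GoodEntries b L) :
    IncreasingOrder (L.map entryFamily).sum := by
  induction L with
  | nil => exact increasingOrder_zero
  | cons t L ih =>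
    rw [List.map_cons, List.sum_cons]
    exact (increasingOrder_entryFamily t.1 (hL t List.mem_cons_self).1 t.2.2).add
      (ih fun t' ht' => hL t' (List.mem_cons_of_mem _ ht'))

theorem map_prod_entrySeries {L : List (Bool × (σ →₀ ℕ) × R)} (hL : GoodEntries b L) :
    MvPowerSeries.map (chi b β).toRingHom (L.map (entrySeries b)).prod =
      expSeries (expo β (L.map entryFamily).sum) := by
  induction L with
  | nil => simp [expo_zero, expSeries_zero]
  | cons t L ih =>
    have ht := hL t List.mem_cons_self
    rw [List.map_cons, List.prod_cons, List.map_cons, List.sum_cons, map_mul,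
      ih fun t' ht' => hL t' (List.mem_cons_of_mem _ ht'), expo_add,
      expSeries_add (constantCoeff_expo β) (constantCoeff_expo β)]
    congr 1
    exact map_entrySeries b β t.1 ht.2 ht.1

/-- The entries that appear when an entry is multiplied by `-(-τ)^l U`. -/
def flipEntry (τ : σ →₀ ℕ) (U : R) (t : Bool × (σ →₀ ℕ) × R) : Bool × (σ →₀ ℕ) × R :=
  (!t.1, τ + t.2.1, U * t.2.2)

theorem eFamily_mul_sum (τ : σ →₀ ℕ) (U : R) (L : List (Bool × (σ →₀ ℕ) × R)) :
    eFamily τ 1 U * (L.map entryFamily).sum =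
      ((L.map (flipEntry τ U)).map entryFamily).sum := by
  induction L with
  | nil => simp
  | cons t L ih =>
    rw [List.map_cons, List.sum_cons, mul_add, ih, List.map_cons, List.map_cons, List.sum_cons]
    congr 1
    exact eFamily_mul_entryFamily t.1 τ t.2.1 U t.2.2

/-- Entries in monomials of degree at least `2` have coefficients of weight at most half the degree.
Products of them do not affect leading terms. -/
theorem halfFiltered_prod {L : List (Bool × (σ →₀ ℕ) × R)}
    (hL : ∀ t ∈ L, 2 ≤ t.2.1.degree ∧ ZeroOrBasis b t.2.2) :
    HalfFiltered (polyFil ι) (L.map (entrySeries b)).prod ∧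
      constantCoeff (L.map (entrySeries b)).prod = 1 := by
  induction L with
  | nil => exact ⟨halfFiltered_one isFiltration_polyFil, map_one _⟩
  | cons t L ih =>
    have ht := hL t List.mem_cons_self
    have h1 := ih fun t' ht' => hL t' (List.mem_cons_of_mem _ ht')
    have hτ : t.2.1 ≠ 0 := by
      intro h
      rw [h] at ht
      simp at ht
    rw [List.map_cons, List.prod_cons]
    refine ⟨(halfFiltered_entrySeries b t.1 ht.2 ht.1).mul isFiltration_polyFil h1.1, ?_⟩
    rw [map_mul, h1.2, mul_one]
    exact constantCoeff_entrySeries b t.1 hτ t.2.2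

theorem filtered_wordSeries (L : List ι) :
    Filtered (polyFil ι) (wordSeries (fun i => formalX b (b i)) L) := by
  induction L with
  | nil => exact filtered_one isFiltration_polyFil
  | cons i L ih =>
    exact (filtered_inMono isFiltration_polyFil (by simp)
      (formalX_mem b (zeroOrBasis_basis b i))).mul isFiltration_polyFil ih

variable (hb : ∀ i j : ι, b i * b j = 0 ∨ ∃ k : ι, b i * b j = b k)

include hb

/-- By induction on the word, the product of the `E_U` in separate variables has as symbol a product
of factors `E_W(τ)` and `E_W(-τ)⁻¹` in commuting variables. Those whose `τ` is a single variable
give the leading part; all others have `τ` of degree at least `2` and only contribute lower weight.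
-/
theorem exists_entries (L : List ι) : ∃ Es : List (Bool × (ℕ →₀ ℕ) × R), GoodEntries b Es ∧
    hatSym β (wordSeries (fun i n => e n (b i)) L) = expSeries (expo β (Es.map entryFamily).sum) ∧
    Filtered (polyFil ι) (Es.map (entrySeries b)).prod ∧
    LowCongr (polyFil ι) (Es.map (entrySeries b)).prod
      (wordSeries (fun i => formalX b (b i)) L) := by
  have hF := isFiltration_polyFil (ι := ι)
  induction L with
  | nil =>
    refine ⟨[], fun t ht => absurd ht (List.not_mem_nil), ?_, filtered_one hF, LowCongr.rfl⟩
    rw [wordSeries, hatSym_one, List.map_nil, List.sum_nil, expo_zero, expSeries_zero]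
  | cons i L ih =>
    obtain ⟨Es, hgood, hsym, hfil, hlow⟩ := ih
    have hτ : (Finsupp.single L.length 1 : ℕ →₀ ℕ) ≠ 0 := by simp
    set τ : ℕ →₀ ℕ := Finsupp.single L.length 1 with hτd
    have hflip : ∀ t ∈ Es.map (flipEntry τ (b i)), 2 ≤ t.2.1.degree ∧ ZeroOrBasis b t.2.2 := by
      intro t ht
      obtain ⟨t', ht', rfl⟩ := List.mem_map.1 ht
      refine ⟨?_, (hgood t' ht').2.mul_left hb i⟩
      have h1 := degree_pos_of_ne_zero (hgood t' ht').1
      have h2 := degree_pos_of_ne_zero hτ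
      change 2 ≤ (τ + t'.2.1).degree
      rw [map_add]
      omega
    obtain ⟨hhalf, hconst⟩ := halfFiltered_prod hflip
    have hE := filtered_inMono hF hτ (formalX_mem b (zeroOrBasis_basis b i))
    -- The three groups are the terms of `(1 + x)(1 + y) - 1 = x + y + x y`, where `x` comes from
    -- the new letter and `y` from the rest of the word.
    refine ⟨(true, τ, b i) :: (Es ++ Es.map (flipEntry τ (b i))), ?_, ?_, ?_, ?_⟩
    · intro t ht
      rw [List.mem_cons, List.mem_append] at ht
      obtain rfl | ht | ht := ht
      · exact ⟨hτ, zeroOrBasis_basis b i⟩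
      · exact hgood t ht
      · refine ⟨fun h => ?_, (hflip t ht).2⟩
        have := (hflip t ht).1
        rw [h] at this
        simp at this
    · rw [wordSeries, ← substMono_ESeries_one hτ,
        hatSym_substMono_ESeries_mul β hτ 1 (b i) (increasingOrder_sum hgood) hsym,
        eFamily_mul_sum, List.map_cons, List.sum_cons, List.map_append, List.sum_append]
      congr 2
      rw [entryFamily]
      abel
    · rw [List.map_cons, List.prod_cons, List.map_append, List.prod_append]
      exact hE.mul hF (hfil.mul hF (hhalf.filtered hF))
    · rw [List.map_cons, List.prod_cons, List.map_append, List.prod_append, wordSeries]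
      -- The cross terms `x y` live in monomials of degree at least `2`, so their factors count as
      -- `1` in the leading part.
      have h1 := hlow.mul hF (hhalf.lowCongr_one hF hconst) (filtered_wordSeries L)
        (hhalf.filtered hF)
      rw [mul_one] at h1
      exact LowCongr.rfl.mul hF h1 hE (hfil.mul hF (hhalf.filtered hF))

/-- The symbol of a word in the `e_r(U)` is a polynomial in the symbols of the `e_r(U)`, whose
leading term is the corresponding monomial. -/
theorem exists_sym_word (l : List (ℕ+ × ι)) : ∃ p : MvPolynomial (ℕ+ × ι) ℤ,
    chi b β p = sym β (l.map fun p => e (p.1 : ℕ) (b p.2)).prod ∧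
    p - (l.map MvPolynomial.X).prod ∈
      polyBelow ℤ (fun p : ℕ+ × ι => (p.1 : ℕ)) (wordWeight (fun p => (p.1 : ℕ)) l) := by
  obtain ⟨Es, hgood, hsym, -, hlow⟩ := exists_entries β hb (l.map Prod.snd)
  refine ⟨coeff (wordMono l) (Es.map (entrySeries b)).prod, ?_, ?_⟩
  · have h1 := congrArg (coeff (wordMono l)) hsym
    rw [← map_prod_entrySeries β hgood, coeff_hatSym, coeff_wordSeries,
      MvPowerSeries.coeff_map] at h1
    exact h1.symm
  · have h1 := hlow (wordMono l)
    rw [coeff_wordSeries, degree_wordMono] at h1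
    have h2 : (l.map fun p => formalX b (b p.2) (p.1 : ℕ)) = l.map MvPolynomial.X :=
      List.map_congr_left fun p _ => formalX_basis b p.1 p.2
    rwa [h2] at h1

end Entries

end

end GInf

namespace GInf

set_option linter.unusedSectionVars false

noncomputable section

open MvPowerSeries Finset

/-! ### The defining relations hold in the rational algebra -/

section Relation

variable {σ : Type*} {R : Type*} [Ring R] {ι : Type*} (β : Module.Basis ι ℚ (RatExt R))

/-- The family `(1 + x_l)⁻¹ - 1`. -/
def invFamily (x : ℕ+ → MvPowerSeries σ (RatExt R)) (l : ℕ+) : MvPowerSeries σ (RatExt R) :=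
  invOfUnit (1 + x l) 1 - 1

variable {x : ℕ+ → MvPowerSeries σ (RatExt R)} (hx : IncreasingOrder x)

include hx

theorem one_add_mul_invOfUnit (l : ℕ+) : (1 + x l) * invOfUnit (1 + x l) 1 = 1 :=
  mul_invOfUnit _ 1 (by rw [map_add, map_one, hx.constantCoeff, add_zero, Units.val_one])

theorem invFamily_eq : invFamily x + (x + x * invFamily x) = 0 := by
  ext1 l
  have h := one_add_mul_invOfUnit hx l
  change invOfUnit (1 + x l) 1 - 1 + (x l + x l * (invOfUnit (1 + x l) 1 - 1)) = 0
  rw [← sub_eq_zero] at h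
  rw [← h]
  noncomm_ring

theorem increasingOrder_invFamily : IncreasingOrder (invFamily x) := by
  rw [eq_neg_of_add_eq_zero_left (invFamily_eq hx)]
  exact (hx.add (hx.mul_right _)).neg

include β in
-- On exponents this is `(1 + x)(1 + x)⁻¹ = 1`, so inverses of the series `E_W` are again of the
-- form `bigTheta`.
theorem bigTheta_mul_bigTheta_invFamily : bigTheta x * bigTheta (invFamily x) = 1 := by
  apply hatSym_injective β
  rw [hatSym_bigTheta_mul β hx (increasingOrder_invFamily hx)
    (hatSym_bigTheta β (increasingOrder_invFamily hx)), invFamily_eq hx, expo_zero, expSeries_zero,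
    hatSym_one]

end Relation

/-- With `d = (1 - qp)⁻¹` and `d' = (1 - pq)⁻¹` one has `p d = d' p`, `q d' = d q`, `p d q = d' - 1`
and `q d' p = d - 1`; both sides then expand to the same four terms. -/
theorem inverse_conj {A : Type*} [Ring A] (p q d d' : A) (h1 : (1 + -(q * p)) * d = 1)
    (h2 : (1 + -(p * q)) * d' = 1) (h1' : d * (1 + -(q * p)) = 1) (h2' : d' * (1 + -(p * q)) = 1) :
    (1 + p) * (d * (1 + q)) = (1 + q) * (d' * (1 + p)) := by
  have e1 : p * d = d' * p := by
    have : (1 + -(p * q)) * p * d = p := by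
      rw [show (1 + -(p * q)) * p = p * (1 + -(q * p)) by noncomm_ring, mul_assoc, h1, mul_one]
    calc p * d = d' * (1 + -(p * q)) * (p * d) := by rw [h2', one_mul]
      _ = d' * ((1 + -(p * q)) * p * d) := by noncomm_ring
      _ = d' * p := by rw [this]
  have e2 : q * d' = d * q := by
    have : (1 + -(q * p)) * q * d' = q := by
      rw [show (1 + -(q * p)) * q = q * (1 + -(p * q)) by noncomm_ring, mul_assoc, h2, mul_one]
    calc q * d' = d * (1 + -(q * p)) * (q * d') := by rw [h1', one_mul]
      _ = d * ((1 + -(q * p)) * q * d') := by noncomm_ring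
      _ = d * q := by rw [this]
  have e3 : p * d * q = d' - 1 := by
    rw [mul_assoc, ← e2, ← mul_assoc, ← h2]
    noncomm_ring
  have e4 : q * d' * p = d - 1 := by
    rw [mul_assoc, ← e1, ← mul_assoc, ← h1]
    noncomm_ring
  calc (1 + p) * (d * (1 + q)) = d + p * d + d * q + p * d * q := by noncomm_ring
    _ = d + d' * p + q * d' + (d' - 1) := by rw [e3, e1, e2]
    _ = d' + q * d' + d' * p + (d - 1) := by abel
    _ = d' + q * d' + d' * p + q * d' * p := by rw [e4]
    _ = (1 + q) * (d' * (1 + p)) := by noncomm_ring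

/-- The same identity, in the form in which iterated use of `hatSym_bigTheta_mul` presents it. -/
theorem inverse_conj' {A : Type*} [Ring A] (p q d d' : A) (h1 : (1 + -(q * p)) * d = 1)
    (h2 : (1 + -(p * q)) * d' = 1) (h1' : d * (1 + -(q * p)) = 1) (h2' : d' * (1 + -(p * q)) = 1) :
    q + (d - 1 + (d - 1) * q) + (p + p * (q + (d - 1 + (d - 1) * q))) =
      p + (d' - 1 + (d' - 1) * p) + (q + q * (p + (d' - 1 + (d' - 1) * p))) := by
  have h := inverse_conj p q d d' h1 h2 h1' h2'
  rw [← sub_eq_zero] at h ⊢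
  rw [← h]
  noncomm_ring

section Relation

variable {R : Type*} [Ring R] {ι : Type*} (β : Module.Basis ι ℚ (RatExt R))

theorem negUV_e (W : R) : negUV (fun n => e n W) = substMono uv (-1) (ESeries W) := by
  rw [negUV_eq_inMono, substMono_eq_inMono uv_ne_zero]
  congr 1
  ext1 r
  rw [Algebra.smul_def, map_pow, map_neg, map_one]
  rfl

include β in
theorem inVar_e (k : Fin 2) (W : R) :
    inVar k (fun n => e n W) = bigTheta (eFamily (Finsupp.single k 1) 1 W) := by
  have h : (Finsupp.single k 1 : Fin 2 →₀ ℕ) ≠ 0 := by simp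
  rw [inVar_eq_inMono, ← substMono_ESeries_one h, substMono_ESeries β h]

theorem constantCoeff_negUV {A : Type*} [Ring A] {a : ℕ → A} (ha : a 0 = 1) :
    constantCoeff (negUV a) = 1 := by
  rw [negUV_eq_inMono, constantCoeff_inMono uv_ne_zero, pow_zero, one_mul, ha]

include β in
theorem invNegUV_e (W : R) :
    invNegUV (fun n => e n W) = bigTheta (invFamily (eFamily uv (-1) W)) := by
  have h1 := bigTheta_mul_bigTheta_invFamily β (increasingOrder_eFamily uv_ne_zero (-1) W)
  rw [← substMono_ESeries β uv_ne_zero, ← negUV_e] at h1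
  exact left_inv_eq_right_inv (invOfUnit_mul _ 1 (constantCoeff_negUV (e_zero_left W))) h1

include β in
-- With `p_l = -(-u)^l U` and `q_l = -(-v)^l V`, the family of `E_(VU)(-uv)` is `-q_l p_l` and that
-- of `E_(UV)(-uv)` is `-p_l q_l`. Comparing symbols leaves `inverse_conj'` for every `l`.
theorem relation_e (U V : R) :
    inVar 0 (fun n => e n U) * invNegUV (fun n => e n (V * U)) * inVar 1 (fun n => e n V) =
      inVar 1 (fun n => e n V) * invNegUV (fun n => e n (U * V)) * inVar 0 (fun n => e n U) := by
  have h0 : (Finsupp.single (0 : Fin 2) 1 : Fin 2 →₀ ℕ) ≠ 0 := by simp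
  have h1 : (Finsupp.single (1 : Fin 2) 1 : Fin 2 →₀ ℕ) ≠ 0 := by simp
  have hp := increasingOrder_eFamily h0 1 U
  have hq := increasingOrder_eFamily h1 1 V
  have hx := increasingOrder_eFamily uv_ne_zero (-1) (V * U)
  have hx' := increasingOrder_eFamily uv_ne_zero (-1) (U * V)
  rw [inVar_e β, inVar_e β, invNegUV_e β, invNegUV_e β, mul_assoc, mul_assoc]
  apply hatSym_injective β
  rw [hatSym_bigTheta_mul β hp (hq.add ((increasingOrder_invFamily hx).add
      ((increasingOrder_invFamily hx).mul_right _)))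
      (hatSym_bigTheta_mul β (increasingOrder_invFamily hx) hq (hatSym_bigTheta β hq)),
    hatSym_bigTheta_mul β hq (hp.add ((increasingOrder_invFamily hx').add
      ((increasingOrder_invFamily hx').mul_right _)))
      (hatSym_bigTheta_mul β (increasingOrder_invFamily hx') hp (hatSym_bigTheta β hp))]
  congr 2
  ext1 l
  have e1 : eFamily uv (-1) (V * U) l = -(eFamily (Finsupp.single (1 : Fin 2) 1) 1 V l *
      eFamily (Finsupp.single (0 : Fin 2) 1) 1 U l) := by
    rw [eFamily, eFamily, eFamily, monomial_mul_monomial, ← smul_add, smul_mul_smul_comm,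
      toRat_mul, neg_mul_neg, ← mul_pow, ← map_neg, add_comm]
    simp [uv]
  have e2 : eFamily uv (-1) (U * V) l = -(eFamily (Finsupp.single (0 : Fin 2) 1) 1 U l *
      eFamily (Finsupp.single (1 : Fin 2) 1) 1 V l) := by
    rw [eFamily, eFamily, eFamily, monomial_mul_monomial, ← smul_add, smul_mul_smul_comm,
      toRat_mul, neg_mul_neg, ← mul_pow, ← map_neg]
    simp [uv]
  have u1 : constantCoeff (1 + eFamily uv (-1) (V * U) l) = ((1 : (RatExt R)ˣ) : RatExt R) := by
    rw [map_add, map_one, hx.constantCoeff, add_zero, Units.val_one]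
  have u2 : constantCoeff (1 + eFamily uv (-1) (U * V) l) = ((1 : (RatExt R)ˣ) : RatExt R) := by
    rw [map_add, map_one, hx'.constantCoeff, add_zero, Units.val_one]
  have k1 := mul_invOfUnit _ 1 u1
  have k2 := invOfUnit_mul _ 1 u1
  have k3 := mul_invOfUnit _ 1 u2
  have k4 := invOfUnit_mul _ 1 u2
  simp only [Pi.add_apply, Pi.mul_apply, invFamily]
  rw [e1] at k1 k2 ⊢
  rw [e2] at k3 k4 ⊢
  exact inverse_conj' _ _ _ _ k1 k3 k2 k4

end Relation

/-! ### The homomorphism from the presented ring -/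

section Presented

variable {R : Type*} [Ring R] {ι : Type*} (b : Module.Basis ι ℤ R)

theorem map_inVar {A C : Type*} [Ring A] [Ring C] (f : A →+* C) (k : Fin 2) (a : ℕ → A) :
    MvPowerSeries.map f (inVar k a) = inVar k fun n => f (a n) := by
  rw [inVar_eq_inMono, map_inMono f (by simp), inVar_eq_inMono]

theorem map_invNegUV {A C : Type*} [Ring A] [Ring C] (f : A →+* C) {a : ℕ → A} (ha : a 0 = 1) :
    MvPowerSeries.map f (invNegUV a) = invNegUV fun n => f (a n) := by
  rw [invNegUV, map_invOfUnit f (constantCoeff_negUV ha), negUV_eq_inMono,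
    map_inMono f uv_ne_zero, invNegUV, negUV_eq_inMono]
  congr 2
  ext1 r
  rw [map_mul, map_pow, map_neg, map_one]

/-- The homomorphism from the free ring to the rational algebra. -/
def freeHom : FreeAlgebra ℤ (ℕ+ × ι) →ₐ[ℤ] GQ R :=
  FreeAlgebra.lift ℤ fun p => e (p.1 : ℕ) (b p.2)

theorem freeHom_gen (r : ℕ+) (i : ι) : freeHom b (gen r i) = e (r : ℕ) (b i) :=
  FreeAlgebra.lift_ι_apply _ _

variable (β : Module.Basis ι ℚ (RatExt R))

include β in
theorem freeHom_formalE {W : R} (hW : ZeroOrBasis b W) (n : ℕ) :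
    freeHom b (formalE b W n) = e n W :=
  map_formalE b (freeHom b).toRingHom (fun W n => e n W) e_zero_left
    (fun _ hn => e_zero_right β hn) (freeHom_gen b) hW n

variable (hb : ∀ i j : ι, b i * b j = 0 ∨ ∃ k : ι, b i * b j = b k)

include hb β in
theorem freeHom_rel {x y : FreeAlgebra ℤ (ℕ+ × ι)} (h : Rel b x y) :
    freeHom b x = freeHom b y := by
  obtain ⟨i, j, m⟩ := h
  have key : ∀ i j k l : ι, ∀ s t : Fin 2,
      MvPowerSeries.map (freeHom b).toRingHom (inVar s (formalE b (b i)) *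
        invNegUV (formalE b (b j * b k)) * inVar t (formalE b (b l))) =
      inVar s (fun n => e n (b i)) * invNegUV (fun n => e n (b j * b k)) *
        inVar t (fun n => e n (b l)) := by
    intro i j k l s t
    rw [map_mul, map_mul, map_inVar, map_inVar, map_invNegUV _ (formalE_zero b _)]
    congr 1
    · congr 1
      · congr 1
        ext1 n
        exact freeHom_formalE b β (zeroOrBasis_basis b i) n
      · congr 1
        ext1 n
        exact freeHom_formalE b β ((zeroOrBasis_basis b k).mul_left hb j) n
    · congr 1
      ext1 n
      exact freeHom_formalE b β (zeroOrBasis_basis b l) n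
  change (freeHom b).toRingHom _ = (freeHom b).toRingHom _
  rw [← MvPowerSeries.coeff_map, ← MvPowerSeries.coeff_map, key, key, relation_e β]

/-- The homomorphism from the ring with generators and relations to the rational algebra. -/
def presentedHom : Presented b →+* GQ R :=
  RingQuot.lift ⟨(freeHom b).toRingHom, fun _ _ h => freeHom_rel b β hb h⟩

theorem presentedHom_mk (x : FreeAlgebra ℤ (ℕ+ × ι)) :
    presentedHom b β hb (RingQuot.mkRingHom (Rel b) x) = freeHom b x :=
  RingQuot.lift_mkRingHom_apply _ _ _

end Presented

end

end GInf

namespace GInf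

set_option linter.unusedSectionVars false

noncomputable section

open MvPowerSeries Finset

/-! ### The filtration by weight of words -/

section Words

variable {B J : Type*} [Ring B] {g : J → B} {w : J → ℕ}

theorem mul_mem_wordsBelow {m n k : ℕ} (h : m + n ≤ k + 1) {x y : B} (hx : x ∈ wordsBelow ℤ g w m)
    (hy : y ∈ wordsBelow ℤ g w n) : x * y ∈ wordsBelow ℤ g w k := by
  induction hy using Submodule.span_induction with
  | mem y hy =>
    obtain ⟨l, hl, rfl⟩ := hy
    exact wordsBelow_mono (by omega) (mul_word_mem_wordsBelow hx l)
  | zero => rw [mul_zero]; exact zero_mem _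
  | add y z _ _ hy hz => rw [mul_add]; exact add_mem hy hz
  | smul c y _ hy => rw [mul_smul_comm]; exact Submodule.smul_mem _ _ hy

theorem word_mem_wordsBelow (l : List J) : (l.map g).prod ∈ wordsBelow ℤ g w (wordWeight w l + 1) :=
  Submodule.subset_span ⟨l, Nat.lt_succ_self _, rfl⟩

variable (g w) in
/-- The filtration by the weight of words. -/
def wordFil (n : ℕ) : AddSubgroup B := (wordsBelow ℤ g w n).toAddSubgroup

theorem isFiltration_wordFil : IsFiltration (wordFil g w) where
  mono _ _ h := wordsBelow_mono h
  one_mem := word_mem_wordsBelow []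
  mul_mem_right hx hy := mul_mem_wordsBelow (by omega) hx hy
  mul_mem_left hx hy := mul_mem_wordsBelow (by omega) hx hy

theorem coeff_inVar_mul_inVar {k k' : Fin 2} (h : k ≠ k') (a d : ℕ → B) (r q : ℕ) :
    coeff (Finsupp.single k r + Finsupp.single k' q) (inVar k a * inVar k' d) = a r * d q := by
  classical
  have h1 : VarsIn ∅ (1 : MvPowerSeries (Fin 2) B) := by
    rintro m ⟨j, -, hj⟩
    rw [MvPowerSeries.coeff_one, if_neg]
    rintro rfl
    exact hj rfl
  have h2 := h1.inMono_single_mul (t := {k'}) (Set.empty_subset _) (Set.mem_singleton k') d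
  rw [mul_one] at h2
  rw [inVar_eq_inMono, inVar_eq_inMono, coeff_inMono_single_mul (s := {k'}) (by simpa using h) a h2 r]
  · have h3 := coeff_inMono_smul (τ := Finsupp.single k' 1) (by simp) d q
    rw [Finsupp.smul_single, smul_eq_mul, mul_one] at h3
    rw [h3]
  · rw [Finsupp.single_eq_of_ne h]

end Words

/-! ### Commutators in the presented ring, and its image -/

section Presented

variable {R : Type*} [Ring R] {ι : Type*} {b : Module.Basis ι ℤ R}
  {B : Type*} [Ring B] (mk : FreeAlgebra ℤ (ℕ+ × ι) →+* B)

/-- The images of the generators. -/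
def genImage (p : ℕ+ × ι) : B := mk (gen p.1 p.2)

theorem adjoin_genImage (hmk : Function.Surjective mk) :
    Algebra.adjoin ℤ (Set.range (genImage mk)) = ⊤ := by
  rw [eq_top_iff]
  rintro x -
  obtain ⟨z, rfl⟩ := hmk x
  induction z using FreeAlgebra.induction with
  | grade0 c =>
    rw [eq_intCast, map_intCast]
    exact intCast_mem _ c
  | grade1 p => exact Algebra.subset_adjoin ⟨p, rfl⟩
  | mul x y hx hy => rw [map_mul]; exact mul_mem hx hy
  | add x y hx hy => rw [map_add]; exact add_mem hx hy

/-- The weight of the generators. -/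
def genWeight (p : ℕ+ × ι) : ℕ := p.1

theorem map_formalE_mem {W : R} (hW : ZeroOrBasis b W) (n : ℕ) :
    mk (formalE b W n) ∈ wordFil (genImage mk) genWeight (n + 1) := by
  by_cases hn : n = 0
  · subst hn
    rw [formalE_zero, map_one]
    exact isFiltration_wordFil.one_mem
  · obtain rfl | ⟨k, rfl⟩ := hW
    · rw [formalE_zero_right b hn, map_zero]
      exact zero_mem _
    · lift n to ℕ+ using Nat.pos_of_ne_zero hn
      rw [formalE_basis]
      have := word_mem_wordsBelow (g := genImage mk) (w := genWeight) [((n, k) : ℕ+ × ι)]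
      rwa [List.map_singleton, List.prod_singleton, wordWeight, List.map_singleton,
        List.sum_singleton] at this

theorem filtered_inVar {W : R} (hW : ZeroOrBasis b W) (k : Fin 2) :
    Filtered (wordFil (genImage mk) genWeight) (inVar k fun n => mk (formalE b W n)) := by
  rw [inVar_eq_inMono]
  exact filtered_inMono isFiltration_wordFil (by simp) (map_formalE_mem mk hW)

theorem degree_uv : uv.degree = 2 := by
  rw [uv, map_add, Finsupp.degree_single, Finsupp.degree_single]

theorem halfFiltered_invNegUV {W : R} (hW : ZeroOrBasis b W) :
    HalfFiltered (wordFil (genImage mk) genWeight) (invNegUV fun n => mk (formalE b W n)) := by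
  refine HalfFiltered.invOfUnit isFiltration_wordFil ?_
  rw [negUV_eq_inMono]
  refine halfFiltered_inMono isFiltration_wordFil degree_uv.ge fun r => ?_
  obtain h | h := neg_one_pow_eq_or B r
  · rw [h, one_mul]
    exact map_formalE_mem mk hW r
  · rw [h, neg_one_mul]
    exact neg_mem (map_formalE_mem mk hW r)

/-- The middle factor is a series in `u v`, whose degree is `2`, so it can be replaced by `1` modulo
lower weight. -/
theorem lowCongr_relation {U V W : R} (hU : ZeroOrBasis b U) (hV : ZeroOrBasis b V)
    (hW : ZeroOrBasis b W) (k k' : Fin 2) :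
    LowCongr (wordFil (genImage mk) genWeight)
      (inVar k (fun n => mk (formalE b U n)) * invNegUV (fun n => mk (formalE b W n)) *
        inVar k' (fun n => mk (formalE b V n)))
      (inVar k (fun n => mk (formalE b U n)) * inVar k' (fun n => mk (formalE b V n))) := by
  have hF := isFiltration_wordFil (g := genImage mk) (w := genWeight)
  have h1 := halfFiltered_invNegUV mk hW
  have h2 := h1.lowCongr_one hF (by rw [invNegUV, constantCoeff_invOfUnit, inv_one, Units.val_one])
  have h3 := LowCongr.rfl.mul hF h2 (filtered_inVar mk hU k) (h1.filtered hF)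
  rw [mul_one] at h3
  exact h3.mul hF LowCongr.rfl (filtered_inVar mk hU k) (filtered_inVar mk hV k')

variable (hb : ∀ i j : ι, b i * b j = 0 ∨ ∃ k : ι, b i * b j = b k)
  (hrel : ∀ x y, Rel b x y → mk x = mk y)

include hb hrel

/-- The coefficient of `u^r v^s` in the relation, read modulo weight less than `r + s`, says that
the two generators commute. -/
theorem commutator_mem (p q : ℕ+ × ι) :
    genImage mk p * genImage mk q - genImage mk q * genImage mk p ∈
      wordsBelow ℤ (genImage mk) genWeight (genWeight p + genWeight q) := by
  obtain ⟨r, i⟩ := p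
  obtain ⟨s, j⟩ := q
  have hi := zeroOrBasis_basis b i
  have hj := zeroOrBasis_basis b j
  set m : Fin 2 →₀ ℕ := Finsupp.single 0 (r : ℕ) + Finsupp.single 1 (s : ℕ) with hm
  have h1 := hrel _ _ (Rel.comm i j m)
  have h2 : m.degree = genWeight (r, i) + genWeight (s, j) := by
    rw [hm, map_add, Finsupp.degree_single, Finsupp.degree_single]
    rfl
  have hmap := map_mul (MvPowerSeries.map (σ := Fin 2) mk)
  rw [← MvPowerSeries.coeff_map, ← MvPowerSeries.coeff_map, hmap, hmap, hmap, hmap,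
    map_inVar, map_inVar, map_invNegUV _ (formalE_zero b _),
    map_invNegUV _ (formalE_zero b _)] at h1
  have h3 := lowCongr_relation mk hi hj (hi.mul_left hb j) 0 1 m
  have h4 := lowCongr_relation mk hj hi (hj.mul_left hb i) 1 0 m
  rw [h1] at h3
  -- By the relation the two exact products have the same coefficient, so the two approximations
  -- without the middle factor differ by an element of lower weight.
  have h5 := sub_mem h4 h3
  rw [sub_sub_sub_cancel_left, hm, coeff_inVar_mul_inVar (by decide), add_comm,
    coeff_inVar_mul_inVar (by decide), add_comm, ← hm, h2, formalE_basis, formalE_basis] at h5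
  exact h5

variable {β : Module.Basis ι ℚ (RatExt R)} (hβ : ∀ i, β i = toRat (b i))
  (hmk : Function.Surjective mk) (φ : B →+* GQ R)
  (hφ : ∀ p : ℕ+ × ι, φ (genImage mk p) = e (p.1 : ℕ) (b p.2))

omit hrel in
include hmk hφ in
theorem exists_chi_eq (x : B) : ∃ p, chi b β p = sym β (φ x) := by
  have hx : x ∈ Submodule.span ℤ ((Submonoid.closure (Set.range (genImage mk)) : Set B)) := by
    rw [← Algebra.adjoin_eq_span, adjoin_genImage mk hmk]
    trivial
  induction hx using Submodule.span_induction with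
  | mem x hx =>
    obtain ⟨l, hl, rfl⟩ := Submonoid.exists_list_of_mem_closure hx
    obtain ⟨l', rfl⟩ : ∃ l' : List (ℕ+ × ι), l = l'.map (genImage mk) := by
      have h1 := Set.range_list_map (genImage mk)
      have h2 : l ∈ Set.range (List.map (genImage mk)) := h1 ▸ hl
      exact ⟨h2.choose, h2.choose_spec.symm⟩
    obtain ⟨p, hp, -⟩ := exists_sym_word β hb l'
    refine ⟨p, ?_⟩
    rw [hp, map_list_prod φ, List.map_map]
    congr 3
    ext1 p
    exact (hφ p).symm
  | zero => exact ⟨0, by simp⟩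
  | add x y _ _ hx hy =>
    obtain ⟨p, hp⟩ := hx
    obtain ⟨q, hq⟩ := hy
    exact ⟨p + q, by rw [map_add, map_add, map_add, hp, hq]⟩
  | smul c x _ hx =>
    obtain ⟨p, hp⟩ := hx
    exact ⟨c • p, by rw [map_zsmul, map_zsmul, map_zsmul, hp]⟩

include hβ hmk hφ in
/-- The homomorphism is injective, and symbols identify its image with the polynomials over the
integers in the symbols of the generators. -/
theorem injective_and_range_sym : Function.Injective φ ∧
    ∀ y : GQ R, y ∈ φ.range ↔ sym β y ∈ (chi b β).range := by
  choose s hs using exists_chi_eq mk hb (β := β) hmk φ hφ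
  have hinj := chi_injective (b := b) hβ
  -- The choice `s` of integral polynomials is additive because `chi` is injective and `sym ∘ φ` is
  -- additive.
  let s' : B →ₗ[ℤ] MvPolynomial (ℕ+ × ι) ℤ := AddMonoidHom.toIntLinearMap
    { toFun := s
      map_zero' := hinj (by rw [hs, map_zero, map_zero, map_zero])
      map_add' := fun x y => hinj (by rw [hs, map_add, map_add, map_add, hs, hs]) }
  have hbij : Function.Bijective s' := by
    refine bijective_of_triangular (w := genWeight) (adjoin_genImage mk hmk)
      (commutator_mem mk hb hrel) s' fun l => ?_
    obtain ⟨p, hp, hlow⟩ := exists_sym_word β hb l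
    have : s' (l.map (genImage mk)).prod = p := by
      apply hinj
      rw [hp]
      change chi b β (s _) = _
      rw [hs, map_list_prod φ, List.map_map]
      congr 3
      exact funext hφ
    rw [this]
    exact hlow
  refine ⟨fun x y hxy => hbij.1 (hinj ?_), fun y => ⟨?_, ?_⟩⟩
  · change chi b β (s x) = chi b β (s y)
    rw [hs, hs, hxy]
  · rintro ⟨x, rfl⟩
    exact ⟨s x, hs x⟩
  · rintro ⟨p, hp⟩
    obtain ⟨x, rfl⟩ := hbij.2 p
    exact ⟨x, sym_injective β ((hs x).symm.trans hp)⟩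

end Presented

end

end GInf

namespace GInf

set_option linter.unusedSectionVars false

noncomputable section

open MvPowerSeries Finset

/-! ### Congruence at the divisors of a monomial, products over separate variables -/

section CongrBelow

variable {σ B : Type*} [Ring B]

/-- The coefficients at the divisors of the monomial `m` agree. -/
def CongrBelow (m : σ →₀ ℕ) (f g : MvPowerSeries σ B) : Prop := ∀ n ≤ m, coeff n f = coeff n g

theorem CongrBelow.mul {m : σ →₀ ℕ} {f g f' g' : MvPowerSeries σ B} (h : CongrBelow m f f')
    (h' : CongrBelow m g g') : CongrBelow m (f * g) (f' * g') := by
  classical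
  intro n hn
  rw [MvPowerSeries.coeff_mul, MvPowerSeries.coeff_mul]
  refine sum_congr (Eq.refl _) fun p hp => ?_
  rw [HasAntidiagonal.mem_antidiagonal] at hp
  rw [h p.1 ((hp ▸ le_self_add).trans hn), h' p.2 ((hp ▸ le_add_self).trans hn)]

theorem CongrBelow.pow {m : σ →₀ ℕ} {f g : MvPowerSeries σ B} (h : CongrBelow m f g) (n : ℕ) :
    CongrBelow m (f ^ n) (g ^ n) := by
  induction n with
  | zero => rw [pow_zero, pow_zero]; exact fun _ _ => Eq.refl _
  | succ n ih => rw [pow_succ, pow_succ]; exact ih.mul h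

theorem CongrBelow.expSeries [Algebra ℚ B] {m : σ →₀ ℕ} {f g : MvPowerSeries σ B}
    (h : CongrBelow m f g) : CongrBelow m (expSeries f) (expSeries g) := by
  intro n hn
  change ∑ k ∈ range (n.degree + 1), ((k.factorial : ℚ)⁻¹) • coeff n (f ^ k) =
    ∑ k ∈ range (n.degree + 1), ((k.factorial : ℚ)⁻¹) • coeff n (g ^ k)
  refine sum_congr (Eq.refl _) fun k _ => ?_
  rw [h.pow k n hn]

end CongrBelow

section Products

variable {σ P : Type*} [CommRing P]

theorem varsIn_one : VarsIn ∅ (1 : MvPowerSeries σ P) := by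
  classical
  rintro m ⟨j, -, hj⟩
  rw [MvPowerSeries.coeff_one, if_neg]
  rintro rfl
  exact hj rfl

theorem varsIn_prod_inMono (s : Finset σ) (a : σ → ℕ → P) :
    VarsIn (s : Set σ) (∏ v ∈ s, inMono (Finsupp.single v 1) (a v)) := by
  classical
  induction s using Finset.induction_on with
  | empty => simpa using varsIn_one
  | insert v s hv ih =>
    rw [prod_insert hv]
    exact ih.inMono_single_mul (by simp) (by simp) _

theorem coeff_prod_inMono (s : Finset σ) (a : σ → ℕ → P) {m : σ →₀ ℕ}
    (hm : m.support ⊆ s) :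
    coeff m (∏ v ∈ s, inMono (Finsupp.single v 1) (a v)) = ∏ v ∈ s, a v (m v) := by
  classical
  induction s using Finset.induction_on generalizing m with
  | empty =>
    rw [subset_empty, Finsupp.support_eq_empty] at hm
    subst hm
    simp
  | insert v s hv ih =>
    rw [prod_insert hv, prod_insert hv]
    have h1 : Finsupp.single v (m v) + m.erase v = m := Finsupp.single_add_erase v m
    have h2 := coeff_inMono_single_mul (mem_coe.not.2 hv) (a v) (varsIn_prod_inMono s a) (m v)
      (m := m.erase v) (by simp)
    rw [h1, ih] at h2
    · rw [h2]
      congr 1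
      refine prod_congr rfl fun w hw => ?_
      rw [Finsupp.erase_ne]
      rintro rfl
      exact hv hw
    · rw [Finsupp.support_erase]
      exact fun w hw => (mem_insert.1 (hm (mem_of_mem_erase hw))).resolve_left (ne_of_mem_erase hw)

theorem expSeries_sum [Algebra ℚ P] {κ : Type*} (s : Finset κ) (f : κ → MvPowerSeries σ P)
    (hf : ∀ i, constantCoeff (f i) = 0) :
    expSeries (∑ i ∈ s, f i) = ∏ i ∈ s, expSeries (f i) := by
  classical
  induction s using Finset.induction_on with
  | empty => rw [sum_empty, prod_empty, expSeries_zero]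
  | insert i s hi ih =>
    rw [sum_insert hi, prod_insert hi, expSeries_add (hf i), ih]
    rw [map_sum]
    exact sum_eq_zero fun i _ => hf i

end Products

/-! ### The complete analogues of the `e_r` -/

section Eta

variable {R : Type*} [Ring R] {ι : Type*} (b : Module.Basis ι ℤ R)
  (β : Module.Basis ι ℚ (RatExt R))

/-- The coefficients of the series `E_U(-t)⁻¹` of symbols, `U` the `i`-th basis element. -/
def eta (i : ι) (r : ℕ) : MvPolynomial (ℕ+ × ι) ℚ :=
  (-1 : ℚ) ^ r • PowerSeries.coeff r
    (expSeries (-expo β (eFamily (Finsupp.single () 1) 1 (b i))) : PowerSeries _)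

/-- The exponent on the left is `∑ X_l(U) τ^l`, so that `eta` is to the `l X_l(U)` as complete
symmetric functions are to power sums. -/
theorem expSeries_neg_expo {σ : Type*} {τ : σ →₀ ℕ} (hτ : τ ≠ 0) (i : ι) :
    expSeries (expo β (-eFamily τ (-1) (b i))) = inMono τ (eta b β i) := by
  have h1 : PowerSeries.constantCoeff
      (-expo β (eFamily (Finsupp.single () 1) 1 (b i)) : PowerSeries _) = 0 := by
    rw [map_neg, neg_eq_zero]
    exact constantCoeff_expo β
  have h2 : substMono τ (-1) (-expo β (eFamily (Finsupp.single () 1) 1 (b i)) : PowerSeries _) =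
      expo β (-eFamily τ (-1) (b i)) := by
    rw [expo_neg, ← substMono_expo β hτ, substMono_eq_inMono hτ, substMono_eq_inMono hτ]
    symm
    refine eq_inMono hτ (fun r => ?_) fun m hm => ?_
    · rw [map_neg, coeff_inMono_smul hτ, map_neg, smul_neg]
    · rw [map_neg, coeff_inMono_of_forall _ hm, neg_zero]
  rw [← h2, ← substMono_expSeries (-1) hτ h1, substMono_eq_inMono hτ]
  rfl

theorem eta_zero (i : ι) : eta b β i 0 = 1 := by
  rw [eta, pow_zero, one_smul, PowerSeries.coeff_zero_eq_constantCoeff_apply]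
  exact constantCoeff_expSeries (σ := Unit) (-expo β (eFamily (Finsupp.single () 1) 1 (b i)))

theorem sum_sym_e_mul_eta (i : ι) {n : ℕ} (hn : n ≠ 0) :
    ∑ p ∈ antidiagonal n, sym β (e p.1 (b i)) * ((-1 : ℚ) ^ p.2 • eta b β i p.2) = 0 := by
  have h1 : (Finsupp.single () 1 : Unit →₀ ℕ) ≠ 0 := by simp
  have h2 : (expSeries (expo β (eFamily (Finsupp.single () 1) 1 (b i))) : PowerSeries _) *
      expSeries (-expo β (eFamily (Finsupp.single () 1) 1 (b i))) = 1 := by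
    rw [← expSeries_add (constantCoeff_expo β), add_neg_cancel, expSeries_zero]
    rw [map_neg, constantCoeff_expo, neg_zero]
  have h3 := congrArg (PowerSeries.coeff n) h2
  rw [PowerSeries.coeff_mul, PowerSeries.coeff_one, if_neg hn] at h3
  rw [← h3]
  refine sum_congr rfl fun p _ => ?_
  congr 1
  · rw [← hatSym_bigTheta β (increasingOrder_eFamily h1 1 (b i)), ← ESeries_eq_bigTheta]
    rfl
  · rw [eta, smul_smul, ← mul_pow, neg_one_mul, neg_neg, one_pow, one_smul]

theorem neg_one_pow_smul_mem {C : Type*} [CommRing C] [Algebra ℚ C] (S : Subalgebra ℤ C) (n : ℕ)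
    {x : C} (hx : x ∈ S) : (-1 : ℚ) ^ n • x ∈ S := by
  obtain h | h := neg_one_pow_eq_or ℚ n
  · rw [h, one_smul]
    exact hx
  · rw [h, neg_one_smul]
    exact neg_mem hx

/-- The relation between elementary and complete functions has leading coefficient `1` and can be
solved recursively over `ℤ` for `eta`; the next lemma solves it for the symbols of the `e_n`. -/
theorem eta_mem_range_chi (i : ι) (n : ℕ) : eta b β i n ∈ (chi b β).range := by
  induction n using Nat.strong_induction_on with
  | _ n ih =>
    by_cases hn : n = 0
    · subst hn
      rw [eta_zero]
      exact one_mem _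
    · have h1 := sum_sym_e_mul_eta b β i hn
      have hmem : ((0 : ℕ), n) ∈ antidiagonal n := by
        rw [HasAntidiagonal.mem_antidiagonal, zero_add]
      rw [← add_sum_erase _ _ hmem, e_zero_left, sym_one, one_mul] at h1
      have h2 : (-1 : ℚ) ^ n • eta b β i n ∈ (chi b β).range := by
        rw [eq_neg_of_add_eq_zero_left h1]
        refine neg_mem (sum_mem fun p hp => ?_)
        rw [mem_erase, HasAntidiagonal.mem_antidiagonal] at hp
        have hp1 : p.1 ≠ 0 := by
          intro h
          exact hp.1 (Prod.ext h (by simp; omega))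
        refine mul_mem ?_ (neg_one_pow_smul_mem _ _ (ih p.2 (by omega)))
        exact ⟨MvPolynomial.X (⟨p.1, Nat.pos_of_ne_zero hp1⟩, i), chi_X b β _⟩
      have h3 := neg_one_pow_smul_mem _ n h2
      rwa [smul_smul, ← mul_pow, neg_one_mul, neg_neg, one_pow, one_smul] at h3

theorem sym_e_mem_adjoin_eta (i : ι) (n : ℕ) :
    sym β (e n (b i)) ∈ Algebra.adjoin ℤ (Set.range fun p : ι × ℕ => eta b β p.1 p.2) := by
  have heta : ∀ n, eta b β i n ∈ Algebra.adjoin ℤ (Set.range fun p : ι × ℕ => eta b β p.1 p.2) :=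
    fun n => Algebra.subset_adjoin ⟨(i, n), rfl⟩
  induction n using Nat.strong_induction_on with
  | _ n ih =>
    by_cases hn : n = 0
    · subst hn
      rw [e_zero_left, sym_one]
      exact one_mem _
    · have h1 := sum_sym_e_mul_eta b β i hn
      have hmem : (n, (0 : ℕ)) ∈ antidiagonal n := by
        rw [HasAntidiagonal.mem_antidiagonal, add_zero]
      rw [← add_sum_erase _ _ hmem, eta_zero, pow_zero, one_smul, mul_one] at h1
      rw [eq_neg_of_add_eq_zero_left h1]
      refine neg_mem (sum_mem fun p hp => ?_)
      rw [mem_erase, HasAntidiagonal.mem_antidiagonal] at hp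
      have hp1 : p.2 ≠ 0 := by
        intro h
        exact hp.1 (Prod.ext (by simp; omega) h)
      exact mul_mem (ih p.1 (by omega)) (neg_one_pow_smul_mem _ _ (heta p.2))

end Eta

/-! ### Coefficients of the generating function -/

section GenFun

variable {R : Type*} [Ring R] {ι : Type*} (b : Module.Basis ι ℤ R)

theorem coeff_pSum (l : ℕ+) (m : ι × ℕ →₀ ℕ) :
    coeff m (pSum b l) = ∑ᶠ U, coeff m (pSym U l) • toRat (b U) := rfl

theorem coeff_pSum_single (l : ℕ+) (v : ι × ℕ) :
    coeff (Finsupp.single v (l : ℕ)) (pSum b l) = toRat (b v.1) := by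
  classical
  rw [coeff_pSum, finsum_eq_single _ v.1]
  · have : coeff (Finsupp.single v (l : ℕ)) (pSym v.1 l) = 1 := if_pos ⟨v.2, rfl⟩
    rw [this, one_smul]
  · intro U hU
    have : coeff (Finsupp.single v (l : ℕ)) (pSym U l) = 0 := by
      refine if_neg ?_
      rintro ⟨j, hj⟩
      have h1 := (Finsupp.single_left_inj l.pos.ne').1 hj
      exact hU (by rw [h1])
    rw [this, zero_smul]

theorem coeff_pSum_of_forall (l : ℕ+) {m : ι × ℕ →₀ ℕ}
    (hm : ∀ v, m ≠ Finsupp.single v (l : ℕ)) : coeff m (pSum b l) = 0 := by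
  rw [coeff_pSum]
  refine finsum_eq_zero_of_forall_eq_zero fun U => ?_
  have : coeff m (pSym U l) = 0 := by
    refine if_neg ?_
    rintro ⟨j, hj⟩
    exact hm _ hj
  rw [this, zero_smul]

theorem increasingOrder_pSum : IncreasingOrder (pSum b) := by
  intro l m h
  refine coeff_pSum_of_forall b l ?_
  rintro v rfl
  simp at h

variable (β : Module.Basis ι ℚ (RatExt R))

/-- The exponent `∑_l X_l(∑_U p_l^{(U)} U)` splits into one sum for each variable `x_v`, so its
exponential is a product of the series of the `eta`, one for each `v`. There may be infinitely many
variables, but only those dividing `m` matter. -/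
theorem sym_coeff_genFun (m : ι × ℕ →₀ ℕ) :
    sym β (coeff m (genFun b)) = m.prod fun v n => eta b β v.1 n := by
  classical
  have h1 : hatSym β (genFun b) = expSeries (expo β (pSum b)) :=
    hatSym_bigTheta β (increasingOrder_pSum b)
  have hs : ∀ v : ι × ℕ, (Finsupp.single v 1 : ι × ℕ →₀ ℕ) ≠ 0 := by simp
  have hI : ∀ v : ι × ℕ, IncreasingOrder (-eFamily (R := R) (Finsupp.single v 1) (-1) (b v.1)) :=
    fun v => (increasingOrder_eFamily (hs v) (-1) _).neg
  have h2 : CongrBelow m (expo β (pSum b))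
      (∑ v ∈ m.support, expo β (-eFamily (Finsupp.single v 1) (-1) (b v.1))) := by
    intro n hn
    rw [map_sum, coeff_expo β (increasingOrder_pSum b) le_rfl]
    simp_rw [coeff_expo β (hI _) (le_refl n.degree)]
    rw [sum_comm]
    refine sum_congr rfl fun k _ => ?_
    simp_rw [coeff_hatX]
    rw [← map_sum]
    congr 1
    have h3 : ∀ v, coeff n ((-eFamily (R := R) (Finsupp.single v 1) (-1) (b v.1)) k.succPNat) =
        if n = Finsupp.single v (k.succPNat : ℕ) then toRat (b v.1) else 0 := by
      intro v
      rw [Pi.neg_apply, map_neg, eFamily, coeff_monomial, Finsupp.smul_single, smul_eq_mul, mul_one]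
      split_ifs
      · simp
      · rw [neg_zero]
    simp_rw [h3]
    by_cases h4 : ∃ v, n = Finsupp.single v (k.succPNat : ℕ)
    · obtain ⟨v, rfl⟩ := h4
      rw [coeff_pSum_single, sum_eq_single v, if_pos rfl]
      · intro w _ hw
        rw [if_neg]
        intro h
        exact hw ((Finsupp.single_left_inj k.succPNat.pos.ne').1 h).symm
      -- A power of `x_v` that divides `m` forces `v` into the support of `m`.
      · intro h
        exfalso
        rw [Finsupp.notMem_support_iff] at h
        have := hn v
        rw [Finsupp.single_eq_same, h] at this
        exact absurd this (by simp)
    · push Not at h4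
      rw [coeff_pSum_of_forall b _ h4]
      exact (sum_eq_zero fun v _ => if_neg (h4 v)).symm
  have h3 := h2.expSeries m le_rfl
  rw [← h1, coeff_hatSym, expSeries_sum _ _ fun v => constantCoeff_expo β] at h3
  rw [h3]
  simp_rw [expSeries_neg_expo b β (hs _)]
  exact coeff_prod_inMono m.support (fun v => eta b β v.1) subset_rfl

/-- Each letter is given a fresh variable of its alphabet, so every product of `eta`'s occurs as the
symbol of some coefficient. This is where infinitely many variables are needed. -/
theorem eta_word_mem (l : List (ι × ℕ)) : ∃ m : ι × ℕ →₀ ℕ,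
    (m.prod fun v n => eta b β v.1 n) = (l.map fun p => eta b β p.1 p.2).prod ∧
      ∀ v, l.length ≤ v.2 → m v = 0 := by
  classical
  induction l with
  | nil => exact ⟨0, by simp, fun _ _ => rfl⟩
  | cons p l ih =>
    obtain ⟨m, hm, hm'⟩ := ih
    have h1 : ((Finsupp.single (p.1, l.length) p.2).prod fun v n => eta b β v.1 n) =
        eta b β p.1 p.2 :=
      Finsupp.prod_single_index (h := fun (v : ι × ℕ) n => eta b β v.1 n) (eta_zero b β _)
    refine ⟨Finsupp.single (p.1, l.length) p.2 + m, ?_, ?_⟩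
    · rw [Finsupp.prod_add_index_of_disjoint, hm, h1,
        List.map_cons, List.prod_cons]
      refine Finset.disjoint_of_subset_left Finsupp.support_single_subset ?_
      rw [disjoint_singleton_left, Finsupp.notMem_support_iff]
      exact hm' _ le_rfl
    · intro v hv
      rw [List.length_cons] at hv
      rw [Finsupp.add_apply, hm' v (by omega), Finsupp.single_eq_of_ne]
      rintro rfl
      simp at hv

/-- The coefficients of the generating function span the elements whose symbols are polynomials
over the integers in the symbols of the generators. -/
theorem mem_span_coeff_genFun_iff (y : GQ R) :
    y ∈ Submodule.span ℤ (Set.range fun m => coeff m (genFun b)) ↔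
      sym β y ∈ (chi b β).range := by
  constructor
  · intro hy
    induction hy using Submodule.span_induction with
    | mem y hy =>
      obtain ⟨m, rfl⟩ := hy
      dsimp only
      rw [sym_coeff_genFun]
      exact prod_mem fun v _ => eta_mem_range_chi b β _ _
    | zero => rw [map_zero]; exact zero_mem _
    | add x y _ _ hx hy => rw [map_add]; exact add_mem hx hy
    | smul c x _ hx => rw [map_zsmul]; exact zsmul_mem hx c
  · rintro ⟨p, hp⟩
    have h1 : chi b β p ∈ Algebra.adjoin ℤ (Set.range fun p : ι × ℕ => eta b β p.1 p.2) := by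
      clear hp
      induction p using MvPolynomial.induction_on with
      | C a =>
        rw [← MvPolynomial.algebraMap_eq, AlgHom.commutes]
        exact Subalgebra.algebraMap_mem _ a
      | add p q ihp ihq =>
        rw [map_add]
        exact add_mem ihp ihq
      | mul_X p j ih =>
        rw [map_mul, chi_X]
        exact mul_mem ih (sym_e_mem_adjoin_eta b β _ _)
    have h2 : ∃ y' ∈ Submodule.span ℤ (Set.range fun m => coeff m (genFun b)),
        sym β y' = chi b β p := by
      rw [← Subalgebra.mem_toSubmodule, Algebra.adjoin_eq_span] at h1
      clear hp
      generalize chi b β p = z at h1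
      induction h1 using Submodule.span_induction with
      | mem z hz =>
        obtain ⟨l, hl, rfl⟩ := Submonoid.exists_list_of_mem_closure hz
        have h3 := Set.range_list_map fun p : ι × ℕ => eta b β p.1 p.2
        have h4 : l ∈ Set.range (List.map fun p : ι × ℕ => eta b β p.1 p.2) := h3 ▸ hl
        obtain ⟨l', rfl⟩ := h4
        obtain ⟨m, hm, -⟩ := eta_word_mem b β l'
        exact ⟨_, Submodule.subset_span ⟨m, rfl⟩, (sym_coeff_genFun b β m).trans hm⟩
      | zero => exact ⟨0, zero_mem _, map_zero _⟩
      | add x y _ _ hx hy =>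
        obtain ⟨x', hx', rfl⟩ := hx
        obtain ⟨y', hy', rfl⟩ := hy
        exact ⟨x' + y', add_mem hx' hy', map_add _ _ _⟩
      | smul c x _ hx =>
        obtain ⟨x', hx', rfl⟩ := hx
        exact ⟨c • x', Submodule.smul_mem _ _ hx', map_zsmul _ _ _⟩
    obtain ⟨y', hy', h3⟩ := h2
    have h4 : y' = y := sym_injective β (h3.trans hp)
    exact h4 ▸ hy'

end GenFun

end

end GInf

namespace GInf

set_option linter.unusedSectionVars false

noncomputable section

open MvPowerSeries Finset

/-! ### Diagrams of monomials and multipartitions -/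

section Shapes

variable {ι : Type*}

open Classical in
/-- The columns of the diagrams of a monomial: the number of variables in the alphabet of `U` whose
exponent exceeds `k`. -/
def cols (m : ι × ℕ →₀ ℕ) (U : ι) (k : ℕ) : ℕ := #{v ∈ m.support | v.1 = U ∧ k < m v}

open Classical in
theorem cols_eq_card (m : ι × ℕ →₀ ℕ) (U : ι) (k : ℕ) {s : Finset (ι × ℕ)}
    (hs : ∀ v, v.1 = U → k < m v → v ∈ s) : cols m U k = #{v ∈ s | v.1 = U ∧ k < m v} := by
  rw [cols]
  congr 1
  ext v
  rw [mem_filter, mem_filter, Finsupp.mem_support_iff]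
  constructor
  · rintro ⟨_, h1, h2⟩
    exact ⟨hs v h1 h2, h1, h2⟩
  · rintro ⟨_, h1, h2⟩
    exact ⟨by omega, h1, h2⟩

theorem cols_anti (m : ι × ℕ →₀ ℕ) (U : ι) {k l : ℕ} (h : k ≤ l) : cols m U l ≤ cols m U k := by
  classical
  refine card_le_card fun v hv => ?_
  rw [mem_filter] at hv ⊢
  exact ⟨hv.1, hv.2.1, by omega⟩

theorem cols_embDomain (m : ι × ℕ →₀ ℕ) {π : Equiv.Perm (ι × ℕ)} (hπ : ∀ v, (π v).1 = v.1) :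
    cols (m.embDomain π.toEmbedding) = cols m := by
  classical
  ext U k
  symm
  refine card_bij (fun v _ => π v) ?_ ?_ ?_
  · intro v hv
    rw [mem_filter] at hv ⊢
    have h1 : m.embDomain π.toEmbedding (π v) = m v := Finsupp.embDomain_apply_self π.toEmbedding m v
    rw [Finsupp.mem_support_iff, h1, hπ]
    exact ⟨Finsupp.mem_support_iff.1 hv.1, hv.2⟩
  · intro v _ w _ h
    exact π.injective h
  · intro w hw
    obtain ⟨v, rfl⟩ := π.surjective w
    refine ⟨v, ?_, rfl⟩
    have h1 : m.embDomain π.toEmbedding (π v) = m v := Finsupp.embDomain_apply_self π.toEmbedding m v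
    rw [mem_filter, Finsupp.mem_support_iff, h1, hπ] at hw
    rw [mem_filter, Finsupp.mem_support_iff]
    exact hw

/-- The columns determine how often each positive exponent occurs in each alphabet; matching
variables with equal alphabet and exponent gives the permutation. -/
theorem exists_perm_of_cols_eq {m m' : ι × ℕ →₀ ℕ} (h : cols m = cols m') :
    ∃ π : Equiv.Perm (ι × ℕ), (∀ v, (π v).1 = v.1) ∧ m' = m.embDomain π.toEmbedding := by
  classical
  set V := m.support ∪ m'.support with hV
  have hge : ∀ U k, #{v ∈ V | v.1 = U ∧ k ≤ m v} = #{v ∈ V | v.1 = U ∧ k ≤ m' v} := by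
    intro U k
    obtain _ | k := k
    · simp
    · have h1 := cols_eq_card m U k (s := V) fun v _ hv =>
        mem_union_left _ (Finsupp.mem_support_iff.2 (by omega))
      have h2 := cols_eq_card m' U k (s := V) fun v _ hv =>
        mem_union_right _ (Finsupp.mem_support_iff.2 (by omega))
      rw [h] at h1
      exact h1.symm.trans h2
  -- The number of exponents equal to `k` is the difference of two of the counts that the columns
  -- record.
  have hsplit : ∀ (n : ι × ℕ →₀ ℕ) U k, #{v ∈ V | v.1 = U ∧ k ≤ n v} =
      #{v ∈ V | v.1 = U ∧ n v = k} + #{v ∈ V | v.1 = U ∧ k + 1 ≤ n v} := by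
    intro n U k
    rw [← card_union_of_disjoint]
    · congr 1
      ext v
      simp only [mem_union, mem_filter]
      constructor
      · rintro ⟨h1, h2, h3⟩
        obtain h4 | h4 := h3.eq_or_lt
        · exact Or.inl ⟨h1, h2, h4.symm⟩
        · exact Or.inr ⟨h1, h2, h4⟩
      · rintro (⟨h1, h2, h3⟩ | ⟨h1, h2, h3⟩)
        · exact ⟨h1, h2, h3.ge⟩
        · exact ⟨h1, h2, by omega⟩
    · rw [Finset.disjoint_left]
      intro v h1 h2
      rw [mem_filter] at h1 h2
      omega
  have heq : ∀ U k, #{v ∈ V | v.1 = U ∧ m v = k} = #{v ∈ V | v.1 = U ∧ m' v = k} := by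
    intro U k
    have h1 := hsplit m U k
    have h2 := hsplit m' U k
    rw [hge, hge] at h1
    omega
  have hfib : ∀ (n : ι × ℕ →₀ ℕ) (c : ι × ℕ),
      Fintype.card {a : {v // v ∈ V} // ((a : ι × ℕ).1, n a) = c} =
        #{v ∈ V | v.1 = c.1 ∧ n v = c.2} := by
    intro n c
    rw [← Nat.card_eq_fintype_card, Nat.card_congr (Equiv.subtypeSubtypeEquivSubtypeInter
      (fun v => v ∈ V) fun v => (v.1, n v) = c)]
    refine Nat.subtype_card _ fun v => ?_
    rw [mem_filter, Prod.ext_iff]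
  have hE : ∀ c : ι × ℕ, Nonempty ({a : {v // v ∈ V} // ((a : ι × ℕ).1, m a) = c} ≃
      {a : {v // v ∈ V} // ((a : ι × ℕ).1, m' a) = c}) := by
    intro c
    refine ⟨Fintype.equivOfCardEq ?_⟩
    rw [hfib, hfib, heq]
  -- A bijection of the finite set `V` is glued from its fibres over pairs of alphabet and exponent;
  -- outside `V`, where both monomials have exponent `0`, the identity will do.
  let E : {v // v ∈ V} ≃ {v // v ∈ V} := Equiv.ofFiberEquiv fun c => (hE c).some
  have hEm : ∀ a, ((E a : ι × ℕ).1, m' (E a)) = ((a : ι × ℕ).1, m a) := fun a =>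
    Equiv.ofFiberEquiv_map (fun c => (hE c).some) a
  let π : Equiv.Perm (ι × ℕ) := Equiv.Perm.ofSubtype E
  have hπ : ∀ v, (π v).1 = v.1 ∧ m' (π v) = m v := by
    intro v
    by_cases hv : v ∈ V
    · have h1 : π v = E ⟨v, hv⟩ := Equiv.Perm.ofSubtype_apply_of_mem E hv
      rw [h1]
      exact Prod.ext_iff.1 (hEm ⟨v, hv⟩)
    · have h1 : π v = v := Equiv.Perm.ofSubtype_apply_of_not_mem E hv
      rw [h1]
      rw [hV, mem_union, not_or, Finsupp.notMem_support_iff, Finsupp.notMem_support_iff] at hv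
      exact ⟨rfl, by rw [hv.1, hv.2]⟩
  refine ⟨π, fun v => (hπ v).1, ?_⟩
  ext w
  obtain ⟨v, rfl⟩ := π.surjective w
  rw [(hπ v).2]
  exact (Finsupp.embDomain_apply_self π.toEmbedding m v).symm

/-- The degrees of a monomial in the alphabets. -/
def degs (m : ι × ℕ →₀ ℕ) : ι →₀ ℕ := m.mapDomain Prod.fst

theorem degs_add (m n : ι × ℕ →₀ ℕ) : degs (m + n) = degs m + degs n := Finsupp.mapDomain_add

theorem degs_eq_of_cols_eq {m m' : ι × ℕ →₀ ℕ} (h : cols m = cols m') : degs m = degs m' := by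
  obtain ⟨π, hπ, rfl⟩ := exists_perm_of_cols_eq h
  rw [degs, degs, Finsupp.embDomain_eq_mapDomain, ← Finsupp.mapDomain_comp]
  congr 1
  ext1 v
  exact (hπ v).symm

theorem degree_degs (m : ι × ℕ →₀ ℕ) : (degs m).degree = m.degree := by
  induction m using Finsupp.induction_linear with
  | zero => simp [degs]
  | add f g hf hg => rw [degs_add, map_add, map_add, hf, hg]
  | single v n => rw [degs, Finsupp.mapDomain_single, Finsupp.degree_single, Finsupp.degree_single]

/-- The monomial with the rows of the diagrams as exponents. -/
def rowMono (lam : Multipartition ι) : ι × ℕ →₀ ℕ :=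
  Finsupp.ofSupportFinite (fun v => (lam.1 v.1).rowLen v.2) (by
    refine (lam.2.biUnion fun U _ => ((Set.finite_singleton U).prod
      (Set.finite_Iio ((lam.1 U).colLen 0)))).subset ?_
    rintro ⟨U, j⟩ h
    have h1 : (j, 0) ∈ lam.1 U := YoungDiagram.mem_iff_lt_rowLen.2 (Nat.pos_of_ne_zero h)
    rw [Set.mem_iUnion₂]
    refine ⟨U, ?_, rfl, YoungDiagram.mem_iff_lt_colLen.1 h1⟩
    intro h2
    rw [h2] at h1
    exact YoungDiagram.notMem_bot _ h1)

theorem rowMono_apply (lam : Multipartition ι) (v : ι × ℕ) :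
    rowMono lam v = (lam.1 v.1).rowLen v.2 := rfl

theorem cols_rowMono (lam : Multipartition ι) (U : ι) (k : ℕ) :
    cols (rowMono lam) U k = (lam.1 U).colLen k := by
  classical
  rw [cols, ← card_range ((lam.1 U).colLen k)]
  symm
  refine card_bij (fun j _ => (U, j)) ?_ ?_ ?_
  · intro j hj
    rw [mem_range, ← YoungDiagram.mem_iff_lt_colLen, YoungDiagram.mem_iff_lt_rowLen] at hj
    rw [mem_filter, Finsupp.mem_support_iff, rowMono_apply]
    exact ⟨by dsimp only; omega, rfl, hj⟩
  · intro i _ j _ h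
    exact (Prod.ext_iff.1 h).2
  · rintro ⟨V, j⟩ h
    rw [mem_filter] at h
    obtain ⟨-, rfl, h⟩ := h
    refine ⟨j, ?_, rfl⟩
    rw [mem_range, ← YoungDiagram.mem_iff_lt_colLen, YoungDiagram.mem_iff_lt_rowLen]
    exact h

theorem eq_of_cols_rowMono_eq {lam mu : Multipartition ι}
    (h : cols (rowMono lam) = cols (rowMono mu)) : lam = mu := by
  refine Subtype.ext (funext fun U => YoungDiagram.ext ?_)
  ext ⟨j, k⟩
  have h1 := congrFun (congrFun h U) k
  rw [cols_rowMono, cols_rowMono] at h1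
  rw [YoungDiagram.mem_cells, YoungDiagram.mem_cells, YoungDiagram.mem_iff_lt_colLen,
    YoungDiagram.mem_iff_lt_colLen, h1]

theorem rowMono_injective : Function.Injective (rowMono : Multipartition ι → _) :=
  fun _ _ h => eq_of_cols_rowMono_eq (congrArg cols h)

/-- Together with `eq_of_cols_rowMono_eq`, this makes the monomials `rowMono lam` a system of
representatives for the orbits of monomials. -/
theorem exists_cols_rowMono (m : ι × ℕ →₀ ℕ) :
    ∃ lam : Multipartition ι, cols (rowMono lam) = cols m := by
  classical
  -- The bounding box only makes the set of cells finite; membership is decided by the last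
  -- condition.
  let D : ι → YoungDiagram := fun U =>
    { cells := {c ∈ range (cols m U 0) ×ˢ range m.degree | c.1 < cols m U c.2}
      isLowerSet := by
        rintro ⟨i, k⟩ ⟨j, l⟩ ⟨h1, h2⟩ h
        dsimp only at h1 h2
        simp only [coe_filter, mem_product, mem_range, Set.mem_ofPred_eq] at h ⊢
        have := cols_anti m U h2
        omega }
  have hD : ∀ U j k, (j, k) ∈ D U ↔ j < cols m U k := by
    intro U j k
    rw [← YoungDiagram.mem_cells]
    simp only [D, mem_filter, mem_product, mem_range]
    refine ⟨fun h => h.2, fun h => ⟨⟨h.trans_le (cols_anti m U (Nat.zero_le k)), ?_⟩, h⟩⟩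
    have h1 : 0 < cols m U k := by omega
    obtain ⟨v, hv⟩ := card_pos.1 h1
    rw [mem_filter] at hv
    exact hv.2.2.trans_le (Finsupp.le_degree v m)
  have hfin : {U | D U ≠ ⊥}.Finite := by
    refine (m.support.finite_toSet.image Prod.fst).subset fun U hU => ?_
    have h1 : ∃ c, c ∈ D U := by
      by_contra h
      push Not at h
      refine hU (YoungDiagram.ext ?_)
      rw [YoungDiagram.cells_bot, eq_empty_iff_forall_notMem]
      exact h
    obtain ⟨⟨j, k⟩, hc⟩ := h1
    rw [hD] at hc
    have h1 : 0 < cols m U k := by omega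
    obtain ⟨v, hv⟩ := card_pos.1 h1
    rw [mem_filter] at hv
    exact ⟨v, hv.1, hv.2.1⟩
  obtain ⟨lam, hlam⟩ : ∃ lam : Multipartition ι, lam.1 = D := ⟨⟨D, hfin⟩, rfl⟩
  refine ⟨lam, ?_⟩
  ext U k
  rw [cols_rowMono, hlam]
  refine eq_of_forall_lt_iff fun j => ?_
  rw [← YoungDiagram.mem_iff_lt_colLen, hD]

theorem finite_setOf_degs_rowMono (d : ι →₀ ℕ) :
    {lam : Multipartition ι | degs (rowMono lam) = d}.Finite := by
  classical
  have hB : ∃ B : ι × ℕ →₀ ℕ, ∀ lam : Multipartition ι, degs (rowMono lam) = d →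
      rowMono lam ≤ B := by
    -- A partition of `d U` has rows of length at most `d U`, and at most `d U` of them.
    refine ⟨∑ U ∈ d.support, ∑ j ∈ range (d U), Finsupp.single (U, j) (d U), ?_⟩
    rintro lam h ⟨U, j⟩
    have hle : ∀ v, rowMono lam v ≤ d v.1 := by
      intro v
      rw [← h, degs]
      have h1 : Finsupp.single v (rowMono lam v) ≤ rowMono lam := by
        rw [Finsupp.single_le_iff]
      obtain ⟨n, hn⟩ := exists_add_of_le h1
      conv_rhs => rw [hn, Finsupp.mapDomain_add, Finsupp.mapDomain_single]
      rw [Finsupp.add_apply, Finsupp.single_eq_same]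
      omega
    by_cases h0 : rowMono lam (U, j) = 0
    · rw [h0]
      exact Nat.zero_le _
    · have hj : j < d U := by
        have h1 : ∑ i ∈ range (j + 1), Finsupp.single (U, i) 1 ≤ rowMono lam := by
          rintro ⟨V, i⟩
          rw [Finsupp.finsetSum_apply]
          by_cases hV : V = U
          · subst hV
            have h2 := (lam.1 V).rowLen_anti
            by_cases hi : i ≤ j
            · rw [sum_eq_single i, Finsupp.single_eq_same]
              · have := h2 i j hi
                rw [rowMono_apply] at h0 ⊢
                dsimp only at h0 ⊢
                omega
              · intro k _ hk
                exact Finsupp.single_eq_of_ne (by simpa using hk.symm)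
              · intro h
                simp at h
                omega
            · rw [sum_eq_zero]
              · exact Nat.zero_le _
              · intro k hk
                rw [mem_range] at hk
                refine Finsupp.single_eq_of_ne ?_
                simp
                omega
          · rw [sum_eq_zero]
            · exact Nat.zero_le _
            · intro k _
              exact Finsupp.single_eq_of_ne (by simp [hV])
        obtain ⟨n, hn⟩ := exists_add_of_le h1
        have h3 : d U = (degs (rowMono lam)) U := by rw [h]
        rw [hn, degs_add, degs, Finsupp.mapDomain_finsetSum] at h3
        simp only [Finsupp.mapDomain_single, sum_const, card_range, Finsupp.add_apply,
          Finsupp.smul_apply, Finsupp.single_eq_same, smul_eq_mul, mul_one] at h3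
        omega
      have hU : U ∈ d.support := by
        rw [Finsupp.mem_support_iff]
        omega
      have h1 : Finsupp.single (U, j) (d U) ≤
          ∑ U ∈ d.support, ∑ j ∈ range (d U), Finsupp.single (U, j) (d U) :=
        (single_le_sum (f := fun j => Finsupp.single (U, j) (d U)) (fun _ _ => zero_le)
          (mem_range.2 hj)).trans
          (single_le_sum (f := fun U => ∑ j ∈ range (d U), Finsupp.single (U, j) (d U))
            (fun _ _ => zero_le) hU)
      have h2 := h1 (U, j)
      rw [Finsupp.single_eq_same] at h2
      exact (hle (U, j)).trans h2
  obtain ⟨B, hB⟩ := hB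
  exact Set.Finite.of_finite_image ((Set.finite_Iic B).subset (by
    rintro _ ⟨lam, h, rfl⟩
    exact hB lam h)) rowMono_injective.injOn

end Shapes

end

end GInf

namespace GInf

set_option linter.unusedSectionVars false

noncomputable section

open MvPowerSeries Finset

section Degs

variable {ι : Type*}

open Classical in
theorem degs_apply (m : ι × ℕ →₀ ℕ) (U : ι) {N : ℕ} (hN : ∀ j, N ≤ j → m (U, j) = 0) :
    degs m U = ∑ j ∈ range N, m (U, j) := by
  have h1 : degs m U = ∑ v ∈ m.support, if v.1 = U then m v else 0 := by
    rw [degs, Finsupp.mapDomain, Finsupp.sum_apply, Finsupp.sum]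
    exact sum_congr rfl fun v _ => Finsupp.single_apply
  rw [h1, ← sum_filter]
  have h2 : ∑ j ∈ range N, m (U, j) = ∑ v ∈ (range N).image (Prod.mk U), m v :=
    (sum_image fun i _ j _ h => (Prod.ext_iff.1 h).2).symm
  rw [h2]
  refine sum_subset ?_ ?_
  · rintro ⟨V, j⟩ hv
    rw [mem_filter, Finsupp.mem_support_iff] at hv
    obtain ⟨hv, rfl⟩ := hv
    refine mem_image.2 ⟨j, ?_, rfl⟩
    rw [mem_range]
    by_contra h
    exact hv (hN j (by omega))
  · intro v hv hv'
    obtain ⟨j, -, rfl⟩ := mem_image.1 hv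
    by_contra h
    exact hv' (mem_filter.2 ⟨Finsupp.mem_support_iff.2 h, rfl⟩)

end Degs

/-! ### Homogeneity of Schur functions -/

section Homogeneous

variable {ι : Type*}

/-- The series is homogeneous of degree `n` in the alphabet of `U`, and free of other variables. -/
def IsHomogIn (U : ι) (n : ℤ) (f : MvPowerSeries (ι × ℕ) ℤ) : Prop :=
  ∀ m, coeff m f ≠ 0 → ∃ k : ℕ, (k : ℤ) = n ∧ degs m = Finsupp.single U k

theorem le_degs (m : ι × ℕ →₀ ℕ) (v : ι × ℕ) : m v ≤ degs m v.1 := by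
  have h1 : Finsupp.single v (m v) ≤ m := by rw [Finsupp.single_le_iff]
  obtain ⟨n, hn⟩ := exists_add_of_le h1
  rw [degs]
  conv_rhs => rw [hn, Finsupp.mapDomain_add, Finsupp.mapDomain_single]
  rw [Finsupp.add_apply, Finsupp.single_eq_same]
  omega

theorem forall_support_iff (m : ι × ℕ →₀ ℕ) (U : ι) :
    (∀ v ∈ m.support, v.1 = U) ↔ degs m = Finsupp.single U m.degree := by
  constructor
  · intro h
    rw [degs, Finsupp.mapDomain, Finsupp.sum, Finsupp.degree_apply]
    rw [← Finsupp.singleAddHom_apply, map_sum]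
    exact sum_congr rfl fun v hv => by rw [h v hv]; rfl
  · intro h v hv
    by_contra hne
    have h1 := le_degs m v
    rw [h, Finsupp.single_eq_of_ne hne] at h1
    exact Finsupp.mem_support_iff.1 hv (by omega)

open Classical in
theorem coeff_hSym (m : ι × ℕ →₀ ℕ) (U : ι) (n : ℕ) :
    coeff m (hSym U n) = if degs m = Finsupp.single U n then 1 else 0 := by
  change (if (m.degree : ℤ) = n ∧ ∀ v ∈ m.support, v.1 = U then 1 else 0) = _
  congr 1
  rw [eq_iff_iff, forall_support_iff]
  constructor
  · rintro ⟨h1, h2⟩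
    rw [h2, Nat.cast_inj.1 h1]
  · intro h
    have h1 : m.degree = n := by rw [← degree_degs, h, Finsupp.degree_single]
    exact ⟨by rw [h1], by rw [h1, h]⟩

theorem hSym_of_neg (U : ι) {n : ℤ} (hn : n < 0) : hSym U n = 0 := by
  ext1 m
  refine if_neg ?_
  rintro ⟨h, -⟩
  omega

theorem hSym_zero (U : ι) : hSym U ((0 : ℕ) : ℤ) = 1 := by
  classical
  ext1 m
  rw [coeff_hSym, MvPowerSeries.coeff_one, Finsupp.single_zero]
  congr 1
  rw [eq_iff_iff]
  constructor
  · intro h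
    rw [← Finsupp.degree_eq_zero_iff, ← degree_degs, h, map_zero]
  · rintro rfl
    rw [degs, Finsupp.mapDomain_zero]

theorem isHomogIn_hSym (U : ι) (n : ℤ) : IsHomogIn U n (hSym U n) := by
  classical
  intro m hm
  by_cases hn : n < 0
  · rw [hSym_of_neg U hn] at hm
    exact absurd rfl hm
  · lift n to ℕ using not_lt.1 hn
    rw [coeff_hSym] at hm
    exact ⟨n, rfl, (ite_ne_right_iff.1 hm).1⟩

theorem isHomogIn_one (U : ι) : IsHomogIn U 0 1 := by
  have := isHomogIn_hSym U ((0 : ℕ) : ℤ)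
  rwa [hSym_zero] at this

theorem IsHomogIn.mul {U : ι} {a c : ℤ} {f g : MvPowerSeries (ι × ℕ) ℤ} (hf : IsHomogIn U a f)
    (hg : IsHomogIn U c g) : IsHomogIn U (a + c) (f * g) := by
  classical
  intro m hm
  rw [MvPowerSeries.coeff_mul] at hm
  obtain ⟨p, hp, h⟩ := exists_ne_zero_of_sum_ne_zero hm
  obtain ⟨k, rfl, hk⟩ := hf p.1 (left_ne_zero_of_mul h)
  obtain ⟨l, rfl, hl⟩ := hg p.2 (right_ne_zero_of_mul h)
  refine ⟨k + l, by push_cast; rfl, ?_⟩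
  rw [← HasAntidiagonal.mem_antidiagonal.1 hp, degs_add, hk, hl, Finsupp.single_add]

theorem IsHomogIn.prod {U : ι} {κ : Type*} (s : Finset κ) {a : κ → ℤ}
    {f : κ → MvPowerSeries (ι × ℕ) ℤ} (hf : ∀ i, IsHomogIn U (a i) (f i)) :
    IsHomogIn U (∑ i ∈ s, a i) (∏ i ∈ s, f i) := by
  classical
  induction s using Finset.induction_on with
  | empty => exact isHomogIn_one U
  | insert i s hi ih =>
    rw [sum_insert hi, prod_insert hi]
    exact (hf i).mul ih

theorem IsHomogIn.sum {U : ι} {a : ℤ} {κ : Type*} (s : Finset κ)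
    {f : κ → MvPowerSeries (ι × ℕ) ℤ} (hf : ∀ i, IsHomogIn U a (f i)) :
    IsHomogIn U a (∑ i ∈ s, f i) := by
  intro m hm
  rw [map_sum] at hm
  obtain ⟨i, -, h⟩ := exists_ne_zero_of_sum_ne_zero hm
  exact hf i m h

/-- The Leibniz expansion of the Jacobi-Trudi determinant. -/
theorem schur_eq_sum (U : ι) (μ : YoungDiagram) : schur U μ =
    ∑ σ : Equiv.Perm (Fin (μ.colLen 0)), Equiv.Perm.sign σ •
      ∏ i, hSym U ((μ.rowLen (σ i) : ℤ) - (σ i : ℤ) + (i : ℤ)) := by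
  rw [schur, Matrix.det_apply]
  rfl

/-- In every term of the Leibniz expansion the shifts `-σ(i) + i` cancel in the sum of the indices,
so all terms have the same degree. -/
theorem isHomogIn_schur (U : ι) (μ : YoungDiagram) :
    IsHomogIn U (∑ i ∈ range (μ.colLen 0), (μ.rowLen i : ℤ)) (schur U μ) := by
  rw [schur_eq_sum]
  refine IsHomogIn.sum _ fun σ m hm => ?_
  have h1 : ∑ i ∈ range (μ.colLen 0), (μ.rowLen i : ℤ) =
      ∑ i : Fin (μ.colLen 0), ((μ.rowLen (σ i) : ℤ) - (σ i : ℤ) + (i : ℤ)) := by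
    rw [sum_add_distrib, sum_sub_distrib,
      Equiv.sum_comp σ fun i : Fin (μ.colLen 0) => (μ.rowLen i : ℤ),
      Equiv.sum_comp σ fun i : Fin (μ.colLen 0) => (i : ℤ), sub_add_cancel,
      Finset.sum_range]
  rw [h1]
  refine IsHomogIn.prod univ (fun i => isHomogIn_hSym U _) m fun h => hm ?_
  obtain h2 | h2 := Int.units_eq_one_or (Equiv.Perm.sign σ)
  · rw [h2, one_smul, h]
  · rw [h2, Units.neg_smul, one_smul, map_neg, h, neg_zero]

theorem schur_bot (U : ι) : schur U ⊥ = 1 := by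
  have h : (⊥ : YoungDiagram).colLen 0 = 0 := by
    rw [YoungDiagram.colLen_eq_card, YoungDiagram.col, YoungDiagram.cells_bot]
    rfl
  have : IsEmpty (Fin ((⊥ : YoungDiagram).colLen 0)) := by rw [h]; infer_instance
  exact Matrix.det_isEmpty

theorem multiSchur_eq_prod (lam : Multipartition ι) {s : Finset ι} (hs : ∀ U, lam.1 U ≠ ⊥ → U ∈ s) :
    multiSchur lam = ∏ U ∈ s, schur U (lam.1 U) := by
  refine finprod_eq_prod_of_mulSupport_subset _ fun U hU => hs U fun h => hU ?_
  exact (congrArg (schur U) h).trans (schur_bot U)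

/-- Products of Schur functions are homogeneous. -/
theorem degs_eq_of_coeff_multiSchur_ne_zero {lam : Multipartition ι} {m : ι × ℕ →₀ ℕ}
    (h : coeff m (multiSchur lam) ≠ 0) : degs m = degs (rowMono lam) := by
  classical
  have key : ∀ (s : Finset ι) (m : ι × ℕ →₀ ℕ), coeff m (∏ U ∈ s, schur U (lam.1 U)) ≠ 0 →
      degs m = ∑ U ∈ s, Finsupp.single U (∑ i ∈ range ((lam.1 U).colLen 0), (lam.1 U).rowLen i) := by
    intro s
    induction s using Finset.induction_on with
    | empty =>
      intro m hm
      rw [prod_empty, MvPowerSeries.coeff_one] at hm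
      rw [(ite_ne_right_iff.1 hm).1, sum_empty, degs, Finsupp.mapDomain_zero]
    | insert U s hU ih =>
      intro m hm
      rw [prod_insert hU, MvPowerSeries.coeff_mul] at hm
      obtain ⟨p, hp, h⟩ := exists_ne_zero_of_sum_ne_zero hm
      obtain ⟨k, hk, hk'⟩ := isHomogIn_schur U _ p.1 (left_ne_zero_of_mul h)
      rw [← Nat.cast_sum, Nat.cast_inj] at hk
      rw [← HasAntidiagonal.mem_antidiagonal.1 hp, degs_add, ih p.2 (right_ne_zero_of_mul h),
        sum_insert hU, hk', hk]
  rw [multiSchur_eq_prod lam (s := lam.2.toFinset) (fun U hU => (Set.Finite.mem_toFinset _).2 hU)]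
    at h
  rw [key _ _ h]
  ext U
  rw [degs_apply (N := (lam.1 U).colLen 0), Finsupp.finsetSum_apply]
  · by_cases hU : U ∈ lam.2.toFinset
    · rw [sum_eq_single U, Finsupp.single_eq_same]
      · rfl
      · intro V _ hV
        exact Finsupp.single_eq_of_ne hV.symm
      · exact fun h => absurd hU h
    · rw [sum_eq_zero]
      · rw [Set.Finite.mem_toFinset] at hU
        have h1 : lam.1 U = ⊥ := not_not.1 hU
        symm
        refine sum_eq_zero fun j _ => ?_
        rw [rowMono_apply]
        dsimp only
        rw [h1]
        by_contra h2
        exact YoungDiagram.notMem_bot (j, 0)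
          (YoungDiagram.mem_iff_lt_rowLen.2 (Nat.pos_of_ne_zero h2))
      · intro V hV
        refine Finsupp.single_eq_of_ne ?_
        rintro rfl
        exact hU hV
  · intro j hj
    rw [rowMono_apply]
    dsimp only
    by_contra h2
    have h3 := YoungDiagram.mem_iff_lt_rowLen.2 (Nat.pos_of_ne_zero h2)
    rw [YoungDiagram.mem_iff_lt_colLen] at h3
    omega

end Homogeneous

/-! ### Series symmetric in each alphabet -/

section Sym

variable {ι : Type*}

/-- The series whose coefficients only depend on the diagrams of the monomials. -/
def symRing (ι : Type*) : Subring (MvPowerSeries (ι × ℕ) ℤ) where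
  carrier := {f | ∀ π : Equiv.Perm (ι × ℕ), (∀ v, (π v).1 = v.1) → killCompl π.toEmbedding f = f}
  mul_mem' hf hg π hπ := by rw [map_mul, hf π hπ, hg π hπ]
  one_mem' π _ := map_one _
  add_mem' hf hg π hπ := by rw [map_add, hf π hπ, hg π hπ]
  zero_mem' π _ := map_zero _
  neg_mem' hf π hπ := by rw [map_neg, hf π hπ]

theorem coeff_eq_of_cols_eq {f : MvPowerSeries (ι × ℕ) ℤ} (hf : f ∈ symRing ι) {m m' : ι × ℕ →₀ ℕ}
    (h : cols m = cols m') : coeff m f = coeff m' f := by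
  obtain ⟨π, hπ, rfl⟩ := exists_perm_of_cols_eq h
  have h1 := congrArg (coeff m) (hf π hπ)
  rw [coeff_killCompl] at h1
  exact h1.symm

theorem mem_symRing_of_cols {f : MvPowerSeries (ι × ℕ) ℤ}
    (h : ∀ m m', cols m = cols m' → coeff m f = coeff m' f) : f ∈ symRing ι := by
  intro π hπ
  ext1 m
  rw [coeff_killCompl]
  exact h _ _ (cols_embDomain m hπ)

theorem hSym_mem_symRing (U : ι) (n : ℤ) : hSym U n ∈ symRing ι := by
  classical
  by_cases hn : n < 0
  · rw [hSym_of_neg U hn]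
    exact zero_mem _
  · lift n to ℕ using not_lt.1 hn
    refine mem_symRing_of_cols fun m m' h => ?_
    rw [coeff_hSym, coeff_hSym, degs_eq_of_cols_eq h]

theorem units_smul_mem {A : Type*} [Ring A] (S : Subring A) (u : ℤˣ) {x : A} (hx : x ∈ S) :
    u • x ∈ S := by
  obtain h | h := Int.units_eq_one_or u
  · rw [h, one_smul]
    exact hx
  · rw [h, Units.neg_smul, one_smul]
    exact neg_mem hx

theorem schur_mem (U : ι) (μ : YoungDiagram) (S : Subring (MvPowerSeries (ι × ℕ) ℤ))
    (hS : ∀ n, hSym U n ∈ S) : schur U μ ∈ S := by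
  rw [schur_eq_sum]
  exact sum_mem fun σ _ => units_smul_mem S _ (prod_mem fun i _ => hS _)

theorem multiSchur_mem_symRing (lam : Multipartition ι) : multiSchur lam ∈ symRing ι := by
  rw [multiSchur_eq_prod lam (s := lam.2.toFinset) (fun U hU => (Set.Finite.mem_toFinset _).2 hU)]
  exact prod_mem fun U _ => schur_mem U _ _ (hSym_mem_symRing U)

end Sym

end

end GInf

namespace GInf

set_option linter.unusedSectionVars false

noncomputable section

open MvPowerSeries Finset

/-! ### From complete symmetric functions to Schur functions -/

/-- The sequence `r i - i` is strictly decreasing. By the rearrangement inequality the cross term `∑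
i (r (σ i) - σ i)` is least for the identity, and for no other permutation, as a permutation keeping
the opposite order is increasing. -/
theorem sum_sq_lt_sum_sq {n : ℕ} {r : Fin n → ℤ} (hr : Antitone r) {σ : Equiv.Perm (Fin n)}
    (hσ : σ ≠ 1) : ∑ i, r i ^ 2 < ∑ i, (r (σ i) - (σ i : ℕ) + (i : ℕ)) ^ 2 := by
  set x : Fin n → ℤ := fun i => r i - (i : ℕ) with hx
  have hxanti : StrictAnti x := fun i j h => by
    have h1 := hr h.le
    have h2 : (i : ℕ) < (j : ℕ) := h
    simp only [hx]
    omega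
  have hav : Antivary (fun i : Fin n => ((i : ℕ) : ℤ)) x := fun i j h => by
    have h1 := hxanti.lt_iff_gt.1 h
    exact Int.ofNat_le.2 h1.le
  have hnot : ¬Antivary (fun i : Fin n => ((i : ℕ) : ℤ)) (x ∘ σ) := by
    intro h
    apply hσ
    have hmono : StrictMono σ := by
      intro i j hij
      by_contra hne
      have h1 : σ j < σ i := lt_of_le_of_ne (not_lt.1 hne) fun h => hij.ne (σ.injective h).symm
      have h2 := h (i := i) (j := j) (hxanti h1)
      have h3 : (i : ℕ) < (j : ℕ) := hij
      dsimp only at h2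
      omega
    ext1 i
    have h1 : (hmono.orderIsoOfSurjective σ σ.surjective : Fin n ≃o Fin n) = OrderIso.refl _ :=
      Subsingleton.elim _ _
    exact congrArg (fun f : Fin n ≃o Fin n => f i) h1
  have h1 := hav.sum_mul_lt_sum_mul_comp_perm_iff.2 hnot
  have h2 : ∀ τ : Equiv.Perm (Fin n), ∑ i, (x (τ i) + (i : ℕ)) ^ 2 =
      ∑ i, x i ^ 2 + ∑ i : Fin n, ((i : ℕ) : ℤ) ^ 2 + 2 * ∑ i : Fin n, ((i : ℕ) : ℤ) * x (τ i) := by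
    intro τ
    rw [← Equiv.sum_comp τ fun i => x i ^ 2, mul_sum, ← sum_add_distrib, ← sum_add_distrib]
    exact sum_congr rfl fun i _ => by ring
  have h3 : ∑ i, r i ^ 2 = ∑ i, (x ((1 : Equiv.Perm (Fin n)) i) + (i : ℕ)) ^ 2 :=
    sum_congr rfl fun i _ => by simp [hx]
  rw [h3, h2, show ∑ i, (r (σ i) - (σ i : ℕ) + (i : ℕ)) ^ 2 = ∑ i, (x (σ i) + (i : ℕ)) ^ 2 from rfl, h2]
  simp only [Equiv.Perm.coe_one, id_eq]
  simp only [smul_eq_mul] at h1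
  linarith

section JacobiTrudi

variable {ι : Type*}

/-- A product of complete symmetric functions. -/
def hProd (U : ι) (a : Multiset ℕ) : MvPowerSeries (ι × ℕ) ℤ := (a.map fun n : ℕ => hSym U n).prod

theorem hProd_filter_pos (U : ι) (a : Multiset ℕ) : hProd U (a.filter (0 < ·)) = hProd U a := by
  induction a using Multiset.induction_on with
  | empty => rfl
  | cons n a ih =>
    by_cases h : 0 < n
    · rw [Multiset.filter_cons_of_pos _ h, hProd, hProd, Multiset.map_cons, Multiset.map_cons,
        Multiset.prod_cons, Multiset.prod_cons, ← hProd, ← hProd, ih]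
    · obtain rfl : n = 0 := by omega
      rw [Multiset.filter_cons_of_neg _ h, ih, hProd, hProd, Multiset.map_cons,
        Multiset.prod_cons, hSym_zero, one_mul]

theorem sum_map_filter_pos (f : ℕ → ℕ) (hf : f 0 = 0) (a : Multiset ℕ) :
    ((a.filter (0 < ·)).map f).sum = (a.map f).sum := by
  induction a using Multiset.induction_on with
  | empty => rfl
  | cons n a ih =>
    by_cases h : 0 < n
    · rw [Multiset.filter_cons_of_pos _ h, Multiset.map_cons, Multiset.map_cons,
        Multiset.sum_cons, Multiset.sum_cons, ih]
    · obtain rfl : n = 0 := by omega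
      rw [Multiset.filter_cons_of_neg _ h, ih, Multiset.map_cons, Multiset.sum_cons, hf, zero_add]

theorem sum_map_sq_le (a : Multiset ℕ) : (a.map (· ^ 2)).sum ≤ a.sum ^ 2 := by
  induction a using Multiset.induction_on with
  | empty => simp
  | cons n a ih =>
    rw [Multiset.map_cons, Multiset.sum_cons, Multiset.sum_cons]
    have h : 0 ≤ 2 * n * a.sum := Nat.zero_le _
    linarith [add_sq n a.sum]

/-- The rows of a diagram, as a multiset. -/
def rowMultiset (μ : YoungDiagram) : Multiset ℕ :=
  (univ : Finset (Fin (μ.colLen 0))).val.map fun i : Fin (μ.colLen 0) => μ.rowLen i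

theorem rowMultiset_eq (μ : YoungDiagram) : rowMultiset μ = μ.rowLens := by
  rw [rowMultiset, YoungDiagram.rowLens, Fin.univ_val_map, List.ofFn_eq_map]
  congr 1
  rw [← List.map_coe_finRange_eq_range, List.map_map]
  rfl

theorem exists_rowMultiset_eq (a : Multiset ℕ) : ∃ μ : YoungDiagram, rowMultiset μ = a.filter (0 < ·) := by
  have hpos : ∀ x ∈ (a.filter (0 < ·)).sort (· ≥ ·), 0 < x := by
    intro x hx
    rw [Multiset.mem_sort] at hx
    exact (Multiset.mem_filter.1 hx).2
  have hs : ((a.filter (0 < ·)).sort (· ≥ ·)).SortedGE :=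
    (Multiset.pairwise_sort (a.filter (0 < ·)) (· ≥ ·)).sortedGE
  refine ⟨YoungDiagram.ofRowLens _ hs, ?_⟩
  rw [rowMultiset_eq, YoungDiagram.rowLens_ofRowLens_eq_self hpos, Multiset.sort_eq]

/-- Products of complete symmetric functions are integral combinations of Schur functions. -/
theorem hProd_mem_span_schur (U : ι) (a : Multiset ℕ) :
    hProd U a ∈ Submodule.span ℤ (Set.range (schur U)) := by
  -- In the Jacobi-Trudi expansion the identity gives the product itself. The other terms have the
  -- same sum of indices and a strictly larger sum of squares, which the square of the sum bounds,
  -- so this difference decreases.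
  induction hN : a.sum ^ 2 - (a.map (· ^ 2)).sum using Nat.strong_induction_on generalizing a with
  | _ N ih =>
    subst hN
    obtain ⟨μ, hμ⟩ := exists_rowMultiset_eq a
    have hsum : a.sum = ∑ i : Fin (μ.colLen 0), μ.rowLen i := by
      have := sum_map_filter_pos id rfl a
      rw [Multiset.map_id, Multiset.map_id, ← hμ] at this
      exact this.symm
    have hsq : (a.map (· ^ 2)).sum = ∑ i : Fin (μ.colLen 0), μ.rowLen i ^ 2 := by
      have := sum_map_filter_pos (· ^ 2) rfl a
      rw [← hμ, rowMultiset, Multiset.map_map] at this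
      exact this.symm
    have hprod : hProd U a = ∏ i : Fin (μ.colLen 0), hSym U (μ.rowLen i) := by
      rw [← hProd_filter_pos, ← hμ, rowMultiset, hProd, Multiset.map_map]
      rfl
    have hexp := schur_eq_sum U μ
    rw [← add_sum_erase _ _ (mem_univ 1)] at hexp
    have h1 : Equiv.Perm.sign (1 : Equiv.Perm (Fin (μ.colLen 0))) • ∏ i : Fin (μ.colLen 0),
        hSym U ((μ.rowLen ((1 : Equiv.Perm (Fin (μ.colLen 0))) i) : ℤ) -
          ((1 : Equiv.Perm (Fin (μ.colLen 0))) i : ℤ) + (i : ℤ)) = hProd U a := by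
      rw [hprod, Equiv.Perm.sign_one, one_smul]
      refine prod_congr rfl fun i _ => ?_
      rw [Equiv.Perm.one_apply, sub_add_cancel]
    rw [h1] at hexp
    rw [← sub_eq_iff_eq_add] at hexp
    rw [← hexp]
    refine sub_mem (Submodule.subset_span ⟨μ, rfl⟩) (sum_mem fun σ hσ => ?_)
    have hσ1 : σ ≠ 1 := (mem_erase.1 hσ).1
    have hterm : ∏ i : Fin (μ.colLen 0), hSym U ((μ.rowLen (σ i) : ℤ) - (σ i : ℤ) + (i : ℤ)) ∈
        Submodule.span ℤ (Set.range (schur U)) := by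
      -- A factor of negative index is zero; otherwise the term is a product of complete functions
      -- indexed by natural numbers, to which the induction applies.
      by_cases hneg : ∃ i : Fin (μ.colLen 0), (μ.rowLen (σ i) : ℤ) - (σ i : ℤ) + (i : ℤ) < 0
      · obtain ⟨i, hi⟩ := hneg
        rw [prod_eq_zero (mem_univ i) (hSym_of_neg U hi)]
        exact zero_mem _
      · push Not at hneg
        choose α hα using fun i => Int.eq_ofNat_of_zero_le (hneg i)
        have h2 : ∏ i : Fin (μ.colLen 0), hSym U ((μ.rowLen (σ i) : ℤ) - (σ i : ℤ) + (i : ℤ)) =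
            hProd U ((univ : Finset (Fin (μ.colLen 0))).val.map α) := by
          rw [hProd, Multiset.map_map]
          exact prod_congr rfl fun i _ => by rw [hα]; rfl
        rw [h2]
        have hsum' : ((univ : Finset (Fin (μ.colLen 0))).val.map α).sum = a.sum := by
          rw [hsum, ← Nat.cast_inj (R := ℤ)]
          change ((∑ i, α i : ℕ) : ℤ) = _
          push_cast
          simp_rw [← hα]
          rw [sum_add_distrib, sum_sub_distrib,
            Equiv.sum_comp σ fun i : Fin (μ.colLen 0) => (μ.rowLen i : ℤ),
            Equiv.sum_comp σ fun i : Fin (μ.colLen 0) => ((i : ℕ) : ℤ), sub_add_cancel]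
        have hlt : (a.map (· ^ 2)).sum <
            (((univ : Finset (Fin (μ.colLen 0))).val.map α).map (· ^ 2)).sum := by
          rw [hsq, Multiset.map_map, ← Nat.cast_lt (α := ℤ)]
          change _ < ((∑ i, α i ^ 2 : ℕ) : ℤ)
          push_cast
          simp_rw [← hα]
          exact sum_sq_lt_sum_sq (r := fun i : Fin (μ.colLen 0) => (μ.rowLen i : ℤ))
            (fun i j hij => Int.ofNat_le.2 (μ.rowLen_anti i j hij)) hσ1
        refine ih _ ?_ _ rfl
        have h3 := sum_map_sq_le ((univ : Finset (Fin (μ.colLen 0))).val.map α)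
        rw [hsum'] at h3 ⊢
        omega
    obtain h2 | h2 := Int.units_eq_one_or (Equiv.Perm.sign σ)
    · rw [h2, one_smul]
      exact hterm
    · rw [h2, Units.neg_smul, one_smul]
      exact neg_mem hterm

/-- The ring of symmetric functions in the alphabet of `U`. -/
def hRing (U : ι) : Subring (MvPowerSeries (ι × ℕ) ℤ) :=
  Subring.closure (Set.range fun n : ℕ => hSym U n)

theorem hSym_mem_hRing (U : ι) (n : ℤ) : hSym U n ∈ hRing U := by
  by_cases hn : n < 0
  · rw [hSym_of_neg U hn]
    exact zero_mem _
  · lift n to ℕ using not_lt.1 hn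
    exact Subring.subset_closure ⟨n, rfl⟩

theorem mem_span_schur_of_mem_hRing {U : ι} {f : MvPowerSeries (ι × ℕ) ℤ} (hf : f ∈ hRing U) :
    f ∈ Submodule.span ℤ (Set.range (schur U)) := by
  rw [hRing, Subring.mem_closure_iff] at hf
  induction hf using AddSubgroup.closure_induction with
  | mem f hf =>
    obtain ⟨l, hl, rfl⟩ := Submonoid.exists_list_of_mem_closure hf
    have h3 := Set.range_list_map fun n : ℕ => hSym U n
    have h4 : l ∈ Set.range (List.map fun n : ℕ => hSym U n) := h3 ▸ hl
    obtain ⟨l', rfl⟩ := h4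
    exact hProd_mem_span_schur U (l' : Multiset ℕ)
  | zero => exact zero_mem _
  | add f g _ _ hf hg => exact add_mem hf hg
  | neg f _ hf => exact neg_mem hf

/-- Isolating the factor of one alphabet reduces multiplication by a complete function in that
alphabet to the case of a single alphabet. -/
theorem exists_multiSchur_eq_mul (lam : Multipartition ι) (U : ι) :
    ∃ r : MvPowerSeries (ι × ℕ) ℤ, multiSchur lam = schur U (lam.1 U) * r ∧
      ∀ μ, schur U μ * r ∈ Set.range (multiSchur : Multipartition ι → _) := by
  classical
  set s : Finset ι := insert U lam.2.toFinset with hs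
  have h1 : ∀ V, lam.1 V ≠ ⊥ → V ∈ s := fun V hV =>
    mem_insert_of_mem ((Set.Finite.mem_toFinset _).2 hV)
  refine ⟨∏ V ∈ s.erase U, schur V (lam.1 V), ?_, fun μ => ?_⟩
  · rw [multiSchur_eq_prod lam h1, mul_prod_erase s (fun V => schur V (lam.1 V))
      (mem_insert_self _ _)]
  · have hfin : {V | Function.update lam.1 U μ V ≠ ⊥}.Finite := by
      refine s.finite_toSet.subset fun V hV => ?_
      by_cases hVU : V = U
      · rw [hVU]
        exact mem_insert_self _ _
      · refine h1 V fun h => hV ?_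
        rw [Function.update_of_ne hVU, h]
    obtain ⟨lam', hlam'⟩ : ∃ lam' : Multipartition ι, lam'.1 = Function.update lam.1 U μ :=
      ⟨⟨_, hfin⟩, rfl⟩
    refine ⟨lam', ?_⟩
    have h2 : ∀ V, lam'.1 V ≠ ⊥ → V ∈ s := by
      intro V hV
      by_cases hVU : V = U
      · rw [hVU]
        exact mem_insert_self _ _
      · refine h1 V fun h => hV ?_
        rw [hlam', Function.update_of_ne hVU, h]
    rw [multiSchur_eq_prod lam' h2, ← mul_prod_erase s (fun V => schur V (lam'.1 V))
      (mem_insert_self _ _), hlam']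
    congr 1
    · rw [Function.update_self]
    · refine prod_congr rfl fun V hV => ?_
      rw [Function.update_of_ne (ne_of_mem_erase hV)]

theorem mul_hSym_mem_span {f : MvPowerSeries (ι × ℕ) ℤ}
    (hf : f ∈ Submodule.span ℤ (Set.range (multiSchur : Multipartition ι → _))) (U : ι) (n : ℕ) :
    f * hSym U n ∈ Submodule.span ℤ (Set.range (multiSchur : Multipartition ι → _)) := by
  induction hf using Submodule.span_induction with
  | mem f hf =>
    obtain ⟨lam, rfl⟩ := hf
    obtain ⟨r, hr, hr'⟩ := exists_multiSchur_eq_mul lam U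
    have h1 := mem_span_schur_of_mem_hRing (mul_mem
      (schur_mem U (lam.1 U) (hRing U) (hSym_mem_hRing U)) (hSym_mem_hRing U n))
    rw [hr, mul_right_comm]
    generalize schur U (lam.1 U) * hSym U n = g at h1 ⊢
    clear hr
    induction h1 using Submodule.span_induction with
    | mem g hg =>
      obtain ⟨μ, rfl⟩ := hg
      exact Submodule.subset_span (hr' μ)
    | zero => rw [zero_mul]; exact zero_mem _
    | add f g _ _ hf hg => rw [add_mul]; exact add_mem hf hg
    | smul c f _ hf => rw [smul_mul_assoc]; exact Submodule.smul_mem _ _ hf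
  | zero => rw [zero_mul]; exact zero_mem _
  | add f g _ _ hf hg => rw [add_mul]; exact add_mem hf hg
  | smul c f _ hf => rw [smul_mul_assoc]; exact Submodule.smul_mem _ _ hf

/-- The ring generated by the complete symmetric functions in all alphabets. -/
def hRingAll (ι : Type*) : Subring (MvPowerSeries (ι × ℕ) ℤ) :=
  Subring.closure (Set.range fun p : ι × ℕ => hSym p.1 p.2)

theorem one_mem_span_multiSchur :
    (1 : MvPowerSeries (ι × ℕ) ℤ) ∈ Submodule.span ℤ (Set.range (multiSchur : Multipartition ι → _)) := by
  obtain ⟨lam, hlam⟩ : ∃ lam : Multipartition ι, lam.1 = fun _ => ⊥ :=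
    ⟨⟨fun _ => ⊥, by simp⟩, rfl⟩
  refine Submodule.subset_span ⟨lam, ?_⟩
  rw [multiSchur_eq_prod lam (s := ∅) (fun U hU => absurd (by rw [hlam]) hU), prod_empty]

/-- The ring generated by the complete symmetric functions is spanned by the products of Schur
functions. -/
theorem mem_span_multiSchur {f : MvPowerSeries (ι × ℕ) ℤ} (hf : f ∈ hRingAll ι) :
    f ∈ Submodule.span ℤ (Set.range (multiSchur : Multipartition ι → _)) := by
  rw [hRingAll, Subring.mem_closure_iff] at hf
  induction hf using AddSubgroup.closure_induction with
  | mem f hf =>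
    induction hf using Submonoid.closure_induction_right with
    | one => exact one_mem_span_multiSchur
    | mul_right x _ y hy ih =>
      obtain ⟨p, rfl⟩ := hy
      exact mul_hSym_mem_span ih p.1 p.2
  | zero => exact zero_mem _
  | add f g _ _ hf hg => exact add_mem hf hg
  | neg f _ hf => exact neg_mem hf

end JacobiTrudi

end

end GInf

namespace GInf

set_option linter.unusedSectionVars false

noncomputable section

open MvPowerSeries Finset

/-! ### Elementary symmetric functions -/

/-- Squarefree divisors of `m` correspond to subsets of its support, and the alternating sum over
the subsets of a nonempty set is zero. -/
theorem sum_antidiagonal_neg_one_pow {σ : Type*} [DecidableEq σ]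
    [DecidablePred fun p : (σ →₀ ℕ) × (σ →₀ ℕ) => ∀ v, p.1 v ≤ 1] {m : σ →₀ ℕ} (hm : m ≠ 0) :
    ∑ p ∈ antidiagonal m with ∀ v, p.1 v ≤ 1, (-1 : ℤ) ^ p.1.degree = 0 := by
  have hne : m.support.Nonempty := Finsupp.support_nonempty_iff.2 hm
  rw [← sum_powerset_neg_one_pow_card_of_nonempty hne]
  have hind : ∀ (S : Finset σ) v, Finsupp.indicator S (fun _ _ => 1) v = if v ∈ S then 1 else 0 := by
    intro S v
    rw [Finsupp.indicator_apply]
    split_ifs <;> rfl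
  refine sum_nbij' (fun p => p.1.support)
    (fun S => (Finsupp.indicator S fun _ _ => 1, m - Finsupp.indicator S fun _ _ => 1)) ?_ ?_ ?_ ?_ ?_
  · intro p hp
    rw [mem_filter, HasAntidiagonal.mem_antidiagonal] at hp
    rw [mem_powerset, ← hp.1]
    exact Finsupp.support_mono le_self_add
  · intro S hS
    rw [mem_powerset] at hS
    rw [mem_filter, HasAntidiagonal.mem_antidiagonal]
    refine ⟨?_, fun v => ?_⟩
    · ext v
      dsimp only
      rw [Finsupp.add_apply, Finsupp.tsub_apply, hind]
      split_ifs with h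
      · have := Finsupp.mem_support_iff.1 (hS h)
        omega
      · omega
    · dsimp only
      rw [hind]
      split_ifs <;> omega
  · intro p hp
    rw [mem_filter, HasAntidiagonal.mem_antidiagonal] at hp
    have h1 : (Finsupp.indicator p.1.support fun _ _ => 1) = p.1 := by
      ext v
      rw [hind]
      have := hp.2 v
      by_cases h : p.1 v = 0
      · rw [if_neg (Finsupp.notMem_support_iff.2 h), h]
      · rw [if_pos (Finsupp.mem_support_iff.2 h)]
        omega
    refine Prod.ext h1 ?_
    dsimp only
    rw [h1, ← hp.1, add_tsub_cancel_left]
  · intro S _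
    ext v
    dsimp only
    rw [Finsupp.mem_support_iff, hind]
    simp
  · intro p hp
    rw [mem_filter] at hp
    rw [Finsupp.degree_apply, card_eq_sum_ones]
    congr 1
    refine sum_congr rfl fun v hv => ?_
    have h1 := hp.2 v
    have h2 := Finsupp.mem_support_iff.1 hv
    omega

section Elementary

variable {ι : Type*}

open Classical in
/-- The elementary symmetric function `e_n` in the alphabet of `U`. -/
def eSym (U : ι) (n : ℕ) : MvPowerSeries (ι × ℕ) ℤ := fun m =>
  if degs m = Finsupp.single U n ∧ ∀ v, m v ≤ 1 then 1 else 0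

open Classical in
theorem coeff_eSym (m : ι × ℕ →₀ ℕ) (U : ι) (n : ℕ) : coeff m (eSym U n) =
    if degs m = Finsupp.single U n ∧ ∀ v, m v ≤ 1 then 1 else 0 := rfl

theorem eSym_zero (U : ι) : eSym U 0 = 1 := by
  classical
  ext1 m
  rw [coeff_eSym, MvPowerSeries.coeff_one, Finsupp.single_zero]
  congr 1
  rw [eq_iff_iff]
  constructor
  · rintro ⟨h, -⟩
    rw [← Finsupp.degree_eq_zero_iff, ← degree_degs, h, map_zero]
  · rintro rfl
    exact ⟨by rw [degs, Finsupp.mapDomain_zero], fun v => Nat.zero_le 1⟩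

/-- At a monomial of the alphabet of `U` of degree `n`, each squarefree divisor contributes its sign
exactly once; other monomials do not occur at all. -/
theorem sum_eSym_mul_hSym (U : ι) {n : ℕ} (hn : n ≠ 0) :
    ∑ p ∈ antidiagonal n, ((-1 : ℤ) ^ p.1 • eSym U p.1) * hSym U p.2 = 0 := by
  classical
  ext1 m
  rw [map_sum, map_zero]
  simp_rw [smul_mul_assoc, map_zsmul, MvPowerSeries.coeff_mul, coeff_eSym, coeff_hSym, smul_sum]
  rw [sum_comm]
  by_cases hm : degs m = Finsupp.single U n
  · have hdeg : m.degree = n := by rw [← degree_degs, hm, Finsupp.degree_single]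
    have hm0 : m ≠ 0 := by
      rintro rfl
      rw [map_zero] at hdeg
      exact hn hdeg.symm
    have hsupp := (forall_support_iff m U).2 (by rw [hm, hdeg])
    refine Eq.trans ?_ ((sum_filter _ _).symm.trans (sum_antidiagonal_neg_one_pow hm0))
    refine sum_congr rfl fun q hq => ?_
    rw [HasAntidiagonal.mem_antidiagonal] at hq
    have h1 : degs q.1 = Finsupp.single U q.1.degree := (forall_support_iff _ _).1 fun v hv =>
      hsupp v (Finsupp.support_mono (hq ▸ le_self_add) hv)
    have h2 : degs q.2 = Finsupp.single U q.2.degree := (forall_support_iff _ _).1 fun v hv =>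
      hsupp v (Finsupp.support_mono (hq ▸ le_add_self) hv)
    rw [sum_eq_single (q.1.degree, q.2.degree)]
    · dsimp only
      rw [if_pos h2, mul_one, smul_eq_mul]
      by_cases h3 : ∀ v, q.1 v ≤ 1
      · rw [if_pos ⟨h1, h3⟩, if_pos h3, mul_one]
      · rw [if_neg fun h => h3 h.2, if_neg h3, mul_zero]
    · intro p _ hp
      rw [h1, h2]
      by_cases h3 : q.1.degree = p.1
      · have h4 : q.2.degree ≠ p.2 := fun h4 => hp (Prod.ext h3.symm h4.symm)
        rw [if_neg fun h => h4 (Finsupp.single_injective U h), mul_zero, smul_zero]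
      · rw [if_neg fun h => h3 (Finsupp.single_injective U h.1), zero_mul, smul_zero]
    · intro h
      exfalso
      apply h
      rw [HasAntidiagonal.mem_antidiagonal, ← hdeg, ← hq, map_add]
  · refine sum_eq_zero fun q hq => sum_eq_zero fun p hp => ?_
    rw [HasAntidiagonal.mem_antidiagonal] at hq hp
    by_cases h1 : degs q.1 = Finsupp.single U p.1
    · rw [if_neg (c := degs q.2 = Finsupp.single U p.2), mul_zero, smul_zero]
      intro h2
      rw [← hq, degs_add, h1, h2, ← Finsupp.single_add, hp] at hm
      exact hm rfl
    · rw [if_neg fun h => h1 h.1, zero_mul, smul_zero]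

theorem eSym_mem_hRingAll (U : ι) (n : ℕ) : eSym U n ∈ hRingAll ι := by
  induction n using Nat.strong_induction_on with
  | _ n ih =>
    by_cases hn : n = 0
    · subst hn
      rw [eSym_zero]
      exact one_mem _
    · have h1 := sum_eSym_mul_hSym U hn
      have hmem : (n, (0 : ℕ)) ∈ antidiagonal n := by
        rw [HasAntidiagonal.mem_antidiagonal, add_zero]
      rw [← add_sum_erase _ _ hmem] at h1
      dsimp only at h1
      rw [hSym_zero, mul_one] at h1
      have h2 : (-1 : ℤ) ^ n • eSym U n ∈ hRingAll ι := by
        rw [eq_neg_of_add_eq_zero_left h1]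
        refine neg_mem (sum_mem fun p hp => ?_)
        rw [mem_erase, HasAntidiagonal.mem_antidiagonal] at hp
        have hp1 : p.2 ≠ 0 := by
          intro h
          exact hp.1 (Prod.ext (by simp; omega) h)
        exact mul_mem (zsmul_mem (ih p.1 (by omega)) _) (Subring.subset_closure ⟨(U, p.2), rfl⟩)
      have h3 := zsmul_mem h2 ((-1 : ℤ) ^ n)
      rwa [smul_smul, ← mul_pow, neg_one_mul, neg_neg, one_pow, one_smul] at h3

theorem eSym_mem_symRing (U : ι) (n : ℕ) : eSym U n ∈ symRing ι := by
  have h : hRingAll ι ≤ symRing ι := by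
    rw [hRingAll, Subring.closure_le]
    rintro _ ⟨p, rfl⟩
    exact hSym_mem_symRing p.1 p.2
  exact h (eSym_mem_hRingAll U n)

end Elementary

/-! ### Monomial symmetric functions -/

section MonomialSymmetric

variable {ι : Type*}

open Classical in
/-- The sum of all monomials with the same diagrams as a given one. -/
def orbitSum (m₀ : ι × ℕ →₀ ℕ) : MvPowerSeries (ι × ℕ) ℤ := fun m =>
  if cols m = cols m₀ then 1 else 0

open Classical in
theorem coeff_orbitSum (m m₀ : ι × ℕ →₀ ℕ) :
    coeff m (orbitSum m₀) = if cols m = cols m₀ then 1 else 0 := rfl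

theorem orbitSum_mem_symRing (m₀ : ι × ℕ →₀ ℕ) : orbitSum m₀ ∈ symRing ι :=
  mem_symRing_of_cols fun m m' h => by rw [coeff_orbitSum, coeff_orbitSum, h]

/-- The multipartitions with prescribed sizes. -/
def multipartitionsOf (d : ι →₀ ℕ) : Finset (Multipartition ι) :=
  (finite_setOf_degs_rowMono d).toFinset

theorem mem_multipartitionsOf {d : ι →₀ ℕ} {lam : Multipartition ι} :
    lam ∈ multipartitionsOf d ↔ degs (rowMono lam) = d :=
  Set.Finite.mem_toFinset _

/-- A symmetric series of fixed multidegree is constant on the finitely many orbits of that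
multidegree, so its values at the representatives determine it. -/
theorem eq_sum_orbitSum {f : MvPowerSeries (ι × ℕ) ℤ} (hf : f ∈ symRing ι) {d : ι →₀ ℕ}
    (hd : ∀ m, coeff m f ≠ 0 → degs m = d) :
    f = ∑ lam ∈ multipartitionsOf d, coeff (rowMono lam) f • orbitSum (rowMono lam) := by
  classical
  ext1 m
  rw [map_sum]
  simp_rw [map_zsmul, coeff_orbitSum]
  by_cases hm : degs m = d
  · obtain ⟨lam, hlam⟩ := exists_cols_rowMono m
    rw [sum_eq_single lam, if_pos hlam.symm, smul_eq_mul, mul_one, coeff_eq_of_cols_eq hf hlam]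
    · intro mu _ hmu
      rw [if_neg, smul_zero]
      intro h
      exact hmu (eq_of_cols_rowMono_eq (h.symm.trans hlam.symm))
    · intro h
      exact absurd (mem_multipartitionsOf.2 ((degs_eq_of_cols_eq hlam).trans hm)) h
  · rw [sum_eq_zero]
    · by_contra h
      exact hm (hd m h)
    · intro lam hlam
      rw [if_neg, smul_zero]
      intro h
      exact hm ((degs_eq_of_cols_eq h).trans (mem_multipartitionsOf.1 hlam))

theorem card_support_eq_of_cols_eq {m m' : ι × ℕ →₀ ℕ} (h : cols m = cols m') :
    #m.support = #m'.support := by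
  obtain ⟨π, -, rfl⟩ := exists_perm_of_cols_eq h
  rw [Finsupp.support_embDomain, card_map]

/-- Adding a first column. -/
theorem cols_add_column {U : ι} {a c : ι × ℕ →₀ ℕ} (ha : ∀ v, a v ≤ 1)
    (haU : ∀ v ∈ a.support, v.1 = U) (hc : ∀ v, v.1 = U → c v ≠ 0 → a v = 1) :
    cols (a + c) U 0 = #a.support ∧ (∀ k, cols (a + c) U (k + 1) = cols c U k) ∧
      ∀ V, V ≠ U → cols (a + c) V = cols c V := by
  classical
  refine ⟨?_, fun k => ?_, fun V hV => ?_⟩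
  · rw [cols]
    congr 1
    ext v
    rw [mem_filter, Finsupp.mem_support_iff, Finsupp.add_apply, Finsupp.mem_support_iff]
    constructor
    · rintro ⟨h1, h2, -⟩
      have := hc v h2
      omega
    · intro h1
      exact ⟨by omega, haU v (Finsupp.mem_support_iff.2 h1), by omega⟩
  · rw [cols_eq_card c U k (s := (a + c).support)]
    · rw [cols]
      congr 1
      ext v
      rw [mem_filter, mem_filter, Finsupp.mem_support_iff, Finsupp.add_apply]
      have h1 := ha v
      constructor
      · rintro ⟨h2, h3, h4⟩
        exact ⟨h2, h3, by omega⟩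
      · rintro ⟨h2, h3, h4⟩
        have := hc v h3
        exact ⟨h2, h3, by omega⟩
    · intro v _ hv
      rw [Finsupp.mem_support_iff, Finsupp.add_apply]
      omega
  · ext k
    rw [cols_eq_card c V k (s := (a + c).support)]
    · rw [cols]
      congr 1
      ext v
      rw [mem_filter, mem_filter]
      refine and_congr_right fun _ => and_congr_right fun h => ?_
      have h1 : a v = 0 := by
        by_contra h1
        exact hV (h ▸ haU v (Finsupp.mem_support_iff.2 h1))
      rw [Finsupp.add_apply, h1, zero_add]
    · intro v _ hv
      rw [Finsupp.mem_support_iff, Finsupp.add_apply]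
      omega

theorem eq_of_cols_add_column {U : ι} {a c a' c' : ι × ℕ →₀ ℕ} (ha : ∀ v, a v ≤ 1)
    (haU : ∀ v ∈ a.support, v.1 = U) (hc : ∀ v, v.1 = U → c v ≠ 0 → a v = 1)
    (ha' : ∀ v, a' v ≤ 1)
    (haU' : ∀ v ∈ a'.support, v.1 = U) (hc' : ∀ v, v.1 = U → c' v ≠ 0 → a' v = 1)
    (h1 : #a.support = #a'.support) (h2 : cols c = cols c') : cols (a + c) = cols (a' + c') := by
  obtain ⟨e1, e2, e3⟩ := cols_add_column ha haU hc
  obtain ⟨e1', e2', e3'⟩ := cols_add_column ha' haU' hc'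
  ext V k
  by_cases hV : V = U
  · subst hV
    obtain _ | k := k
    · rw [e1, e1', h1]
    · rw [e2, e2', h2]
  · rw [e3 V hV, e3' V hV, h2]

theorem card_support_eq_degree {a : ι × ℕ →₀ ℕ} (ha : ∀ v, a v ≤ 1) : #a.support = a.degree := by
  rw [Finsupp.degree_apply, card_eq_sum_ones]
  refine sum_congr rfl fun v hv => ?_
  have h1 := ha v
  have h2 := Finsupp.mem_support_iff.1 hv
  omega

/-- Adding `a` only affects variables of the alphabet of `U`; the variables of the other alphabets
occur equally often on both sides. -/
theorem card_support_add {U : ι} {a c : ι × ℕ →₀ ℕ} (haU : ∀ v ∈ a.support, v.1 = U) :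
    #(a + c).support + cols c U 0 = cols (a + c) U 0 + #c.support := by
  classical
  have h : ∀ m : ι × ℕ →₀ ℕ, #m.support = cols m U 0 + #{v ∈ m.support | ¬v.1 = U} := by
    intro m
    rw [← card_filter_add_card_filter_not (s := m.support) (fun v => v.1 = U), cols]
    congr 2
    ext v
    rw [mem_filter, mem_filter, Finsupp.mem_support_iff]
    exact ⟨fun h => ⟨h.1, h.2, by omega⟩, fun h => ⟨h.1, h.2.1⟩⟩
  have h2 : #{v ∈ (a + c).support | ¬v.1 = U} = #{v ∈ c.support | ¬v.1 = U} := by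
    congr 1
    ext v
    rw [mem_filter, mem_filter, Finsupp.mem_support_iff, Finsupp.mem_support_iff]
    refine and_congr_left fun h => ?_
    have h1 : a v = 0 := by
      by_contra h1
      exact h (haU v (Finsupp.mem_support_iff.2 h1))
    rw [Finsupp.add_apply, h1, zero_add]
  rw [h (a + c), h c, h2]
  omega

theorem card_support_le_cols {U : ι} {a c : ι × ℕ →₀ ℕ} (haU : ∀ v ∈ a.support, v.1 = U) :
    #a.support ≤ cols (a + c) U 0 := by
  classical
  refine card_le_card fun v hv => ?_
  have := Finsupp.mem_support_iff.1 hv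
  rw [mem_filter, Finsupp.mem_support_iff, Finsupp.add_apply]
  exact ⟨by omega, haU v hv, by omega⟩

/-- The variables of the alphabet of `U` that occur in `a + c` include the support of `a`, and equal
cardinality makes the two sets coincide. -/
theorem support_eq_of_cols_eq {U : ι} {a c : ι × ℕ →₀ ℕ} (ha : ∀ v, a v ≤ 1)
    (haU : ∀ v ∈ a.support, v.1 = U) (h : cols (a + c) U 0 = #a.support) :
    ∀ v, v.1 = U → (a + c) v ≠ 0 → a v = 1 := by
  classical
  intro v hv hne
  have h1 : a.support ⊆ {v ∈ (a + c).support | v.1 = U ∧ 0 < (a + c) v} := by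
    intro v hv
    have := Finsupp.mem_support_iff.1 hv
    rw [mem_filter, Finsupp.mem_support_iff, Finsupp.add_apply]
    exact ⟨by omega, haU v hv, by omega⟩
  have h2 := eq_of_subset_of_card_le h1 h.le
  have h3 : v ∈ a.support := by
    rw [h2, mem_filter, Finsupp.mem_support_iff]
    exact ⟨hne, hv, Nat.pos_of_ne_zero hne⟩
  have h4 := Finsupp.mem_support_iff.1 h3
  have := ha v
  omega

/-- Monomial symmetric functions are polynomials in the complete symmetric functions. -/
theorem orbitSum_mem_hRingAll (m₀ : ι × ℕ →₀ ℕ) : orbitSum m₀ ∈ hRingAll ι := by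
  classical
  -- The outer induction is on the degree, the inner one on the degree minus the number of
  -- variables: stripping a column lowers the degree, and the error terms have the same degree but
  -- more variables.
  induction hN : m₀.degree using Nat.strong_induction_on generalizing m₀ with
  | _ N ih =>
  induction hK : N - #m₀.support using Nat.strong_induction_on generalizing m₀ with
  | _ K ihK =>
    subst hN
    subst hK
    by_cases h0 : m₀ = 0
    · subst h0
      have : orbitSum (0 : ι × ℕ →₀ ℕ) = 1 := by
        ext1 m
        rw [coeff_orbitSum, MvPowerSeries.coeff_one]
        congr 1
        rw [eq_iff_iff]
        constructor
        · intro h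
          rw [← Finsupp.degree_eq_zero_iff, ← degree_degs, degs_eq_of_cols_eq h, degree_degs,
            map_zero]
        · rintro rfl
          rfl
      rw [this]
      exact one_mem _
    obtain ⟨v₀, hv₀⟩ := Finsupp.support_nonempty_iff.2 h0
    set U := v₀.1 with hU
    -- The first column of the diagram in one alphabet `U` that occurs in `m₀`: each variable of
    -- that alphabet in `m₀`, once.
    set a₀ : ι × ℕ →₀ ℕ := Finsupp.indicator {v ∈ m₀.support | v.1 = U} fun _ _ => 1 with ha₀d
    have ha₀ : ∀ v, a₀ v = if v ∈ m₀.support ∧ v.1 = U then 1 else 0 := by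
      intro v
      rw [ha₀d, Finsupp.indicator_apply]
      simp only [mem_filter, dite_eq_ite]
    have ha₀1 : ∀ v, a₀ v ≤ 1 := by
      intro v
      rw [ha₀]
      split_ifs <;> omega
    have ha₀U : ∀ v ∈ a₀.support, v.1 = U := by
      intro v hv
      have h1 := Finsupp.mem_support_iff.1 hv
      rw [ha₀] at h1
      exact (ite_ne_right_iff.1 h1).1.2
    set c₀ := m₀ - a₀ with hc₀
    have hac : a₀ + c₀ = m₀ := by
      refine add_tsub_cancel_of_le fun v => ?_
      rw [ha₀]
      split_ifs with h
      · exact Nat.pos_of_ne_zero (Finsupp.mem_support_iff.1 h.1)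
      · exact Nat.zero_le _
    have hm₀a : ∀ v, v.1 = U → m₀ v ≠ 0 → a₀ v = 1 := fun v hv hne => by
      rw [ha₀, if_pos ⟨Finsupp.mem_support_iff.2 hne, hv⟩]
    have hc₀a : ∀ v, v.1 = U → c₀ v ≠ 0 → a₀ v = 1 := fun v hv hne => by
      refine hm₀a v hv ?_
      rw [← hac, Finsupp.add_apply]
      omega
    set n := #a₀.support with hn
    have hn0 : 0 < n := by
      refine card_pos.2 ⟨v₀, ?_⟩
      rw [Finsupp.mem_support_iff, ha₀, if_pos ⟨hv₀, hU.symm⟩]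
      exact one_ne_zero
    have hna : n = a₀.degree := card_support_eq_degree ha₀1
    have hdega : degs a₀ = Finsupp.single U n := by
      rw [hna]
      exact (forall_support_iff a₀ U).1 ha₀U
    have hcols₀ : cols m₀ U 0 = n := by
      have := (cols_add_column ha₀1 ha₀U hc₀a).1
      rwa [hac] at this
    set f := eSym U n * orbitSum c₀ with hf
    have hfmem : f ∈ hRingAll ι := by
      refine mul_mem (eSym_mem_hRingAll U n) (ih c₀.degree ?_ c₀ rfl)
      rw [← hac, map_add, ← hna]
      omega
    have hfsym : f ∈ symRing ι := mul_mem (eSym_mem_symRing U n) (orbitSum_mem_symRing c₀)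
    have hfne : ∀ m, coeff m f ≠ 0 → ∃ a c, a + c = m ∧ (∀ v, a v ≤ 1) ∧
        (∀ v ∈ a.support, v.1 = U) ∧ degs a = Finsupp.single U n ∧ #a.support = n ∧
        cols c = cols c₀ := by
      intro m hm
      rw [hf, MvPowerSeries.coeff_mul] at hm
      obtain ⟨p, hp, h⟩ := exists_ne_zero_of_sum_ne_zero hm
      have h1 := left_ne_zero_of_mul h
      have h2 := right_ne_zero_of_mul h
      rw [coeff_eSym] at h1
      rw [coeff_orbitSum] at h2
      obtain ⟨h3, h4⟩ := (ite_ne_right_iff.1 h1).1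
      have h5 : p.1.degree = n := by rw [← degree_degs, h3, Finsupp.degree_single]
      refine ⟨p.1, p.2, HasAntidiagonal.mem_antidiagonal.1 hp, h4, ?_, h3, ?_,
        (ite_ne_right_iff.1 h2).1⟩
      · rw [forall_support_iff, h5, h3]
      · rw [card_support_eq_degree h4, h5]
    have hfdeg : ∀ m, coeff m f ≠ 0 → degs m = degs m₀ := by
      intro m hm
      obtain ⟨a, c, rfl, -, -, h1, -, h2⟩ := hfne m hm
      rw [degs_add, h1, degs_eq_of_cols_eq h2, ← hdega, ← degs_add, hac]
    -- The only way to obtain `m₀` is to take the whole first column, since a squarefree factor with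
    -- `n` variables must use all `n` variables of the alphabet of `U` in `m₀`.
    have hf1 : coeff m₀ f = 1 := by
      rw [hf, MvPowerSeries.coeff_mul, sum_eq_single (a₀, c₀)]
      · dsimp only
        rw [coeff_eSym, if_pos ⟨hdega, ha₀1⟩, coeff_orbitSum, if_pos rfl, mul_one]
      · rintro ⟨a, c⟩ hp hne
        rw [HasAntidiagonal.mem_antidiagonal] at hp
        dsimp only at hp ⊢
        by_contra h
        have h1 := left_ne_zero_of_mul h
        rw [coeff_eSym] at h1
        obtain ⟨h3, h4⟩ := (ite_ne_right_iff.1 h1).1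
        have h5 : a.degree = n := by rw [← degree_degs, h3, Finsupp.degree_single]
        have h6 : ∀ v ∈ a.support, v.1 = U := by rw [forall_support_iff, h5, h3]
        have h7 : #a.support = n := by rw [card_support_eq_degree h4, h5]
        have h8 := support_eq_of_cols_eq h4 h6 (c := c) (by rw [hp, h7, hcols₀])
        rw [hp] at h8
        have h9 : a = a₀ := by
          ext v
          rw [ha₀]
          split_ifs with hv
          · exact h8 v hv.2 (Finsupp.mem_support_iff.1 hv.1)
          · by_contra hav
            refine hv ⟨?_, h6 v (Finsupp.mem_support_iff.2 hav)⟩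
            rw [← hp, Finsupp.mem_support_iff, Finsupp.add_apply]
            omega
        subst h9
        rw [← hac] at hp
        exact hne (Prod.ext rfl (add_left_cancel hp))
      · intro h
        exfalso
        apply h
        rw [HasAntidiagonal.mem_antidiagonal]
        exact hac
    obtain ⟨lam₀, hlam₀⟩ := exists_cols_rowMono m₀
    have hexp := eq_sum_orbitSum hfsym hfdeg
    rw [← add_sum_erase _ _ (mem_multipartitionsOf.2 (degs_eq_of_cols_eq hlam₀)),
      coeff_eq_of_cols_eq hfsym hlam₀, hf1, one_smul] at hexp
    have horb : orbitSum (rowMono lam₀) = orbitSum m₀ := by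
      ext1 m
      rw [coeff_orbitSum, coeff_orbitSum, hlam₀]
    rw [horb] at hexp
    rw [← sub_eq_iff_eq_add] at hexp
    rw [← hexp]
    refine sub_mem hfmem (sum_mem fun lam hlam => ?_)
    rw [mem_erase, mem_multipartitionsOf] at hlam
    by_cases hz : coeff (rowMono lam) f = 0
    · rw [hz, zero_smul]
      exact zero_mem _
    · refine zsmul_mem ?_ _
      obtain ⟨a, c, hac', h1, h2, -, h3, h4⟩ := hfne _ hz
      have hdeg : (rowMono lam).degree = m₀.degree := by
        rw [← degree_degs, hlam.2, degree_degs]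
      -- If the new column does not sit on top of the variables of `c`, more variables of the
      -- alphabet of `U` occur; if it does, the diagrams are those of `m₀`, which has been split
      -- off.
      have hgt : #m₀.support < #(rowMono lam).support := by
        have e1 := card_support_add (c := c) h2
        have e2 := card_support_add (c := c₀) ha₀U
        rw [hac', h4, card_support_eq_of_cols_eq h4] at e1
        rw [hac, hcols₀] at e2
        have e3 := card_support_le_cols (c := c) h2
        rw [hac', h3] at e3
        have e4 : cols (rowMono lam) U 0 ≠ n := by
          intro e4
          refine hlam.1 (eq_of_cols_rowMono_eq ?_)
          rw [hlam₀, ← hac, ← hac']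
          have h8 := support_eq_of_cols_eq h1 h2 (c := c) (by rw [hac', e4, h3])
          refine eq_of_cols_add_column h1 h2 (fun v hv hne => h8 v hv ?_) ha₀1 ha₀U hc₀a h3 h4
          rw [Finsupp.add_apply]
          omega
        omega
      refine ihK _ ?_ _ hdeg rfl
      have hle : #(rowMono lam).support ≤ m₀.degree := by
        rw [← hdeg, Finsupp.degree_apply, card_eq_sum_ones]
        exact sum_le_sum fun v hv => Nat.pos_of_ne_zero (Finsupp.mem_support_iff.1 hv)
      omega

end MonomialSymmetric

end

end GInf

namespace GInf

set_option linter.unusedSectionVars false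

noncomputable section

open MvPowerSeries Finset

/-! ### Expansion of a symmetric family in Schur functions -/

section Inversion

variable {ι : Type*}

theorem finsum_multiSchur_smul {A : Type*} [AddCommGroup A] (Z : Multipartition ι → A)
    (m : ι × ℕ →₀ ℕ) : ∑ᶠ lam : Multipartition ι, coeff m (multiSchur lam) • Z lam =
      ∑ lam ∈ multipartitionsOf (degs m), coeff m (multiSchur lam) • Z lam := by
  refine finsum_eq_sum_of_support_subset _ fun lam hlam => ?_
  rw [mem_coe, mem_multipartitionsOf]
  exact (degs_eq_of_coeff_multiSchur_ne_zero fun h => hlam (by simp only [h, zero_smul])).symm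

open Classical in
/-- The matrix of the Schur functions in the monomial symmetric functions of a fixed degree is
invertible over the integers. -/
theorem exists_inverse_multiSchur (d : ι →₀ ℕ) :
    ∃ Q : Multipartition ι → Multipartition ι → ℤ,
      (∀ l ∈ multipartitionsOf d, ∀ l' ∈ multipartitionsOf d,
        ∑ k ∈ multipartitionsOf d, coeff (rowMono l) (multiSchur k) * Q k l' =
          if l = l' then 1 else 0) ∧
      ∀ k ∈ multipartitionsOf d, ∀ k' ∈ multipartitionsOf d,
        ∑ l ∈ multipartitionsOf d, Q k l * coeff (rowMono l) (multiSchur k') =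
          if k = k' then 1 else 0 := by
  have h1 : ∀ l : Multipartition ι, ∃ c : Multipartition ι →₀ ℤ,
      (c.sum fun k n => n • multiSchur k) = orbitSum (rowMono l) := fun l =>
    Finsupp.mem_span_range_iff_exists_finsupp.1 (mem_span_multiSchur (orbitSum_mem_hRingAll _))
  choose c hc using h1
  have h2 : ∀ l ∈ multipartitionsOf d, ∀ l' ∈ multipartitionsOf d,
      ∑ k ∈ multipartitionsOf d, coeff (rowMono l) (multiSchur k) * c l' k =
        if l = l' then 1 else 0 := by
    intro l hl l' hl'
    have h3 := congrArg (coeff (rowMono l)) (hc l')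
    rw [coeff_orbitSum, Finsupp.sum, map_sum] at h3
    have h4 : (if l = l' then (1 : ℤ) else 0) =
        if cols (rowMono l) = cols (rowMono l') then 1 else 0 :=
      if_congr ⟨fun h => h ▸ rfl, fun h => eq_of_cols_rowMono_eq h⟩ rfl rfl
    rw [h4, ← h3]
    have h5 : ∀ k, k ∉ multipartitionsOf d → coeff (rowMono l) (multiSchur k) = 0 := by
      intro k hk
      by_contra h
      rw [mem_multipartitionsOf] at hk hl
      exact hk ((degs_eq_of_coeff_multiSchur_ne_zero h).symm.trans hl)
    have h6 : ∀ k, coeff (rowMono l) (c l' k • multiSchur k) =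
        coeff (rowMono l) (multiSchur k) * c l' k := fun k => by
      rw [map_zsmul, smul_eq_mul, mul_comm]
    simp_rw [h6]
    -- The expansion of an orbit sum may involve Schur functions of other multidegrees, but these
    -- vanish at the monomials of degree `d`; both sums are extended to a common index set.
    rw [sum_subset (subset_union_left (s₁ := multipartitionsOf d) (s₂ := (c l').support))
        fun k _ hk => by rw [h5 k hk, zero_mul],
      sum_subset (subset_union_right (s₁ := multipartitionsOf d) (s₂ := (c l').support))
        fun k _ hk => by rw [Finsupp.notMem_support_iff.1 hk, mul_zero]]
  refine ⟨fun k l => c l k, h2, ?_⟩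
  let C : Matrix {l // l ∈ multipartitionsOf d} {l // l ∈ multipartitionsOf d} ℤ :=
    Matrix.of fun l k => coeff (rowMono l.1) (multiSchur k.1)
  let D : Matrix {l // l ∈ multipartitionsOf d} {l // l ∈ multipartitionsOf d} ℤ :=
    Matrix.of fun k l => c l.1 k.1
  have h3 : C * D = 1 := by
    ext l l'
    rw [Matrix.mul_apply, Matrix.one_apply]
    refine (sum_coe_sort (multipartitionsOf d)
      (fun k => coeff (rowMono l.1) (multiSchur k) * c l'.1 k)).trans ?_
    rw [h2 l.1 l.2 l'.1 l'.2]
    exact if_congr Subtype.ext_iff.symm rfl rfl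
  intro k hk k' hk'
  -- The matrices are square, so a right inverse is also a left inverse; the former yields existence
  -- of the expansion below, the latter its uniqueness.
  have h4 : (D * C) ⟨k, hk⟩ ⟨k', hk'⟩ = (1 : Matrix {l // l ∈ multipartitionsOf d} {l // l ∈ multipartitionsOf d} ℤ)
      ⟨k, hk⟩ ⟨k', hk'⟩ := by
    rw [mul_eq_one_comm.1 h3]
  rw [Matrix.mul_apply, Matrix.one_apply] at h4
  refine ((sum_coe_sort (multipartitionsOf d)
    (fun l => c l k * coeff (rowMono l) (multiSchur k'))).symm.trans h4).trans ?_
  exact if_congr Subtype.ext_iff rfl rfl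

/-- A symmetric family is the family of monomial coefficients of a unique expansion in Schur
functions, which has the same integral span. -/
theorem exists_schur_expansion {A : Type*} [AddCommGroup A] (γ : (ι × ℕ →₀ ℕ) → A)
    (hγ : ∀ m m', cols m = cols m' → γ m = γ m') :
    ∃ Z : Multipartition ι → A,
      (∀ m, ∑ᶠ lam : Multipartition ι, coeff m (multiSchur lam) • Z lam = γ m) ∧
      (∀ Z' : Multipartition ι → A,
        (∀ m, ∑ᶠ lam : Multipartition ι, coeff m (multiSchur lam) • Z' lam = γ m) → Z' = Z) ∧
      Submodule.span ℤ (Set.range Z) = Submodule.span ℤ (Set.range γ) := by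
  classical
  choose Q hQ hQ' using exists_inverse_multiSchur (ι := ι)
  have hZ : ∀ m, ∑ᶠ lam : Multipartition ι, coeff m (multiSchur lam) •
      (∑ l ∈ multipartitionsOf (degs (rowMono lam)), Q (degs (rowMono lam)) lam l • γ (rowMono l)) =
        γ m := by
    intro m
    rw [finsum_multiSchur_smul]
    obtain ⟨l, hl⟩ := exists_cols_rowMono m
    have hd := degs_eq_of_cols_eq hl
    have hlm : l ∈ multipartitionsOf (degs m) := mem_multipartitionsOf.2 (by rw [hd])
    calc _ = ∑ k ∈ multipartitionsOf (degs m), ∑ l' ∈ multipartitionsOf (degs m),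
          (coeff (rowMono l) (multiSchur k) * Q (degs m) k l') • γ (rowMono l') := by
          refine sum_congr rfl fun k hk => ?_
          rw [mem_multipartitionsOf.1 hk, smul_sum, coeff_eq_of_cols_eq (multiSchur_mem_symRing k) hl]
          exact sum_congr rfl fun l' _ => (mul_smul _ _ _).symm
      _ = ∑ l' ∈ multipartitionsOf (degs m), if l = l' then γ (rowMono l') else 0 := by
          rw [sum_comm]
          refine sum_congr rfl fun l' hl' => ?_
          rw [← sum_smul, hQ _ l hlm l' hl', ite_smul, one_smul, zero_smul]
      _ = γ m := by
          rw [sum_ite_eq, if_pos hlm]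
          exact hγ _ _ hl
  refine ⟨_, hZ, fun Z' hZ' => funext fun k => ?_, le_antisymm ?_ ?_⟩
  · have hk : k ∈ multipartitionsOf (degs (rowMono k)) := mem_multipartitionsOf.2 rfl
    calc Z' k = ∑ k' ∈ multipartitionsOf (degs (rowMono k)), if k = k' then Z' k' else 0 := by
          rw [sum_ite_eq, if_pos hk]
      _ = ∑ k' ∈ multipartitionsOf (degs (rowMono k)), ∑ l ∈ multipartitionsOf (degs (rowMono k)),
          (Q (degs (rowMono k)) k l * coeff (rowMono l) (multiSchur k')) • Z' k' := by
          refine sum_congr rfl fun k' hk' => ?_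
          rw [← sum_smul, hQ' _ k hk k' hk', ite_smul, one_smul, zero_smul]
      _ = _ := by
          rw [sum_comm]
          refine sum_congr rfl fun l hl => ?_
          rw [← hZ' (rowMono l), finsum_multiSchur_smul, mem_multipartitionsOf.1 hl, smul_sum]
          exact sum_congr rfl fun k' _ => mul_smul _ _ _
  · rw [Submodule.span_le]
    rintro _ ⟨k, rfl⟩
    exact sum_mem fun l _ => zsmul_mem (Submodule.subset_span (Set.mem_range_self _)) _
  · rw [Submodule.span_le]
    rintro _ ⟨m, rfl⟩
    rw [← hZ m, finsum_multiSchur_smul]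
    exact sum_mem fun l _ => zsmul_mem (Submodule.subset_span (Set.mem_range_self l)) _

end Inversion

end

end GInf

namespace GInf

set_option linter.unusedSectionVars false

noncomputable section

open MvPowerSeries Finset
open scoped TensorProduct

/-! ### The integral form and the presented ring -/

section Integral

variable {R : Type*} [Ring R] {ι : Type*} (b : Module.Basis ι ℤ R)

theorem exists_rational_basis : ∃ β : Module.Basis ι ℚ (RatExt R), ∀ i, β i = toRat (b i) :=
  ⟨(Algebra.TensorProduct.basis ℚ b : Module.Basis ι ℚ (ℚ ⊗[ℤ] R)),
    fun i => Algebra.TensorProduct.basis_apply b i⟩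

/-- The symbol of a coefficient is a product over variables in which only their alphabets and
exponents enter, so permuting variables within alphabets does not change it. -/
theorem coeff_genFun_eq_of_cols_eq {m m' : ι × ℕ →₀ ℕ} (h : cols m = cols m') :
    coeff m (genFun b) = coeff m' (genFun b) := by
  obtain ⟨β, -⟩ := exists_rational_basis b
  obtain ⟨π, hπ, rfl⟩ := exists_perm_of_cols_eq h
  apply sym_injective β
  rw [sym_coeff_genFun, sym_coeff_genFun, Finsupp.prod, Finsupp.prod, Finsupp.support_embDomain,
    Finset.prod_map]
  refine prod_congr rfl fun v _ => ?_
  rw [Finsupp.embDomain_apply_self, Equiv.toEmbedding_apply, hπ]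

theorem existsUnique_isZFamily : ∃! Z : Multipartition ι → GQ R, IsZFamily b Z := by
  obtain ⟨Z, h1, h2, -⟩ := exists_schur_expansion (fun m => coeff m (genFun b))
    fun m m' h => coeff_genFun_eq_of_cols_eq b h
  exact ⟨Z, h1, h2⟩

theorem GZ_eq_span : GZ b = Submodule.span ℤ (Set.range fun m => coeff m (genFun b)) := by
  obtain ⟨W, h1, h2, h3⟩ := exists_schur_expansion (fun m => coeff m (genFun b))
    fun m m' h => coeff_genFun_eq_of_cols_eq b h
  -- Existence makes the chosen family a solution, and uniqueness identifies it with the one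
  -- constructed.
  have h4 : Z b = W := h2 _ (Classical.epsilon_spec (p := IsZFamily b) ⟨W, h1⟩)
  rw [GZ, h4, h3]

variable (hb : ∀ i j : ι, b i * b j = 0 ∨ ∃ k : ι, b i * b j = b k)

theorem presentedHom_gen (β : Module.Basis ι ℚ (RatExt R)) (r : ℕ+) (i : ι) :
    presentedHom b β hb (RingQuot.mkRingHom (Rel b) (gen r i)) = e r (b i) := by
  rw [presentedHom_mk, freeHom_gen]

theorem range_presentedHom (β : Module.Basis ι ℚ (RatExt R)) :
    (presentedHom b β hb).range =
      Subring.closure {x : GQ R | ∃ (r : ℕ+) (i : ι), x = e (r : ℕ) (b i)} := by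
  apply le_antisymm
  · rintro _ ⟨x, rfl⟩
    obtain ⟨z, rfl⟩ := RingQuot.mkRingHom_surjective _ x
    rw [presentedHom_mk]
    induction z using FreeAlgebra.induction with
    | grade0 n =>
      rw [AlgHom.commutes, eq_intCast]
      exact intCast_mem _ n
    | grade1 p =>
      exact Subring.subset_closure ⟨p.1, p.2, freeHom_gen b p.1 p.2⟩
    | mul x y hx hy => rw [map_mul]; exact mul_mem hx hy
    | add x y hx hy => rw [map_add]; exact add_mem hx hy
  · rw [Subring.closure_le]
    rintro _ ⟨r, i, rfl⟩
    exact ⟨_, presentedHom_gen b hb β r i⟩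

theorem presentedHom_injective_and_mem_range (β : Module.Basis ι ℚ (RatExt R))
    (hβ : ∀ i, β i = toRat (b i)) : Function.Injective (presentedHom b β hb) ∧
      ∀ y : GQ R, y ∈ (presentedHom b β hb).range ↔ sym β y ∈ (chi b β).range :=
  injective_and_range_sym (RingQuot.mkRingHom (Rel b)) hb
    (fun _ _ h => RingQuot.mkRingHom_rel h) hβ (RingQuot.mkRingHom_surjective _)
    (presentedHom b β hb) fun p => presentedHom_gen b hb β p.1 p.2

end Integral

end

end GInf

theorem corollary5p9 {R : Type*} [Ring R] {ι : Type*} (b : Module.Basis ι ℤ R)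
    (hb : ∀ i j : ι, b i * b j = 0 ∨ ∃ k : ι, b i * b j = b k) :
    (∃! Z : GInf.Multipartition ι → GInf.GQ R, GInf.IsZFamily b Z) ∧
    (GInf.GZ b : Set (GInf.GQ R)) =
      Subring.closure {x : GInf.GQ R | ∃ (r : ℕ+) (i : ι), x = GInf.e (r : ℕ) (b i)} ∧
    ∃ φ : GInf.Presented b ≃+*
        Subring.closure {x : GInf.GQ R | ∃ (r : ℕ+) (i : ι), x = GInf.e (r : ℕ) (b i)},
      ∀ (r : ℕ+) (i : ι),
        (φ (RingQuot.mkRingHom (GInf.Rel b) (GInf.gen r i)) : GInf.GQ R) =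
          GInf.e (r : ℕ) (b i) := by
  obtain ⟨β, hβ⟩ := GInf.exists_rational_basis b
  obtain ⟨hinj, hrange⟩ := GInf.presentedHom_injective_and_mem_range b hb β hβ
  have hcl := GInf.range_presentedHom b hb β
  refine ⟨GInf.existsUnique_isZFamily b, ?_, ?_⟩
  · ext y
    -- Both sides consist of the elements whose symbol is in the range of `chi`; in particular the
    -- span of the `Z_λ` is a subring.
    rw [← hcl, SetLike.mem_coe, SetLike.mem_coe, GInf.GZ_eq_span,
      GInf.mem_span_coeff_genFun_iff b β, hrange]
  · have hbij : Function.Bijective (GInf.presentedHom b β hb).rangeRestrict :=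
      ⟨fun x y h => hinj (congrArg Subtype.val h), RingHom.rangeRestrict_surjective _⟩
    exact ⟨(RingEquiv.ofBijective _ hbij).trans (RingEquiv.subringCongr hcl),
      fun r i => GInf.presentedHom_gen b hb β r i⟩
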